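/- **Setting.** A two-qubit gate is a $4\times4$ unitary matrix with entries in $\mathbb{Q}(\sqrt2,i)$, or its inverse, applied to two distinct qubits. A one-clean-qubit computation is a circuit $C$ of such gates on $1+n$ qubits, started in $|0\rangle\langle0|\otimes I/2^n$, whose first qubit is measured at the end; $\mathrm{Prob}(0)=\mathrm{Tr}[(|0\rangle\langle0|\otimes I)\,C(|0\rangle\langle0|\otimes I/2^n)C^\dagger]$. DQC1 is the class of promise problems for which a polynomial-time uniform family of one-clean-qubit computations $C_x$ and a polynomial $q$ exist with $\mathrm{Prob}(0)\ge\frac12+\frac1{q(|x|)}$ on yes-instances and $\le\frac12-\frac1{q(|x|)}$ on no-instances. An estimation problem asks for a complex value $v(x)$ of each instance $x$, which concerns $m(x)$ qubits. It is *DQC1-complete* if (i) (membership) there are polynomial-time computable maps, using polynomially many uniformly random classical bits, that prepare from $x$ and $1^k$ a one-clean-qubit computation for the real part and one for the imaginary part, and there is a constant $B$, such that $B$ times the averages of the $\pm1$ outcomes of $M$ independent runs of each give $v(x)$ with additive error at most $1/k$, except with probability at most $2^{-s}$, for all $x$, all $k\ge1$, all $s\ge0$ and all $M\ge c\,k^2(s+1)$,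 with $c$ a constant; and (ii) (hardness) for every promise problem in DQC1 there are a polynomial-time computable map $\Phi$ to instances and a polynomial $q$ such that $\Phi(x)$ has size at most $q(m)$, with $m=m(\Phi(x))$, and every $z$ with $|z-v(\Phi(x))|\le 1/(q(m)+1)$ has $\mathrm{Re}\,z>0$ if $x$ is a yes-instance and $\mathrm{Re}\,z<0$ if $x$ is a no-instance. An instance of the *time-ordered correlation problem* is a list of two-qubit gates $g_1,\dots,g_T$ on $m$ qubits (all of them written down, so times are polynomially bounded in the input size), times $t_1\le\dots\le t_N\le T$, and operators $O_1,\dots,O_N$, each acting on at most $l$ qubits and given by an expansion in Pauli strings whose complex coefficients have finite binary expansions. Its value is $$\langle O_1(t_1)\cdots O_N(t_N)\rangle=\frac1{2^m}\mathrm{Tr}[O_1(t_1)\cdots O_N(t_N)],\qquad O_j(t_j)=U(0,t_j)\,O_j\,U(0,t_j)^\dagger,\quad U(0,t)=g_t\cdots g_1 .$$ The Pauli norm of $O=\sum_P\alpha_PP$ is $\sum_P(|\mathrm{Re}\,\alpha_P|+|\mathrm{Im}\,\alpha_P|)$. **Statement.** Let $l\ge1$. (a) The time-ordered correlation problem, where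 $N$ is part of the input and every $O_j$ has Pauli norm at most $1$ (for example, every $O_j$ is a Pauli string on at most $l$ qubits), is DQC1-complete. (b) For all constants $N\ge2$ and $K\ge1$, the time-ordered correlation problem with exactly $N$ operators, each of Pauli norm at most $K$, is DQC1-complete. -/

import Mathlib

open scoped BigOperators Matrix

/-! ### Bit-string encodings and polynomial time -/

/-- A self-delimiting (prefix-free) binary encoding: an encoded object can be read off, uniquely,
from the front of any bit string that starts with its code. -/
def IsPrefixCode {α : Type} (e : α → List Bool) : Prop :=
  ∀ (a b : α) (u v : List Bool), e a ++ u = e b ++ v → a = b ∧ u = v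

/-- The unary code `1 ⋯ 1 0` of a natural number. -/
def encUnary (n : ℕ) : List Bool := List.replicate n true ++ [false]

/-- The self-delimiting code of a list: every entry is announced by a `1`, the end by a `0`. -/
def encList {α : Type} (e : α → List Bool) : List α → List Bool
  | [] => [false]
  | a :: l => true :: (e a ++ encList e l)

/-- The code of a table with a fixed number of entries: the codes of the entries one by one. -/
def encTable {α : Type} (e : α → List Bool) : (n : ℕ) → (Fin n → α) → List Bool
  | 0, _ => []
  | n + 1, f => e (f 0) ++ encTable e n (fun i => f i.succ)

/-- The code of a natural number by its binary expansion. -/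
def encBinary (n : ℕ) : List Bool := encList (fun b => [b]) (Computability.encodeNat n)

/-- The code of an integer: a sign bit and the binary expansion of the absolute value. -/
def encInt (z : ℤ) : List Bool := decide (z < 0) :: encBinary z.natAbs

theorem isPrefixCode_unary : IsPrefixCode encUnary := by
  intro a
  induction a with
  | zero =>
    intro b u v h
    cases b with
    | zero => simpa [encUnary] using h
    | succ b => simp [encUnary, List.replicate_succ] at h
  | succ a ih =>
    intro b u v h
    cases b with
    | zero => simp [encUnary, List.replicate_succ] at h
    | succ b =>
      have := ih b u v (by simpa [encUnary, List.replicate_succ] using h)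
      exact ⟨by omega, this.2⟩

theorem isPrefixCode_bit : IsPrefixCode (fun b : Bool => [b]) := by
  intro a b u v h
  simpa using h

theorem isPrefixCode_list {α : Type} {e : α → List Bool} (he : IsPrefixCode e) :
    IsPrefixCode (encList e) := by
  intro l
  induction l with
  | nil =>
    intro l' u v h
    cases l' with
    | nil => simpa [encList] using h
    | cons b l' => simp [encList] at h
  | cons a l ih =>
    intro l' u v h
    cases l' with
    | nil => simp [encList] at h
    | cons b l' =>
      have h1 : e a ++ (encList e l ++ u) = e b ++ (encList e l' ++ v) := by
        simpa [encList] using h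
      obtain ⟨hab, h2⟩ := he _ _ _ _ h1
      obtain ⟨hl, h3⟩ := ih _ _ _ h2
      exact ⟨by rw [hab, hl], h3⟩

theorem isPrefixCode_table {α : Type} {e : α → List Bool} (he : IsPrefixCode e) (n : ℕ) :
    IsPrefixCode (encTable e n) := by
  induction n with
  | zero =>
    intro f g u v h
    exact ⟨funext fun i => i.elim0, by simpa [encTable] using h⟩
  | succ n ih =>
    intro f g u v h
    have h1 : e (f 0) ++ (encTable e n (fun i => f i.succ) ++ u)
        = e (g 0) ++ (encTable e n (fun i => g i.succ) ++ v) := by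
      simpa [encTable] using h
    obtain ⟨h0, h2⟩ := he _ _ _ _ h1
    obtain ⟨hs, h3⟩ := ih _ _ _ _ h2
    refine ⟨funext fun i => ?_, h3⟩
    refine Fin.cases h0 (fun j => ?_) i
    exact congrFun hs j

theorem isPrefixCode_binary : IsPrefixCode encBinary := by
  intro a b u v h
  obtain ⟨h1, h2⟩ := isPrefixCode_list isPrefixCode_bit _ _ _ _ h
  refine ⟨?_, h2⟩
  rw [← Computability.decode_encodeNat a, ← Computability.decode_encodeNat b, h1]

theorem isPrefixCode_int : IsPrefixCode encInt := by
  intro a b u v h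
  simp only [encInt, List.cons_append, List.cons.injEq] at h
  obtain ⟨h1, h2⟩ := h
  obtain ⟨h3, h4⟩ := isPrefixCode_binary _ _ _ _ h2
  refine ⟨?_, h4⟩
  have : (a < 0 ↔ b < 0) := by simpa using h1
  omega

/-- `f` is computable in polynomial time (by a multi-stack Turing machine), with respect to the
binary encodings `ea` of its inputs and `eb` of its outputs. -/
def PolyTime {α β : Type} (ea : α → List Bool) (eb : β → List Bool) (f : α → β) : Prop :=
  Nonempty (Turing.TM2ComputableInPolyTime ea eb f)

/-! ### Qubits, gates and circuits -/

/-- Operators on `n` qubits, as matrices in the computational basis. -/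
abbrev QOp (n : ℕ) : Type := Matrix (Fin n → Fin 2) (Fin n → Fin 2) ℂ

/-- The `4 × 4` matrix with entries `(a + b√2 + i (c + d√2)) / D`; the integers `a, b, c, d` of the
entry in row `r` and column `s` are `coef r s 0, …, coef r s 3`. -/
noncomputable def entryMatrix (D : ℕ) (coef : Fin 4 → Fin 4 → Fin 4 → ℤ) :
    Matrix (Fin 4) (Fin 4) ℂ :=
  Matrix.of fun r s =>
    (((coef r s 0 : ℂ) + (coef r s 1 : ℂ) * (Real.sqrt 2 : ℂ))
      + Complex.I * ((coef r s 2 : ℂ) + (coef r s 3 : ℂ) * (Real.sqrt 2 : ℂ))) / (D : ℂ)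

/-- A two-qubit gate in a circuit on `n` qubits: the ordered pair of wires it acts on, a `4 × 4`
unitary matrix with exactly described entries in `ℚ(√2, i)`, and a bit that tells whether the
gate or its inverse is applied. (One-qubit gates are those that ignore one of the two wires.) -/
structure Gate (n : ℕ) where
  fst : Fin n
  snd : Fin n
  fst_ne_snd : fst ≠ snd
  den : ℕ
  coef : Fin 4 → Fin 4 → Fin 4 → ℤ
  isUnitary : entryMatrix den coef ∈ Matrix.unitaryGroup (Fin 4) ℂ
  inverse : Bool

/-- The `4 × 4` unitary matrix of a gate, in the basis `|00⟩, |01⟩, |10⟩, |11⟩` of its wires. -/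
noncomputable def Gate.local4 {n : ℕ} (g : Gate n) : Matrix (Fin 4) (Fin 4) ℂ :=
  if g.inverse then (entryMatrix g.den g.coef)ᴴ else entryMatrix g.den g.coef

/-- The operator of a gate on all `n` qubits: it acts on its two wires and as the identity on
the others. (`finProdFinEquiv (a, b)` is the index `2 a + b`.) -/
noncomputable def Gate.toOp {n : ℕ} (g : Gate n) : QOp n :=
  Matrix.of fun x y =>
    open Classical in
    if ∀ w, w ≠ g.fst → w ≠ g.snd → x w = y w then
      g.local4 (finProdFinEquiv (x g.fst, x g.snd)) (finProdFinEquiv (y g.fst, y g.snd))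
    else 0

/-- The unitary `g_T ⋯ g_2 g_1` of a circuit `[g_1, g_2, …, g_T]`. -/
noncomputable def circuitOp {n : ℕ} : List (Gate n) → QOp n
  | [] => 1
  | g :: l => circuitOp l * g.toOp

/-- The binary code of a gate. -/
def encGate {n : ℕ} (g : Gate n) : List Bool :=
  encUnary g.fst ++ (encUnary g.snd ++ (encBinary g.den ++
    (encTable (encTable (encTable encInt 4) 4) 4 g.coef ++ [g.inverse])))

theorem isPrefixCode_gate (n : ℕ) : IsPrefixCode (encGate (n := n)) := by
  rintro ⟨a, b, h, D, c, hu, i⟩ ⟨a', b', h', D', c', hu', i'⟩ u v e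
  simp only [encGate, List.append_assoc] at e
  obtain ⟨e1, e⟩ := isPrefixCode_unary _ _ _ _ e
  obtain ⟨e2, e⟩ := isPrefixCode_unary _ _ _ _ e
  obtain ⟨e3, e⟩ := isPrefixCode_binary _ _ _ _ e
  obtain ⟨e4, e⟩ := isPrefixCode_table
    (isPrefixCode_table (isPrefixCode_table isPrefixCode_int 4) 4) 4 _ _ _ _ e
  obtain ⟨e5, e⟩ := isPrefixCode_bit _ _ _ _ e
  obtain rfl := Fin.ext e1
  obtain rfl := Fin.ext e2
  subst e3 e4 e5
  exact ⟨rfl, by simpa using e⟩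

/-! ### The one clean qubit model -/

/-- A one-clean-qubit computation: a circuit on `1 + n` qubits; qubit `0` is the clean one. -/
structure OneClean where
  n : ℕ
  gates : List (Gate (n + 1))

/-- The projection `|0⟩⟨0| ⊗ I` on the clean qubit being `0`. -/
def cleanProj (n : ℕ) : QOp (n + 1) :=
  Matrix.diagonal fun x => if x 0 = 0 then 1 else 0

/-- The initial state `|0⟩⟨0| ⊗ I / 2^n`. -/
noncomputable def initialState (n : ℕ) : QOp (n + 1) := ((2 : ℂ) ^ n)⁻¹ • cleanProj n

/-- The probability of the outcome `0` when the first qubit is measured at the end. -/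
noncomputable def OneClean.prob0 (C : OneClean) : ℝ :=
  (Matrix.trace (cleanProj C.n * (circuitOp C.gates * initialState C.n * (circuitOp C.gates)ᴴ))).re

/-- The binary code of a one-clean-qubit computation. -/
def encOneClean (C : OneClean) : List Bool := encUnary C.n ++ encList encGate C.gates

theorem isPrefixCode_oneClean : IsPrefixCode encOneClean := by
  rintro ⟨n, l⟩ ⟨n', l'⟩ u v e
  simp only [encOneClean, List.append_assoc] at e
  obtain ⟨e1, e⟩ := isPrefixCode_unary _ _ _ _ e
  subst e1
  obtain ⟨e2, e⟩ := isPrefixCode_list (isPrefixCode_gate _) _ _ _ _ e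
  subst e2
  exact ⟨rfl, by simpa using e⟩

/-- A promise problem over bit strings. -/
structure PromiseProblem where
  yes : Set (List Bool)
  no : Set (List Bool)
  disjoint : Disjoint yes no

/-- The complexity class DQC1: some polynomial-time uniform family of one-clean-qubit computations
accepts (outcome `0`) with probability above `1/2` on yes-instances and below `1/2` on
no-instances, each time by at least an inverse polynomial in the input length. -/
def PromiseProblem.InDQC1 (L : PromiseProblem) : Prop :=
  ∃ (C : List Bool → OneClean) (q : Polynomial ℕ),
    PolyTime (fun x => x) encOneClean C ∧
    ∀ x : List Bool,
      (x ∈ L.yes → 1 / 2 + 1 / (((q.eval x.length : ℕ) : ℝ) + 1) ≤ (C x).prob0) ∧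
      (x ∈ L.no → (C x).prob0 ≤ 1 / 2 - 1 / (((q.eval x.length : ℕ) : ℝ) + 1))

/-! ### Estimation problems and DQC1-completeness -/

/-- An estimation problem: instances with a binary encoding, each about a number of qubits, and the
complex quantity that has to be estimated. -/
structure EstimationProblem where
  Inst : Type
  enc : Inst → List Bool
  isPrefixCode : IsPrefixCode enc
  qubits : Inst → ℕ
  value : Inst → ℂ

/-- The probability of the outcome `0` when a seed of `R` bits is drawn uniformly at random, the
one-clean-qubit computation `C seed` is run and its first qubit is measured. -/
noncomputable def seededProb0 (C : List Bool → OneClean) (R : ℕ) : ℝ :=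
  (∑ r : Fin R → Bool, (C (List.ofFn r)).prob0) / 2 ^ R

/-- The probability of the outcomes `b` (`true` is the outcome `1`) in `M` independent runs that
give `0` with probability `p` each. -/
noncomputable def runsProb (p : ℝ) {M : ℕ} (b : Fin M → Bool) : ℝ :=
  ∏ i, if b i then 1 - p else p

/-- The average of the outcomes of `M` runs, where `0` counts as `+1` and `1` counts as `-1`. -/
noncomputable def runsMean {M : ℕ} (b : Fin M → Bool) : ℝ :=
  (∑ i, if b i then (-1 : ℝ) else 1) / M

/-- The probability that the estimate `B * (mean of the first series + i * mean of the second)` is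
off from `v` by more than `ε`, for two independent series of `M` runs whose outcome is `0` with
probability `p` and `p'`, respectively. -/
noncomputable def failureProb (p p' : ℝ) (M B : ℕ) (v : ℂ) (ε : ℝ) : ℝ :=
  open Classical in
  ∑ b : Fin M → Bool, ∑ b' : Fin M → Bool,
    if ε < ‖(B : ℂ) * ((runsMean b : ℂ) + Complex.I * (runsMean b' : ℂ)) - v‖ then
      runsProb p b * runsProb p' b'
    else 0

/-- The code of an instance `x`, a precision parameter `k` (in unary) and a seed `r`. -/
def EstimationProblem.encQuery (P : EstimationProblem) (y : P.Inst × ℕ × List Bool) : List Bool :=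
  P.enc y.1 ++ (encUnary y.2.1 ++ y.2.2)

/-- The problem can be solved in the one clean qubit model. A classical polynomial-time algorithm
with polynomially many random bits prepares, from the instance and the precision `1 / k`, a
one-clean-qubit computation for the real part and one for the imaginary part; the averages of
`O(k² log (1 / δ))` independent runs of each, up to a constant factor `B`, give the value with
additive error at most `1 / k`, except with probability `δ = 2 ^ (-s)`. -/
def EstimationProblem.InDQC1 (P : EstimationProblem) : Prop :=
  ∃ (Cre Cim : P.Inst × ℕ × List Bool → OneClean) (R : Polynomial ℕ) (B c : ℕ),
    PolyTime P.encQuery encOneClean Cre ∧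
    PolyTime P.encQuery encOneClean Cim ∧
    ∀ (x : P.Inst) (k s M : ℕ), 1 ≤ k → c * k ^ 2 * (s + 1) ≤ M →
      failureProb
        (seededProb0 (fun r => Cre (x, k, r)) (R.eval ((P.enc x).length + k)))
        (seededProb0 (fun r => Cim (x, k, r)) (R.eval ((P.enc x).length + k)))
        M B (P.value x) (1 / (k : ℝ)) ≤ (1 / 2 : ℝ) ^ s

/-- Every promise problem in DQC1 reduces in polynomial time to the estimation problem, on
instances of size polynomial in their number `m` of qubits, with additive precision inverse
polynomial in `m`: the sign of any such estimate of the value decides. -/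
def EstimationProblem.DQC1Hard (P : EstimationProblem) : Prop :=
  ∀ L : PromiseProblem, L.InDQC1 →
    ∃ (Φ : List Bool → P.Inst) (q : Polynomial ℕ),
      PolyTime (fun x => x) P.enc Φ ∧
      ∀ x : List Bool,
        (P.enc (Φ x)).length ≤ q.eval (P.qubits (Φ x)) ∧
        ∀ z : ℂ, ‖z - P.value (Φ x)‖ ≤ 1 / (((q.eval (P.qubits (Φ x)) : ℕ) : ℝ) + 1) →
          (x ∈ L.yes → 0 < z.re) ∧ (x ∈ L.no → z.re < 0)

/-- DQC1-completeness of an estimation problem. -/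
def EstimationProblem.DQC1Complete (P : EstimationProblem) : Prop :=
  P.InDQC1 ∧ P.DQC1Hard

/-! ### Local operators -/

/-- Labels of the four one-qubit Pauli matrices. -/
inductive Pauli where
  | I
  | X
  | Y
  | Z

/-- The Pauli matrices. -/
def Pauli.toMatrix : Pauli → Matrix (Fin 2) (Fin 2) ℂ
  | .I => !![1, 0; 0, 1]
  | .X => !![0, 1; 1, 0]
  | .Y => !![0, -Complex.I; Complex.I, 0]
  | .Z => !![1, 0; 0, -1]

/-- The binary code of a Pauli label. -/
def encPauli : Pauli → List Bool
  | .I => [false, false]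
  | .X => [true, false]
  | .Y => [true, true]
  | .Z => [false, true]

theorem isPrefixCode_pauli : IsPrefixCode encPauli := by
  intro a b u v h
  cases a <;> cases b <;> simp [encPauli] at h ⊢ <;> exact h

/-- The operator on `n` qubits that is the tensor product of the Pauli matrices `P i` on the wires
`wires i` and the identity on all other wires. -/
noncomputable def pauliOp {n s : ℕ} (wires : Fin s ↪ Fin n) (P : Fin s → Pauli) : QOp n :=
  Matrix.of fun x y =>
    open Classical in
    if ∀ w, w ∉ Set.range wires → x w = y w then
      ∏ i, (P i).toMatrix (x (wires i)) (y (wires i))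
    else 0

/-- A term `i ^ phase * mult * P` of a Pauli expansion on `s` qubits. -/
structure PauliTerm (s : ℕ) where
  mult : ℕ
  phase : Fin 4
  paulis : Fin s → Pauli

/-- The binary code of a term. -/
def encTerm {s : ℕ} (T : PauliTerm s) : List Bool :=
  encBinary T.mult ++ (encUnary T.phase ++ encTable encPauli s T.paulis)

theorem isPrefixCode_term (s : ℕ) : IsPrefixCode (encTerm (s := s)) := by
  rintro ⟨a, k, P⟩ ⟨a', k', P'⟩ u v e
  simp only [encTerm, List.append_assoc] at e
  obtain ⟨e1, e⟩ := isPrefixCode_binary _ _ _ _ e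
  obtain ⟨e2, e⟩ := isPrefixCode_unary _ _ _ _ e
  obtain ⟨e3, e⟩ := isPrefixCode_table isPrefixCode_pauli _ _ _ _ _ e
  obtain rfl := Fin.ext e2
  subst e1 e3
  exact ⟨rfl, by simpa using e⟩

/-- An operator on `n` qubits that acts on the `s` wires `wires 0, …, wires (s - 1)` only, given by
its expansion in the Pauli basis of these wires; the complex coefficients have finite binary
expansions, with `prec` binary digits after the point. -/
structure LocalOp (n : ℕ) where
  s : ℕ
  wires : Fin s ↪ Fin n
  prec : ℕ
  terms : List (PauliTerm s)

/-- The operator itself. -/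
noncomputable def LocalOp.toOp {n : ℕ} (O : LocalOp n) : QOp n :=
  (O.terms.map fun T =>
    ((T.mult : ℂ) * Complex.I ^ (T.phase : ℕ) / 2 ^ O.prec) • pauliOp O.wires T.paulis).sum

/-- The sum of the absolute values of the coefficients in the given Pauli expansion, the real and
the imaginary part of a coefficient being separate terms. -/
noncomputable def LocalOp.pauliNorm {n : ℕ} (O : LocalOp n) : ℝ :=
  (O.terms.map fun T => (T.mult : ℝ) / 2 ^ O.prec).sum

/-- The binary code of a local operator. -/
def encLocalOp {n : ℕ} (O : LocalOp n) : List Bool :=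
  encUnary O.s ++ (encTable (fun w : Fin n => encUnary w) O.s O.wires ++
    (encUnary O.prec ++ encList encTerm O.terms))

theorem isPrefixCode_localOp (n : ℕ) : IsPrefixCode (encLocalOp (n := n)) := by
  rintro ⟨s, w, d, l⟩ ⟨s', w', d', l'⟩ u v e
  simp only [encLocalOp, List.append_assoc] at e
  obtain ⟨e1, e⟩ := isPrefixCode_unary _ _ _ _ e
  subst e1
  have hw : IsPrefixCode (fun w : Fin n => encUnary w) := by
    intro a b u v h
    obtain ⟨h1, h2⟩ := isPrefixCode_unary _ _ _ _ h
    exact ⟨Fin.ext h1, h2⟩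
  obtain ⟨e2, e⟩ := isPrefixCode_table hw _ _ _ _ _ e
  obtain ⟨e3, e⟩ := isPrefixCode_unary _ _ _ _ e
  obtain ⟨e4, e⟩ := isPrefixCode_list (isPrefixCode_term _) _ _ _ _ e
  obtain rfl := DFunLike.coe_injective e2
  subst e3 e4
  exact ⟨rfl, by simpa using e⟩

/-! ### Time-ordered correlation functions -/

/-- A local operator together with the time at which it is inserted. -/
structure Probe (m : ℕ) where
  time : ℕ
  op : LocalOp m

/-- The binary code of a probe. -/
def encProbe {m : ℕ} (p : Probe m) : List Bool := encUnary p.time ++ encLocalOp p.op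

theorem isPrefixCode_probe (m : ℕ) : IsPrefixCode (encProbe (m := m)) := by
  rintro ⟨t, O⟩ ⟨t', O'⟩ u v e
  simp only [encProbe, List.append_assoc] at e
  obtain ⟨e1, e⟩ := isPrefixCode_unary _ _ _ _ e
  obtain ⟨e2, e⟩ := isPrefixCode_localOp _ _ _ _ _ e
  subst e1 e2
  exact ⟨rfl, by simpa using e⟩

/-- An instance: local dynamics on `m` qubits, as a sequence `g_1, …, g_T` of two-qubit gates, and
probes `(t_1, O_1), …, (t_N, O_N)`, where `t_1 ≤ ⋯ ≤ t_N ≤ T`, the number `N` lies in `A`, every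
`O_j` acts on at most `l` qubits and has Pauli norm at most `K`. -/
structure TOCInstance (A : Set ℕ) (l K : ℕ) where
  m : ℕ
  gates : List (Gate m)
  probes : List (Probe m)
  number_mem : probes.length ∈ A
  time_ordered : probes.Pairwise fun p p' => p.time ≤ p'.time
  time_le : ∀ p ∈ probes, p.time ≤ gates.length
  isLocal : ∀ p ∈ probes, p.op.s ≤ l
  bounded : ∀ p ∈ probes, p.op.pauliNorm ≤ K

/-- The propagator `U(0, t) = g_t ⋯ g_1` of the dynamics. -/
noncomputable def TOCInstance.U {A : Set ℕ} {l K : ℕ} (x : TOCInstance A l K) (t : ℕ) : QOp x.m :=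
  circuitOp (x.gates.take t)

/-- The operator `O(t) = U(0, t) O U(0, t)⁻¹` of a probe. -/
noncomputable def TOCInstance.evolved {A : Set ℕ} {l K : ℕ} (x : TOCInstance A l K)
    (p : Probe x.m) : QOp x.m :=
  x.U p.time * p.op.toOp * (x.U p.time)ᴴ

/-- The infinite-temperature correlation function
`⟨O_1(t_1) ⋯ O_N(t_N)⟩ = Tr [O_1(t_1) ⋯ O_N(t_N)] / 2^m`. -/
noncomputable def TOCInstance.correlation {A : Set ℕ} {l K : ℕ} (x : TOCInstance A l K) : ℂ :=
  Matrix.trace (x.probes.map x.evolved).prod / 2 ^ x.m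

/-- The binary code of an instance. -/
def encTOC {A : Set ℕ} {l K : ℕ} (x : TOCInstance A l K) : List Bool :=
  encUnary x.m ++ (encList encGate x.gates ++ encList encProbe x.probes)

theorem isPrefixCode_toc (A : Set ℕ) (l K : ℕ) :
    IsPrefixCode (encTOC (A := A) (l := l) (K := K)) := by
  rintro ⟨m, g, p, _, _, _, _, _⟩ ⟨m', g', p', _, _, _, _, _⟩ u v e
  simp only [encTOC, List.append_assoc] at e
  obtain ⟨e1, e⟩ := isPrefixCode_unary _ _ _ _ e
  subst e1
  obtain ⟨e2, e⟩ := isPrefixCode_list (isPrefixCode_gate _) _ _ _ _ e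
  obtain ⟨e3, e⟩ := isPrefixCode_list (isPrefixCode_probe _) _ _ _ _ e
  subst e2 e3
  exact ⟨rfl, by simpa using e⟩

/-- Estimating time-ordered `N`-time correlation functions, `N ∈ A`, of local dynamics on qubits
over all eigenstates, for `l`-local operators of Pauli norm at most `K`. -/
noncomputable def tocProblem (A : Set ℕ) (l K : ℕ) : EstimationProblem where
  Inst := TOCInstance A l K
  enc := encTOC
  isPrefixCode := isPrefixCode_toc A l K
  qubits := fun x => x.m
  value := fun x => x.correlation

/-! ### Structured programs for multi-stack machines -/

namespace StackProgram

open Turing Turing.TM2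

/-! Membership rests on the Hadamard test. If the clean qubit, between two Hadamard gates, controls
an operator `W` on `m` qubits, the outcome `0` has probability `1/2 + Re (Tr W / 2^m) / 2`
(`trace_hadamardTest`). A further phase `i^3` on the clean qubit replaces the real part by the
imaginary part. A spare qubit is added at the top of the register, so that a gate on the clean qubit
always has a second wire, even for `m = 0`.

The operator of interest is `O_1(t_1) ⋯ O_N(t_N)`, whose factors need not be unitary. Each `O_j` is
therefore replaced by a random term. A uniform number below `2^(prec + κ)` is drawn, and intervals
whose lengths are the multiplicities of the terms are lined up from `0`. A number inside an interval
selects its term, with its phase. A number beyond all of them selects a random sign, which averages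
to zero. The intervals fit because the Pauli norm is at most `K ≤ 2^κ`, and the average is `O_j /
2^κ` (`sumBits_opValue`). Different probes use disjoint blocks of random bits, so the average of the
product is the correlation function divided by `2^(κN)` (`sumBits_probesValue`). The factor `B =
2^(κN)` has to be a constant. This holds with `κ = 0` when the norms are at most `1` and `N` is
arbitrary, and with `κ = K` when `N` is fixed. Only the Pauli matrices and phases are controlled:
the evolution and its inverse are applied unconditionally and cancel where the clean qubit is `0`
(`conj_ctrlOp`). An exponential moment bound controls the number of runs (`failureProb_le`).

For hardness, let `P` be the projection on the clean qubit being `0`, so that `Z = 2P - 1` on that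
qubit. The normalized trace of `Z · U Z U†` is the bias `2 Prob(0) - 1` of the computation `U`
(`trace_reflection`, `re_correlation_toTOC`). Identity operators at time `0` bring the number of
probes up to `N`. Idle qubits, at least one for each bit of the input, leave the normalized trace
unchanged and make the number of qubits at least the input length, so that bounds polynomial in that
length become bounds polynomial in `m`.

Both reductions are realized by explicit multi-stack machines. They are assembled from fragments
whose effect on a record of registers and whose running time are proved compositionally
(`polyTime_circuit`, `polyTime_instance`). For hardness, the given machine for the DQC1 family is
itself embedded as a fragment, with its own stacks next to the registers (`runs_callMachine`). -/

/-- The registers of the programs: stacks of bits. -/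
inductive Reg
  | inp | out | tmp | width | gates | fwd | rev | cnt | cnt' | size | size' | wires | wires'
  | acc | diff | borrow | flag | sign | seed
  deriving DecidableEq

instance : Fintype Reg where
  elems := {.inp, .out, .tmp, .width, .gates, .fwd, .rev, .cnt, .cnt', .size, .size', .wires,
    .wires', .acc, .diff, .borrow, .flag, .sign, .seed}
  complete := by intro r; cases r <;> decide

/-- The contents of the registers. -/
structure Regs where
  inp : List Bool := []
  out : List Bool := []
  tmp : List Bool := []
  width : List Bool := []
  gates : List Bool := []
  fwd : List Bool := []
  rev : List Bool := []
  cnt : List Bool := []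
  cnt' : List Bool := []
  size : List Bool := []
  size' : List Bool := []
  wires : List Bool := []
  wires' : List Bool := []
  acc : List Bool := []
  diff : List Bool := []
  borrow : List Bool := []
  flag : List Bool := []
  sign : List Bool := []
  seed : List Bool := []

/-- The content of a register. -/
def Regs.get (ρ : Regs) : Reg → List Bool
  | .inp => ρ.inp | .out => ρ.out | .tmp => ρ.tmp | .width => ρ.width | .gates => ρ.gates
  | .fwd => ρ.fwd | .rev => ρ.rev | .cnt => ρ.cnt | .cnt' => ρ.cnt' | .size => ρ.size
  | .size' => ρ.size' | .wires => ρ.wires | .wires' => ρ.wires' | .acc => ρ.acc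
  | .diff => ρ.diff | .borrow => ρ.borrow | .flag => ρ.flag | .sign => ρ.sign | .seed => ρ.seed

/-- Overwrites a register. -/
def Regs.set (ρ : Regs) : Reg → List Bool → Regs
  | .inp, x => { ρ with inp := x } | .out, x => { ρ with out := x }
  | .tmp, x => { ρ with tmp := x } | .width, x => { ρ with width := x }
  | .gates, x => { ρ with gates := x } | .fwd, x => { ρ with fwd := x }
  | .rev, x => { ρ with rev := x } | .cnt, x => { ρ with cnt := x }
  | .cnt', x => { ρ with cnt' := x } | .size, x => { ρ with size := x }
  | .size', x => { ρ with size' := x } | .wires, x => { ρ with wires := x }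
  | .wires', x => { ρ with wires' := x } | .acc, x => { ρ with acc := x }
  | .diff, x => { ρ with diff := x } | .borrow, x => { ρ with borrow := x }
  | .flag, x => { ρ with flag := x } | .sign, x => { ρ with sign := x }
  | .seed, x => { ρ with seed := x }

@[simp] theorem Regs.get_set_self (ρ : Regs) (r : Reg) (x : List Bool) :
    (ρ.set r x).get r = x := by cases r <;> rfl

@[simp] theorem Regs.get_set_of_ne (ρ : Regs) {r r' : Reg} (h : r' ≠ r) (x : List Bool) :
    (ρ.set r x).get r' = ρ.get r' := by
  cases r <;> cases r' <;> first | rfl | exact absurd rfl h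

@[simp] theorem Regs.set_set (ρ : Regs) (r : Reg) (x y : List Bool) :
    (ρ.set r x).set r y = ρ.set r y := by cases r <;> rfl

@[simp] theorem Regs.set_get (ρ : Regs) (r : Reg) : ρ.set r (ρ.get r) = ρ := by cases r <;> rfl

theorem Regs.set_comm (ρ : Regs) {r r' : Reg} (h : r ≠ r') (x y : List Bool) :
    (ρ.set r x).set r' y = (ρ.set r' y).set r x := by
  cases r <;> cases r' <;> first | rfl | exact absurd rfl h

section

variable {E : Type} {Γ : E → Type} {σ₀ : Type}

/-- The stack alphabets of a machine with registers and further stacks indexed by `E`. -/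
abbrev Alph (Γ : E → Type) : E ⊕ Reg → Type := Sum.elim Γ fun _ => Bool

/-- The stacks of a machine, assembled from the further stacks and the registers. -/
def stackOf (e : ∀ k, List (Γ k)) (ρ : Regs) : ∀ k, List (Alph Γ k)
  | .inl k => e k
  | .inr r => ρ.get r

/-- A program fragment: finitely many labels, a label where it is entered, and code that refers to
its labels and to the label of the exit. -/
structure Frag (E : Type) (Γ : E → Type) (σ₀ : Type) where
  Lab : Type
  fin : Fintype Lab
  entry : Lab
  code : ∀ {L : Type}, (Lab → L) → L → Lab → Stmt (Alph Γ) L (σ₀ × Option Bool)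

attribute [instance] Frag.fin

variable [DecidableEq E]

theorem update_stacks_inr (e : ∀ k, List (Γ k)) (ρ : Regs) (r : Reg) (x : List Bool) :
    Function.update (stackOf e ρ) (.inr r) x = stackOf e (ρ.set r x) := by
  funext k
  rcases k with k | k
  · exact Function.update_of_ne (by simp) _ _
  · by_cases h : k = r
    · subst h
      exact (Function.update_self _ _ _).trans (ρ.get_set_self k x).symm
    · exact (Function.update_of_ne (by simpa using h) _ _).trans (ρ.get_set_of_ne h x).symm

theorem update_stacks_inl (e : ∀ k, List (Γ k)) (ρ : Regs) (k : E) (x : List (Γ k)) :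
    Function.update (stackOf e ρ) (.inl k) x = stackOf (Function.update e k x) ρ := by
  funext k'
  rcases k' with k' | k'
  · by_cases h : k' = k
    · subst h
      exact (Function.update_self _ _ _).trans
        (Function.update_self (β := fun k => List (Γ k)) _ _ _).symm
    · exact (Function.update_of_ne (by simpa using h) _ _).trans
        (Function.update_of_ne (β := fun k => List (Γ k)) h _ _).symm
  · exact Function.update_of_ne (by simp) _ _

/-- The machine gets from the configuration `c` to `c'` in exactly `n` steps. -/
def Steps {K : Type} [DecidableEq K] {Δ : K → Type} {L σ : Type} (M : L → Stmt Δ L σ) (n : ℕ)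
    (c c' : Cfg Δ L σ) : Prop :=
  (flip bind (step M))^[n] (some c) = some c'

section

variable {K : Type} [DecidableEq K] {Δ : K → Type} {L σ : Type} {M : L → Stmt Δ L σ}

theorem Steps.trans {n n' : ℕ} {c c' c'' : Cfg Δ L σ} (h : Steps M n c c')
    (h' : Steps M n' c' c'') : Steps M (n + n') c c'' := by
  unfold Steps at *
  rw [Nat.add_comm, Function.iterate_add_apply, h, h']

theorem Steps.zero (c : Cfg Δ L σ) : Steps M 0 c c := rfl

theorem Steps.head {n : ℕ} {c c' c'' : Cfg Δ L σ} (h : step M c = some c')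
    (h' : Steps M n c' c'') : Steps M (n + 1) c c'' := by
  unfold Steps at *
  rw [Function.iterate_succ_apply]
  have : flip bind (step M) (some c) = some c' := h
  rw [this, h']

theorem step_eq {l : L} {q : Stmt Δ L σ} {v : σ} {S : ∀ k, List (Δ k)} {c : Cfg Δ L σ}
    (hl : M l = q) (h : stepAux q v S = c) : step M ⟨some l, v, S⟩ = some c := by
  rw [← h, ← hl]
  rfl

/-- The popped stack enters as a separate list `x`, so that a concrete list of bits can be supplied
where the type of `S k` depends on `k` and only reduces to lists of bits. -/
theorem step_eq_of_pop {l : L} {k : K} {f : σ → Option (Δ k) → σ} {q : Stmt Δ L σ} {v : σ}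
    {S : ∀ k, List (Δ k)} {c : Cfg Δ L σ} (x : List (Δ k)) (hl : M l = .pop k f q) (hS : S k = x)
    (h : stepAux q (f v x.head?) (Function.update S k x.tail) = c) :
    step M ⟨some l, v, S⟩ = some c := by
  subst hS
  exact step_eq hl h

theorem Steps.one {c c' : Cfg Δ L σ} (h : step M c = some c') : Steps M 1 c c' :=
  Steps.head h (Steps.zero _)

end

/-- `F.RunsFrom v e ρ v' e' ρ' t`: in at most `t` steps, the fragment gets from the entry, with
state `v`, further stacks `e` and registers `ρ`, to the exit, with `v'`, `e'` and `ρ'`. -/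
def Frag.RunsFrom (F : Frag E Γ σ₀) (v : σ₀) (e : ∀ k, List (Γ k)) (ρ : Regs) (v' : σ₀)
    (e' : ∀ k, List (Γ k)) (ρ' : Regs) (t : ℕ) : Prop :=
  ∀ (L : Type) (M : L → Stmt (Alph Γ) L (σ₀ × Option Bool)) (emb : F.Lab → L) (exit : L),
    (∀ l, M (emb l) = F.code emb exit l) → ∀ o, ∃ o' n, n ≤ t ∧
      Steps M n ⟨some (emb F.entry), (v, o), stackOf e ρ⟩ ⟨some exit, (v', o'), stackOf e' ρ'⟩

/-- The fragment turns the registers `ρ` into `ρ'` in at most `t` steps. -/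
def Frag.Runs (F : Frag E Γ σ₀) (ρ ρ' : Regs) (t : ℕ) : Prop :=
  ∀ v e, F.RunsFrom v e ρ v e ρ' t

theorem Frag.RunsFrom.mono {F : Frag E Γ σ₀} {v v' : σ₀} {e e' : ∀ k, List (Γ k)} {ρ ρ' : Regs}
    {t t' : ℕ} (h : F.RunsFrom v e ρ v' e' ρ' t) (ht : t ≤ t') :
    F.RunsFrom v e ρ v' e' ρ' t' := by
  intro L M emb exit hM o
  obtain ⟨o', n, hn, hs⟩ := h L M emb exit hM o
  exact ⟨o', n, hn.trans ht, hs⟩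

theorem Frag.Runs.mono {F : Frag E Γ σ₀} {ρ ρ' : Regs} {t t' : ℕ} (h : F.Runs ρ ρ' t)
    (ht : t ≤ t') : F.Runs ρ ρ' t' := fun v e => (h v e).mono ht

theorem Frag.Runs.congr {F : Frag E Γ σ₀} {ρ ρ' ρ'' : Regs} {t t' : ℕ} (h : F.Runs ρ ρ' t)
    (hρ : ρ' = ρ'') (ht : t ≤ t') : F.Runs ρ ρ'' t' := hρ ▸ h.mono ht

theorem Frag.Runs.congr' {F : Frag E Γ σ₀} {ρ ρ₁ ρ' : Regs} {t : ℕ} (h : F.Runs ρ₁ ρ' t)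
    (hρ : ρ = ρ₁) : F.Runs ρ ρ' t := hρ ▸ h

/-- The fragment that does nothing. -/
def skip : Frag E Γ σ₀ where
  Lab := Unit
  fin := inferInstance
  entry := ()
  code _ exit _ := .goto fun _ => exit

theorem runs_skip (ρ : Regs) : (skip : Frag E Γ σ₀).Runs ρ ρ 1 := by
  intro v e L M emb exit hM o
  refine ⟨o, 1, le_rfl, Steps.one ?_⟩
  exact step_eq (hM ()) rfl

/-- Pushes a bit on a register. -/
def push (r : Reg) (b : Bool) : Frag E Γ σ₀ where
  Lab := Unit
  fin := inferInstance
  entry := ()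
  code _ exit _ := .push (.inr r) (fun _ => b) (.goto fun _ => exit)

theorem runs_push (r : Reg) (b : Bool) (ρ : Regs) :
    (push r b : Frag E Γ σ₀).Runs ρ (ρ.set r (b :: ρ.get r)) 1 := by
  intro v e L M emb exit hM o
  refine ⟨o, 1, le_rfl, Steps.one ?_⟩
  exact step_eq (hM ()) (congrArg (Cfg.mk _ _) (update_stacks_inr e ρ r _))

/-- Runs two fragments one after the other. -/
def Frag.seq (F G : Frag E Γ σ₀) : Frag E Γ σ₀ where
  Lab := F.Lab ⊕ G.Lab
  fin := inferInstance
  entry := .inl F.entry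
  code emb exit l := match l with
    | .inl l => F.code (fun l => emb (.inl l)) (emb (.inr G.entry)) l
    | .inr l => G.code (fun l => emb (.inr l)) exit l

infixr:60 " ;; " => Frag.seq

theorem Frag.RunsFrom.seq {F G : Frag E Γ σ₀} {v v' v'' : σ₀} {e e' e'' : ∀ k, List (Γ k)}
    {ρ ρ' ρ'' : Regs} {t t' : ℕ} (h : F.RunsFrom v e ρ v' e' ρ' t)
    (h' : G.RunsFrom v' e' ρ' v'' e'' ρ'' t') :
    (F ;; G).RunsFrom v e ρ v'' e'' ρ'' (t + t') := by
  intro L M emb exit hM o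
  obtain ⟨o', n, hn, hs⟩ := h L M (fun l => emb (.inl l)) (emb (.inr G.entry))
    (fun l => hM (.inl l)) o
  obtain ⟨o'', n', hn', hs'⟩ := h' L M (fun l => emb (.inr l)) exit (fun l => hM (.inr l)) o'
  exact ⟨o'', n + n', by omega, hs.trans hs'⟩

theorem Frag.Runs.seq {F G : Frag E Γ σ₀} {ρ ρ' ρ'' : Regs} {t t' : ℕ} (h : F.Runs ρ ρ' t)
    (h' : G.Runs ρ' ρ'' t') : (F ;; G).Runs ρ ρ'' (t + t') :=
  fun v e => (h v e).seq (h' v e)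

/-- Pops a register and branches on the result. -/
def branch (r : Reg) (F : Option Bool → Frag E Γ σ₀) : Frag E Γ σ₀ where
  Lab := Option (Σ b, (F b).Lab)
  fin := inferInstance
  entry := none
  code emb exit l := match l with
    | none => .pop (.inr r) (fun v b => (v.1, b)) (.goto fun v => emb (some ⟨v.2, (F v.2).entry⟩))
    | some ⟨b, l⟩ => (F b).code (fun l => emb (some ⟨b, l⟩)) exit l

theorem runs_branch (r : Reg) (F : Option Bool → Frag E Γ σ₀) {ρ ρ' : Regs} {t : ℕ}
    (h : (F (ρ.get r).head?).Runs (ρ.set r (ρ.get r).tail) ρ' t) :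
    (branch r F).Runs ρ ρ' (t + 1) := by
  intro v e L M emb exit hM o
  obtain ⟨o', n, hn, hs⟩ := h v e L M (fun l => emb (some ⟨_, l⟩)) exit
    (fun l => hM (some ⟨_, l⟩)) (ρ.get r).head?
  refine ⟨o', n + 1, by omega, hs.head ?_⟩
  exact step_eq (hM none) (congrArg (Cfg.mk _ _) (update_stacks_inr e ρ r _))

theorem runs_branch_nil (r : Reg) (F : Option Bool → Frag E Γ σ₀) {ρ ρ' : Regs} {t : ℕ}
    (hr : ρ.get r = []) (h : (F none).Runs ρ ρ' t) : (branch r F).Runs ρ ρ' (t + 1) := by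
  apply runs_branch
  rw [hr]
  have : ρ.set r [] = ρ := by rw [← hr, ρ.set_get]
  simpa [this] using h

theorem runs_branch_cons (r : Reg) (F : Option Bool → Frag E Γ σ₀) {ρ ρ' : Regs} {t : ℕ}
    (b : Bool) (l : List Bool) (hr : ρ.get r = b :: l)
    (h : (F (some b)).Runs (ρ.set r l) ρ' t) : (branch r F).Runs ρ ρ' (t + 1) := by
  apply runs_branch
  rw [hr]
  exact h

/-- Pops bits from a register and runs a fragment for each of them, until the register is empty or
the bit says that the loop ends. -/
def loop (r : Reg) (again : Bool → Bool) (F : Bool → Frag E Γ σ₀) : Frag E Γ σ₀ where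
  Lab := Option (Σ b, (F b).Lab)
  fin := inferInstance
  entry := none
  code emb exit l := match l with
    | none => .pop (.inr r) (fun v b => (v.1, b)) (.goto fun v => match v.2 with
        | none => exit
        | some b => emb (some ⟨b, (F b).entry⟩))
    | some ⟨b, l⟩ =>
      (F b).code (fun l => emb (some ⟨b, l⟩)) (if again b then emb none else exit) l

theorem runs_loop_nil (r : Reg) (again : Bool → Bool) (F : Bool → Frag E Γ σ₀) {ρ : Regs}
    (hr : ρ.get r = []) : (loop r again F).Runs ρ ρ 1 := by
  intro v e L M emb exit hM o
  refine ⟨none, 1, le_rfl, Steps.one ?_⟩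
  have h := update_stacks_inr e ρ r []
  rw [← hr, ρ.set_get, hr] at h
  exact step_eq_of_pop [] (hM none) hr (congrArg (Cfg.mk _ _) h)

theorem runs_loop_exit (r : Reg) (again : Bool → Bool) (F : Bool → Frag E Γ σ₀) {ρ ρ' : Regs}
    {t : ℕ} (b : Bool) (l : List Bool) (hr : ρ.get r = b :: l) (hb : again b = false)
    (h : (F b).Runs (ρ.set r l) ρ' t) : (loop r again F).Runs ρ ρ' (t + 1) := by
  intro v e L M emb exit hM o
  obtain ⟨o', n, hn, hs⟩ := h v e L M (fun l => emb (some ⟨_, l⟩)) exit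
    (fun l => by rw [hM (some ⟨_, l⟩)]; simp [loop, hb]) (some b)
  refine ⟨o', n + 1, by omega, hs.head ?_⟩
  exact step_eq_of_pop (Δ := Alph Γ) (k := Sum.inr r) (b :: l : List Bool) (hM none) hr
    (congrArg (Cfg.mk _ _) (update_stacks_inr e ρ r l))

theorem runs_loop_again (r : Reg) (again : Bool → Bool) (F : Bool → Frag E Γ σ₀)
    {ρ ρ' ρ'' : Regs} {t t' : ℕ} (b : Bool) (l : List Bool) (hr : ρ.get r = b :: l)
    (hb : again b = true) (h : (F b).Runs (ρ.set r l) ρ' t)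
    (h' : (loop r again F).Runs ρ' ρ'' t') : (loop r again F).Runs ρ ρ'' (t + t' + 1) := by
  intro v e L M emb exit hM o
  obtain ⟨o', n, hn, hs⟩ := h v e L M (fun l => emb (some ⟨_, l⟩)) (emb none)
    (fun l => by rw [hM (some ⟨_, l⟩)]; simp [loop, hb]) (some b)
  obtain ⟨o'', n', hn', hs'⟩ := h' v e L M emb exit hM o'
  refine ⟨o'', n + n' + 1, by omega, (hs.trans hs').head ?_⟩
  exact step_eq_of_pop (Δ := Alph Γ) (k := Sum.inr r) (b :: l : List Bool) (hM none) hr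
    (congrArg (Cfg.mk _ _) (update_stacks_inr e ρ r l))

/-- The machine that runs a fragment, with input in the register `inp` and output in `out`. -/
def Frag.machine [Fintype E] [Fintype σ₀] (F : Frag E Γ σ₀) (v₀ : σ₀) : FinTM2 where
  K := E ⊕ Reg
  k₀ := .inr .inp
  k₁ := .inr .out
  Γ := Alph Γ
  Λ := Option F.Lab
  main := some F.entry
  σ := σ₀ × Option Bool
  initialState := (v₀, none)
  Γk₀Fin := inferInstanceAs (Fintype Bool)
  m
    | none => .load (fun _ => (v₀, none)) .halt
    | some l => F.code some none l

/-- A program that turns the code of every argument into the code of the value, in polynomial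
time, shows that the function is computable in polynomial time. -/
theorem polyTime_of_runsFrom [Fintype E] [Fintype σ₀] {α β : Type} {ea : α → List Bool}
    {eb : β → List Bool} {f : α → β} (F : Frag E Γ σ₀) (v₀ : σ₀) (p : Polynomial ℕ)
    (h : ∀ a, ∃ v', F.RunsFrom v₀ (fun _ => []) { inp := ea a } v' (fun _ => [])
      { out := eb (f a) } (p.eval (ea a).length)) :
    PolyTime ea eb f := by
  refine ⟨{
    tm := F.machine v₀
    inputAlphabet := Equiv.refl Bool
    outputAlphabet := Equiv.refl Bool
    time := p + 1
    outputsFun := fun a => ?_ }⟩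
  apply Classical.choice
  obtain ⟨v', hv⟩ := h a
  obtain ⟨o', n, hn, hs⟩ := hv (Option F.Lab) (F.machine v₀).m some none (fun _ => rfl) none
  -- The additional step is taken at the label `none`. It restores the initial internal state, as a
  -- proper halting configuration requires, and accounts for the `1` in `p + 1`.
  have key := hs.trans (Steps.one (c' := ⟨none, (v₀, none), stackOf (fun _ => [])
    { out := eb (f a) }⟩) rfl)
  have hi : initList (F.machine v₀) (List.map (Equiv.refl Bool).invFun (ea a)) =
      ⟨some (some F.entry), (v₀, none), stackOf (fun _ => []) { inp := ea a }⟩ := by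
    unfold initList
    refine congrArg (Cfg.mk _ _) (funext fun k => ?_)
    rcases k with k | k
    · rfl
    · cases k <;> first | rfl | exact List.map_id _
  have ho : haltList (F.machine v₀) (List.map (Equiv.refl Bool).invFun (eb (f a))) =
      ⟨none, (v₀, none), stackOf (fun _ => []) { out := eb (f a) }⟩ := by
    unfold haltList
    refine congrArg (Cfg.mk _ _) (funext fun k => ?_)
    rcases k with k | k
    · rfl
    · cases k <;> first | rfl | exact List.map_id _
  refine ⟨⟨⟨n + 1, ?_⟩, by simpa using hn⟩⟩
  rw [Option.map_some, hi, ho]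
  exact key

end

end StackProgram

/-! ### Elementary programs and transducers -/

namespace StackProgram

open Turing Turing.TM2

section

variable {E : Type} {Γ : E → Type} {σ₀ : Type} [DecidableEq E]

/-- This is the inductive step of every loop that moves data from `A` to `B`: the remaining rounds
overwrite the two registers that the first round has changed. -/
theorem Regs.set_set_set_set (ρ : Regs) {A B : Reg} (h : A ≠ B) (x y z w : List Bool) :
    (((ρ.set A x).set B y).set A z).set B w = (ρ.set A z).set B w := by
  rw [Regs.set_comm _ h.symm y z, Regs.set_set, Regs.set_set]

/-- Pushes the bits of a list, the first one first. -/
def pushSeq (r : Reg) : List Bool → Frag E Γ σ₀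
  | [] => skip
  | b :: l => push r b ;; pushSeq r l

theorem runs_pushSeq (r : Reg) (l : List Bool) (ρ : Regs) :
    (pushSeq r l : Frag E Γ σ₀).Runs ρ (ρ.set r (l.reverse ++ ρ.get r)) (l.length + 1) := by
  induction l generalizing ρ with
  | nil => simpa [pushSeq] using runs_skip ρ
  | cons b l ih =>
    refine ((runs_push r b ρ).seq (ih _)).congr ?_ ?_
    · simp
    · simp; omega

/-- Puts a list of bits on top of a register. -/
def prepend (r : Reg) (l : List Bool) : Frag E Γ σ₀ := pushSeq r l.reverse

theorem runs_prepend (r : Reg) (l : List Bool) (ρ : Regs) :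
    (prepend r l : Frag E Γ σ₀).Runs ρ (ρ.set r (l ++ ρ.get r)) (l.length + 1) := by
  simpa [prepend] using runs_pushSeq (E := E) (Γ := Γ) (σ₀ := σ₀) r l.reverse ρ

/-- Moves the bits of a register, one by one, to another one. -/
def moveAll (A B : Reg) : Frag E Γ σ₀ := loop A (fun _ => true) fun b => push B b

theorem runs_moveAll {A B : Reg} (h : A ≠ B) (ρ : Regs) (l : List Bool) (hl : ρ.get A = l) :
    (moveAll A B : Frag E Γ σ₀).Runs ρ ((ρ.set A []).set B (l.reverse ++ ρ.get B))
      (2 * l.length + 1) := by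
  induction l generalizing ρ with
  | nil =>
    refine (runs_loop_nil A _ _ hl).congr ?_ (by simp)
    have : ρ.set A [] = ρ := by rw [← hl, ρ.set_get]
    simp [this]
  | cons b l ih =>
    refine (runs_loop_again A _ _ b l hl rfl (runs_push B b _) (ih _ ?_)).congr ?_ ?_
    · simp [h]
    · rw [Regs.set_set_set_set _ h]
      simp [h.symm]
    · simp; omega

/-- Empties a register. -/
def clear (A : Reg) : Frag E Γ σ₀ := loop A (fun _ => true) fun _ => skip

theorem runs_clear (A : Reg) (ρ : Regs) (l : List Bool) (hl : ρ.get A = l) :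
    (clear A : Frag E Γ σ₀).Runs ρ (ρ.set A []) (2 * l.length + 1) := by
  induction l generalizing ρ with
  | nil =>
    refine (runs_loop_nil A _ _ hl).congr ?_ (by simp)
    rw [← hl]; simp
  | cons b l ih =>
    refine (runs_loop_again A _ _ b l hl rfl (runs_skip _) (ih _ ?_)).congr ?_ ?_
    · simp
    · simp
    · simp; omega

/-- A program that reads a code from one register and writes another code, backwards, on a second
register, in time linear in the length of the first code. -/
structure Transducer (E : Type) [DecidableEq E] (Γ : E → Type) (σ₀ : Type) {α : Type}
    (e e' : α → List Bool) where
  prog : Reg → Reg → Frag E Γ σ₀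
  c : ℕ
  runs : ∀ (A B : Reg), A ≠ B → ∀ (a : α) (ρ : Regs) (rest : List Bool),
    ρ.get A = e a ++ rest →
      (prog A B).Runs ρ ((ρ.set A rest).set B ((e' a).reverse ++ ρ.get B))
        (c * ((e a).length + 1))

namespace Transducer

variable {α β : Type}

/-- Copies a unary code. -/
def unary : Transducer E Γ σ₀ encUnary encUnary where
  prog A B := loop A id fun b => push B b
  c := 2
  runs A B h n := by
    induction n with
    | zero =>
      intro ρ rest hρ
      refine (runs_loop_exit A _ _ false rest hρ rfl (runs_push B false _)).congr ?_ ?_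
      · simp [encUnary, h.symm]
      · simp
    | succ n ih =>
      intro ρ rest hρ
      refine (runs_loop_again A _ _ true (encUnary n ++ rest) hρ rfl (runs_push B true _)
        (ih _ rest ?_)).congr ?_ ?_
      · simp [h]
      · rw [Regs.set_set_set_set _ h]
        simp [encUnary, h.symm, List.replicate_succ]
      · simp [encUnary]; omega

/-- Copies a bit, or writes a function of it. -/
def bit (f : Bool → Bool) : Transducer E Γ σ₀ (fun b => [b]) (fun b => [f b]) where
  prog A B := loop A (fun _ => false) fun b => push B (f b)
  c := 1
  runs A B h b ρ rest hρ := by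
    refine (runs_loop_exit A (fun _ => false) _ b rest hρ rfl (runs_push B (f b) _)).congr ?_ ?_
    · simp [h.symm]
    · simp

/-- Writes a constant. -/
def emit (l : List Bool) : Transducer E Γ σ₀ (fun _ : α => []) (fun _ => l) where
  prog _ B := pushSeq B l
  c := l.length + 1
  runs A B h a ρ rest hρ := by
    refine (runs_pushSeq B l ρ).congr ?_ (by simp)
    rw [← (show ρ.get A = rest by simpa using hρ)]
    simp

variable {e e' : α → List Bool}

/-- A transducer for a component of an object. -/
def comap (T : Transducer E Γ σ₀ e e') (f : β → α) :
    Transducer E Γ σ₀ (fun b => e (f b)) (fun b => e' (f b)) where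
  prog := T.prog
  c := T.c
  runs A B h b := T.runs A B h (f b)

/-- Two transducers, one after the other. -/
def append {d d' : α → List Bool} (T : Transducer E Γ σ₀ e e') (U : Transducer E Γ σ₀ d d') :
    Transducer E Γ σ₀ (fun a => e a ++ d a) (fun a => e' a ++ d' a) where
  prog A B := T.prog A B ;; U.prog A B
  c := T.c + U.c
  runs A B h a ρ rest hρ := by
    refine ((T.runs A B h a ρ (d a ++ rest) (by simpa using hρ)).seq
      (U.runs A B h a _ rest ?_)).congr ?_ ?_
    · simp [h]
    · rw [Regs.set_set_set_set _ h]
      simp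
    · simp only [List.length_append]
      nlinarith [Nat.zero_le T.c, Nat.zero_le U.c, Nat.zero_le (T.c * (d a).length),
        Nat.zero_le (U.c * (e a).length)]

/-- Transforms the entries of a list. -/
def list (T : Transducer E Γ σ₀ e e') : Transducer E Γ σ₀ (encList e) (encList e') where
  prog A B := loop A id fun b => if b then push B true ;; T.prog A B else push B false
  c := T.c + 3
  runs A B h l := by
    induction l with
    | nil =>
      intro ρ rest hρ
      refine Frag.Runs.congr (runs_loop_exit A id _ false rest hρ rfl (runs_push B false _)) ?_ ?_
      · simp [encList, h.symm]
      · simp [encList]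
    | cons a l ih =>
      intro ρ rest hρ
      refine (runs_loop_again A _ _ true (e a ++ (encList e l ++ rest))
        (by simpa [encList] using hρ) rfl
        ((runs_push B true _).seq (T.runs A B h a _ (encList e l ++ rest) ?_))
        (ih _ rest ?_)).congr ?_ ?_
      · simp [h]
      · simp [h]
      · rw [Regs.set_set_set_set _ h, Regs.set_set_set_set _ h]
        simp [encList, h.symm]
      · simp only [encList, List.length_cons, List.length_append]
        nlinarith [Nat.zero_le (T.c * (e a).length), Nat.zero_le (T.c * (encList e l).length)]

/-- Transforms the entries of a table. -/
def table (T : Transducer E Γ σ₀ e e') :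
    (n : ℕ) → Transducer E Γ σ₀ (encTable e n) (encTable e' n)
  | 0 => emit []
  | n + 1 => (T.comap fun f : Fin (n + 1) → α => f 0).append
      ((table T n).comap fun (f : Fin (n + 1) → α) i => f i.succ)

/-- Copies the binary code of a natural number. -/
def binary : Transducer E Γ σ₀ encBinary encBinary :=
  (list (bit id)).comap Computability.encodeNat

/-- Copies the code of an integer. -/
def int : Transducer E Γ σ₀ encInt encInt :=
  ((bit id).comap fun z : ℤ => decide (z < 0)).append (binary.comap Int.natAbs)


end Transducer

end

end StackProgram

/-! ### The circuits that estimate a correlation function -/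

/-- The codes of the entries of a list, each announced by a `1`. -/
def encItems {α : Type} (e : α → List Bool) (l : List α) : List Bool :=
  l.flatMap fun a => true :: e a

@[simp] theorem encItems_nil {α : Type} (e : α → List Bool) : encItems e [] = [] := rfl

@[simp] theorem encItems_cons {α : Type} (e : α → List Bool) (a : α) (l : List α) :
    encItems e (a :: l) = true :: e a ++ encItems e l := rfl

@[simp] theorem encItems_append {α : Type} (e : α → List Bool) (l l' : List α) :
    encItems e (l ++ l') = encItems e l ++ encItems e l' := List.flatMap_append

theorem encList_eq {α : Type} (e : α → List Bool) (l : List α) :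
    encList e l = encItems e l ++ [false] := by
  induction l with
  | nil => rfl
  | cons a l ih => simp [encList, ih]

/-- The gate on a register with two more wires, one below and one above the old ones. -/
def Gate.shift {m : ℕ} (g : Gate m) : Gate (m + 1 + 1) where
  fst := g.fst.castSucc.succ
  snd := g.snd.castSucc.succ
  fst_ne_snd := by simpa using g.fst_ne_snd
  den := g.den
  coef := g.coef
  isUnitary := g.isUnitary
  inverse := g.inverse

/-- The inverse gate. -/
def Gate.inv {m : ℕ} (g : Gate m) : Gate m := { g with inverse := !g.inverse }

/-- The coefficients of the entries of the Pauli matrices. -/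
def Pauli.coef : Pauli → Fin 2 → Fin 2 → Fin 4 → ℤ
  | .I => ![![![1, 0, 0, 0], 0], ![0, ![1, 0, 0, 0]]]
  | .X => ![![0, ![1, 0, 0, 0]], ![![1, 0, 0, 0], 0]]
  | .Y => ![![0, ![0, 0, -1, 0]], ![![0, 0, 1, 0], 0]]
  | .Z => ![![![1, 0, 0, 0], 0], ![0, ![-1, 0, 0, 0]]]

/-- The coefficients of the entries of the controlled version of a one-qubit matrix. -/
def ctrlCoef (c : Fin 2 → Fin 2 → Fin 4 → ℤ) : Fin 4 → Fin 4 → Fin 4 → ℤ :=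
  ![![![1, 0, 0, 0], 0, 0, 0], ![0, ![1, 0, 0, 0], 0, 0],
    ![0, 0, c 0 0, c 0 1], ![0, 0, c 1 0, c 1 1]]

/-- The coefficients of the identity. -/
def oneCoef : Fin 4 → Fin 4 → Fin 4 → ℤ :=
  ![![![1, 0, 0, 0], 0, 0, 0], ![0, ![1, 0, 0, 0], 0, 0],
    ![0, 0, ![1, 0, 0, 0], 0], ![0, 0, 0, ![1, 0, 0, 0]]]

/-- The coefficients of a phase `i` on the first qubit. -/
def phaseCoef : Fin 4 → Fin 4 → Fin 4 → ℤ :=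
  ![![![1, 0, 0, 0], 0, 0, 0], ![0, ![1, 0, 0, 0], 0, 0],
    ![0, 0, ![0, 0, 1, 0], 0], ![0, 0, 0, ![0, 0, 1, 0]]]

/-- The coefficients of a Hadamard gate on the first qubit, with denominator `2`. -/
def hadamardCoef : Fin 4 → Fin 4 → Fin 4 → ℤ :=
  ![![![0, 1, 0, 0], 0, ![0, 1, 0, 0], 0], ![0, ![0, 1, 0, 0], 0, ![0, 1, 0, 0]],
    ![![0, 1, 0, 0], 0, ![0, -1, 0, 0], 0], ![0, ![0, 1, 0, 0], 0, ![0, -1, 0, 0]]]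

theorem entryMatrix_ctrl (P : Pauli) :
    entryMatrix 1 (ctrlCoef P.coef) =
      !![1, 0, 0, 0; 0, 1, 0, 0; 0, 0, P.toMatrix 0 0, P.toMatrix 0 1;
        0, 0, P.toMatrix 1 0, P.toMatrix 1 1] := by
  ext i j
  cases P <;> fin_cases i <;> fin_cases j <;>
    simp [entryMatrix, ctrlCoef, Pauli.coef, Pauli.toMatrix]

theorem entryMatrix_one : entryMatrix 1 oneCoef = 1 := by
  ext i j
  fin_cases i <;> fin_cases j <;> simp [entryMatrix, oneCoef]

theorem entryMatrix_phase :
    entryMatrix 1 phaseCoef = Matrix.diagonal ![1, 1, Complex.I, Complex.I] := by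
  ext i j
  fin_cases i <;> fin_cases j <;> simp [entryMatrix, phaseCoef]

theorem entryMatrix_hadamard :
    entryMatrix 2 hadamardCoef = ((Real.sqrt 2 : ℂ) / 2) •
      !![1, 0, 1, 0; 0, 1, 0, 1; 1, 0, -1, 0; 0, 1, 0, -1] := by
  ext i j
  fin_cases i <;> fin_cases j <;> simp [entryMatrix, hadamardCoef] <;> ring

theorem sqrt_two_mul_self : (Real.sqrt 2 : ℂ) * Real.sqrt 2 = 2 := by
  rw [← Complex.ofReal_mul, Real.mul_self_sqrt (by norm_num)]
  norm_num

theorem entryMatrix_ctrl_mem (P : Pauli) :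
    entryMatrix 1 (ctrlCoef P.coef) ∈ Matrix.unitaryGroup (Fin 4) ℂ := by
  rw [Matrix.mem_unitaryGroup_iff, entryMatrix_ctrl]
  ext i j
  cases P <;> fin_cases i <;> fin_cases j <;>
    simp [Matrix.mul_apply, Fin.sum_univ_four, Pauli.toMatrix, Matrix.star_apply]

theorem entryMatrix_one_mem : entryMatrix 1 oneCoef ∈ Matrix.unitaryGroup (Fin 4) ℂ := by
  rw [entryMatrix_one]
  exact one_mem _

theorem entryMatrix_phase_mem : entryMatrix 1 phaseCoef ∈ Matrix.unitaryGroup (Fin 4) ℂ := by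
  rw [Matrix.mem_unitaryGroup_iff, entryMatrix_phase]
  ext i j
  fin_cases i <;> fin_cases j <;> simp [Matrix.mul_apply, Fin.sum_univ_four, Matrix.star_apply]

theorem entryMatrix_hadamard_mem :
    entryMatrix 2 hadamardCoef ∈ Matrix.unitaryGroup (Fin 4) ℂ := by
  have h2 := sqrt_two_mul_self
  have h3 : (starRingEnd ℂ) 2 = 2 := map_ofNat _ 2
  rw [Matrix.mem_unitaryGroup_iff, entryMatrix_hadamard]
  ext i j
  fin_cases i <;> fin_cases j <;>
    simp [Matrix.mul_apply, Fin.sum_univ_four, Matrix.star_apply, h3] <;> linear_combination h2 / 2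

/-- The identity gate on the first two wires. -/
def idGate (n : ℕ) : Gate (n + 1 + 1) where
  fst := 0
  snd := 1
  fst_ne_snd := by simp
  den := 1
  coef := oneCoef
  isUnitary := entryMatrix_one_mem
  inverse := false

/-- The phase `i` on the clean qubit. -/
def phaseGate (m : ℕ) : Gate (m + 1 + 1) where
  fst := 0
  snd := 1
  fst_ne_snd := by simp
  den := 1
  coef := phaseCoef
  isUnitary := entryMatrix_phase_mem
  inverse := false

/-- The Hadamard gate on the clean qubit. -/
def hadamardGate (m : ℕ) : Gate (m + 1 + 1) where
  fst := 0
  snd := 1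
  fst_ne_snd := by simp
  den := 2
  coef := hadamardCoef
  isUnitary := entryMatrix_hadamard_mem
  inverse := false

/-- The Pauli matrix `P` on the wire `w` of the system, controlled by the clean qubit. -/
def ctrlPauli {m : ℕ} (P : Pauli) (w : Fin m) : Gate (m + 1 + 1) where
  fst := 0
  snd := w.castSucc.succ
  fst_ne_snd := (Fin.succ_ne_zero _).symm
  den := 1
  coef := ctrlCoef P.coef
  isUnitary := entryMatrix_ctrl_mem P
  inverse := false

/-- The difference bit of a binary subtraction, for bits `u`, `b` and borrow `c`. -/
def diffBit (u b c : Bool) : Bool := xor (xor u b) c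

/-- The outgoing borrow of a binary subtraction. -/
def borrowBit (u b c : Bool) : Bool := (!u && (b || c)) || (b && c)

/-- Binary subtraction, least significant bits first: the difference modulo a power of two and the
final borrow. -/
def subBits : List Bool → List Bool → Bool → List Bool × Bool
  | b :: bs, u, c =>
    let r := subBits bs u.tail (borrowBit (u.headD false) b c)
    (diffBit (u.headD false) b c :: r.1, r.2)
  | [], [], c => ([], c)
  | [], u :: us, c =>
    let r := subBits [] us (borrowBit u false c)
    (diffBit u false c :: r.1, r.2)

/-- The first bits of a seed, continued by zeros if it is too short. -/
def takeBits : ℕ → List Bool → List Bool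
  | 0, _ => []
  | n + 1, s => s.headD false :: takeBits n s.tail

/-- Selects a term of an expansion: the number `u` falls into the interval that belongs to the
term when intervals of lengths `mult` are lined up. -/
def selectTerm {s : ℕ} : List (PauliTerm s) → List Bool → Option (PauliTerm s)
  | [], _ => none
  | T :: l, u =>
    let r := subBits (Computability.encodeNat T.mult) u false
    if r.2 then some T else selectTerm l r.1

/-- The controlled version of a term of an expansion. -/
def termGates {m s : ℕ} (wires : Fin s ↪ Fin m) (T : PauliTerm s) : List (Gate (m + 1 + 1)) :=
  (List.ofFn fun i => ctrlPauli (T.paulis i) (wires i)).reverse ++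
    List.replicate T.phase (phaseGate m)

/-- The controlled version of a randomly chosen term of a local operator; if none is chosen, a
random sign. -/
def opGates {m : ℕ} (κ : ℕ) (O : LocalOp m) (seed : List Bool) : List (Gate (m + 1 + 1)) :=
  match selectTerm O.terms (takeBits (O.prec + κ) seed).reverse with
  | some T => termGates O.wires T
  | none => if (seed.drop (O.prec + κ)).headD false then [phaseGate m, phaseGate m] else []

/-- The part of the circuit that belongs to a probe. -/
def probeGates {m : ℕ} (κ : ℕ) (gates : List (Gate m)) (p : Probe m) (seed : List Bool) :
    List (Gate (m + 1 + 1)) :=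
  ((gates.take p.time).map fun g => g.shift.inv).reverse ++ opGates κ p.op seed ++
    (gates.take p.time).map Gate.shift

/-- The part of the circuit that belongs to a list of probes. -/
def probesGates {m : ℕ} (κ : ℕ) (gates : List (Gate m)) :
    List (Probe m) → List Bool → List (Gate (m + 1 + 1))
  | [], _ => []
  | p :: ps, seed =>
    probesGates κ gates ps (seed.drop (p.op.prec + κ + 1)) ++ probeGates κ gates p seed

/-- The Hadamard test for the product of randomly chosen terms of the probes, times `i ^ a`. -/
def testCircuit {m : ℕ} (κ a : ℕ) (gates : List (Gate m)) (probes : List (Probe m))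
    (seed : List Bool) : OneClean where
  n := m + 1
  gates := hadamardGate m :: (List.replicate a (phaseGate m) ++
    (probesGates κ gates probes seed ++ [hadamardGate m]))

/-- The one-clean-qubit computation prepared from an instance, a precision and a seed. -/
def TOCInstance.circuit {A : Set ℕ} {l K : ℕ} (κ a : ℕ)
    (y : TOCInstance A l K × ℕ × List Bool) : OneClean :=
  testCircuit κ a y.1.gates y.1.probes
    (encList encProbe y.1.probes ++ (encUnary y.2.1 ++ y.2.2)).reverse

/-! ### Counting loops and the copying of gates -/

namespace StackProgram

open Turing Turing.TM2

section

variable {E : Type} {Γ : E → Type} {σ₀ : Type} [DecidableEq E]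

/-- Runs a fragment for every `1` on a register up to the first `0`, which is removed as well. -/
def forUnary (r : Reg) (F : Frag E Γ σ₀) : Frag E Γ σ₀ :=
  loop r id fun b => match b with
    | true => F
    | false => skip

/-- Runs a fragment as often as there are bits on a register. -/
def forEach (r : Reg) (F : Frag E Γ σ₀) : Frag E Γ σ₀ := loop r (fun _ => true) fun _ => F

theorem runs_forUnary_false {r : Reg} {F : Frag E Γ σ₀} {ρ : Regs} (l : List Bool)
    (h : ρ.get r = false :: l) : (forUnary r F).Runs ρ (ρ.set r l) 2 :=
  runs_loop_exit r _ _ false l h rfl (runs_skip _)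

theorem runs_forUnary_true {r : Reg} {F : Frag E Γ σ₀} {ρ ρ' ρ'' : Regs} {t t' : ℕ}
    (l : List Bool) (h : ρ.get r = true :: l) (hF : F.Runs (ρ.set r l) ρ' t)
    (h' : (forUnary r F).Runs ρ' ρ'' t') : (forUnary r F).Runs ρ ρ'' (t + t' + 1) :=
  runs_loop_again r _ _ true l h rfl hF h'

theorem runs_forEach_nil {r : Reg} {F : Frag E Γ σ₀} {ρ : Regs}
    (h : ρ.get r = []) : (forEach r F).Runs ρ ρ 1 :=
  runs_loop_nil r _ _ h

theorem runs_forEach_cons {r : Reg} {F : Frag E Γ σ₀} {ρ ρ' ρ'' : Regs} {t t' : ℕ}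
    (b : Bool) (l : List Bool) (h : ρ.get r = b :: l) (hF : F.Runs (ρ.set r l) ρ' t)
    (h' : (forEach r F).Runs ρ' ρ'' t') : (forEach r F).Runs ρ ρ'' (t + t' + 1) :=
  runs_loop_again r _ _ b l h rfl hF h'

/-- Moves the bits of a register, one by one, to two other ones. -/
def copyAll (A B C : Reg) : Frag E Γ σ₀ := loop A (fun _ => true) fun b => push B b ;; push C b

theorem runs_copyAll {A B C : Reg} (hAB : A ≠ B) (hAC : A ≠ C) (hBC : B ≠ C) (ρ : Regs)
    (l : List Bool) (hl : ρ.get A = l) :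
    (copyAll A B C : Frag E Γ σ₀).Runs ρ
      (((ρ.set A []).set B (l.reverse ++ ρ.get B)).set C (l.reverse ++ ρ.get C))
      (3 * l.length + 1) := by
  induction l generalizing ρ with
  | nil =>
    refine (runs_loop_nil A _ _ hl).congr ?_ (by simp)
    have : ρ.set A [] = ρ := by rw [← hl, ρ.set_get]
    simp [this]
  | cons b l ih =>
    refine Frag.Runs.congr (runs_loop_again A _ _ b l hl rfl
      ((runs_push B b _).seq (runs_push C b _)) (ih _ ?_)) ?_ ?_
    · simp [hAB, hAC]
    · simp only [Regs.get_set_self, Regs.get_set_of_ne _ hBC, Regs.get_set_of_ne _ hBC.symm,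
        Regs.get_set_of_ne _ hAB.symm, Regs.get_set_of_ne _ hAC.symm]
      rw [Regs.set_comm _ hAC.symm, Regs.set_comm _ hAB.symm, Regs.set_set,
        Regs.set_comm _ hBC.symm, Regs.set_set, Regs.set_set]
      simp
    · simp; omega

/-- Copies the register `gates`, which holds a code backwards, to the register `fwd`. -/
def copyGates : Frag E Γ σ₀ := copyAll .gates .tmp .fwd ;; moveAll .tmp .gates

theorem runs_copyGates (ρ : Regs) (G : List Bool) (hG : ρ.gates = G.reverse)
    (hf : ρ.fwd = []) (ht : ρ.tmp = []) :
    (copyGates : Frag E Γ σ₀).Runs ρ { ρ with fwd := G } (5 * G.length + 2) := by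
  refine Frag.Runs.congr ((runs_copyAll (A := .gates) (B := .tmp) (C := .fwd)
    (by decide) (by decide) (by decide) ρ _ hG).seq
    (runs_moveAll (by decide) _ G ?_)) ?_ ?_
  · simp [Regs.set, Regs.get, ht]
  · cases ρ; simp_all [Regs.set, Regs.get]
  · simp; omega

/-- The data of a gate, without the conditions on them. -/
abbrev RawGate : Type := ℕ × ℕ × ℕ × (Fin 4 → Fin 4 → Fin 4 → ℤ) × Bool

/-- The data of a gate. -/
def rawGate {n : ℕ} (g : Gate n) : RawGate := (g.fst, g.snd, g.den, g.coef, g.inverse)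

/-- The code of the data of a gate. -/
def encRawGate (g : RawGate) : List Bool :=
  encUnary g.1 ++ (encUnary g.2.1 ++ (encBinary g.2.2.1 ++
    (encTable (encTable (encTable encInt 4) 4) 4 g.2.2.2.1 ++ [g.2.2.2.2])))

/-- Copies the code of a gate, with a prefix for both wires and a change of the last bit. -/
def Transducer.gate (l : List Bool) (f : Bool → Bool) : Transducer E Γ σ₀ encRawGate (fun g =>
    (l ++ encUnary g.1) ++ ((l ++ encUnary g.2.1) ++ (encBinary g.2.2.1 ++
    (encTable (encTable (encTable encInt 4) 4) 4 g.2.2.2.1 ++ [f g.2.2.2.2])))) :=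
  ((emit l).append (unary.comap fun g : RawGate => g.1)).append <|
  ((emit l).append (unary.comap fun g : RawGate => g.2.1)).append <|
  (binary.comap fun g : RawGate => g.2.2.1).append <|
  ((((int.table 4).table 4).table 4).comap fun g : RawGate => g.2.2.2.1).append <|
  (bit f).comap fun g : RawGate => g.2.2.2.2

/-- Copies the code of a gate. -/
def gateCopy : Transducer E Γ σ₀ encRawGate encRawGate := Transducer.gate [] id

/-- Copies the code of a gate and inverts the gate. -/
def gateInv : Transducer E Γ σ₀ encRawGate (fun g => encRawGate (g.1, g.2.1, g.2.2.1, g.2.2.2.1,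
    !g.2.2.2.2)) := Transducer.gate [] not

/-- Copies the code of a gate and shifts its wires. -/
def gateShift : Transducer E Γ σ₀ encRawGate (fun g => encRawGate (g.1 + 1, g.2.1 + 1,
    g.2.2.1, g.2.2.2.1, g.2.2.2.2)) := Transducer.gate [true] id

/-- Moves as many gates as `cnt` says, forwards, from `fwd` to `out`. -/
def fetchGates : Frag E Γ σ₀ :=
  forEach .cnt (branch .fwd fun _ => push .rev true ;; gateCopy.prog .fwd .rev) ;;
  clear .fwd ;; moveAll .rev .out

/-- Each round is charged to the code of the gate that it moves. The total time is therefore linear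
in the length of the code of the list, whatever the number `t` is. -/
theorem runs_fetchGates_loop {n : ℕ} (L : List (Gate n)) (t : ℕ) (rest : List Bool) :
    ∀ (ρ : Regs), t ≤ L.length → ρ.cnt = List.replicate t true →
    ρ.fwd = encItems encGate L ++ rest →
    (forEach .cnt (branch .fwd fun _ => push .rev true ;;
      gateCopy.prog .fwd .rev) : Frag E Γ σ₀).Runs ρ
      { ρ with cnt := [], fwd := encItems encGate (L.drop t) ++ rest,
               rev := (encItems encGate (L.take t)).reverse ++ ρ.rev }
      (((gateCopy : Transducer E Γ σ₀ _ _).c + 3) * (encItems encGate L).length + 1) := by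
  induction t generalizing L with
  | zero =>
    intro ρ ht hc hf
    refine (runs_forEach_nil (by exact hc)).congr ?_ (by simp)
    cases ρ; simp_all
  | succ t ih =>
    intro ρ ht hc hf
    obtain _ | ⟨g, L⟩ := L
    · simp at ht
    refine Frag.Runs.congr (runs_forEach_cons true (List.replicate t true) (by exact hc)
      (runs_branch_cons .fwd _ true (encGate g ++ encItems encGate L ++ rest) ?_
        ((runs_push _ _ _).seq (gateCopy.runs .fwd .rev (by decide) (rawGate g) _
          (encItems encGate L ++ rest) ?_)))
      (ih L _ (by simpa using ht) ?_ rfl)) ?_ ?_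
    · simpa [Regs.set, Regs.get] using hf
    · simp [Regs.set, Regs.get]; rfl
    · rfl
    · have : encRawGate (rawGate g) = encGate g := rfl
      simp [Regs.set, Regs.get, this]
    · have : encRawGate (rawGate g) = encGate g := rfl
      simp only [this, encItems_cons, List.length_append, List.length_cons]
      nlinarith [Nat.zero_le (gateCopy (E := E) (Γ := Γ) (σ₀ := σ₀)).c]

theorem runs_fetchGates {n : ℕ} (L : List (Gate n)) (t : ℕ) (ρ : Regs) (ht : t ≤ L.length)
    (hc : ρ.cnt = List.replicate t true) (hf : ρ.fwd = encList encGate L) (hr : ρ.rev = []) :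
    (fetchGates : Frag E Γ σ₀).Runs ρ
      { ρ with cnt := [], fwd := [], out := encItems encGate (L.take t) ++ ρ.out }
      (((gateCopy : Transducer E Γ σ₀ _ _).c + 7) * ((encList encGate L).length + 1)) := by
  have hle : (encItems encGate L).length + 1 = (encList encGate L).length := by
    simp [encList_eq]
  have hs : (encItems encGate L).length = (encItems encGate (L.take t)).length +
      (encItems encGate (L.drop t)).length := by
    rw [← List.length_append, ← encItems_append, List.take_append_drop]
  refine Frag.Runs.congr ((runs_fetchGates_loop L t [false] ρ ht hc (hf.trans (encList_eq _ _))).seq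
    ((runs_clear _ _ _ rfl).seq (runs_moveAll (by decide) _
      (encItems encGate (L.take t)).reverse ?_))) ?_ ?_
  · simp [Regs.set, Regs.get, hr]
  · simp [Regs.set, Regs.get, hr]
  · simp only [Regs.get, List.length_append, List.length_reverse, List.length_singleton]
    rw [← hle]
    nlinarith [Nat.zero_le (gateCopy (E := E) (Γ := Γ) (σ₀ := σ₀)).c]

/-- Moves as many gates as `cnt'` says from `fwd` to `out`, inverted and in reverse order. -/
def fetchInverses : Frag E Γ σ₀ :=
  forEach .cnt' (branch .fwd fun _ => gateInv.prog .fwd .rev ;; moveAll .rev .out ;;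
    push .out true) ;; clear .fwd

theorem length_encGate_inv {n : ℕ} (g : Gate n) : (encGate g.inv).length = (encGate g).length := by
  simp [encGate, Gate.inv]

/-- Each inverted gate is put in front of those already on `out`, which reverses their order. This
is the order in which the inverse of a circuit applies its gates. The detour through `rev` keeps the
code of the single gate forwards. -/
theorem runs_fetchInverses_loop {n : ℕ} (L : List (Gate n)) (t : ℕ) (rest : List Bool) :
    ∀ (ρ : Regs), t ≤ L.length → ρ.cnt' = List.replicate t true → ρ.rev = [] →
    ρ.fwd = encItems encGate L ++ rest →
    (forEach .cnt' (branch .fwd fun _ => gateInv.prog .fwd .rev ;; moveAll .rev .out ;;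
      push .out true) : Frag E Γ σ₀).Runs ρ
      { ρ with cnt' := [], fwd := encItems encGate (L.drop t) ++ rest,
               out := encItems encGate ((L.take t).map Gate.inv).reverse ++ ρ.out }
      (((gateInv : Transducer E Γ σ₀ _ _).c + 6) * (encItems encGate L).length + 1) := by
  induction t generalizing L with
  | zero =>
    intro ρ ht hc hr hf
    refine (runs_forEach_nil (by exact hc)).congr ?_ (by simp)
    cases ρ; simp_all
  | succ t ih =>
    intro ρ ht hc hr hf
    obtain _ | ⟨g, L⟩ := L
    · simp at ht
    have hg : encRawGate (rawGate g) = encGate g := rfl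
    refine Frag.Runs.congr (runs_forEach_cons true (List.replicate t true) (by exact hc)
      (runs_branch_cons .fwd _ true (encGate g ++ encItems encGate L ++ rest) ?_
        ((gateInv.runs .fwd .rev (by decide) (rawGate g) _ (encItems encGate L ++ rest) ?_).seq
          ((runs_moveAll (by decide) _ (encGate g.inv).reverse ?_).seq (runs_push _ _ _))))
      (ih L _ (by simpa using ht) ?_ ?_ rfl)) ?_ ?_
    · simpa [Regs.set, Regs.get] using hf
    · simp [Regs.set, Regs.get]; rfl
    · simp [Regs.set, Regs.get, hr]; rfl
    · rfl
    · rfl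
    · simp [Regs.set, Regs.get]
      exact hr
    · simp only [hg, encItems_cons, List.length_append, List.length_cons, List.length_reverse,
        length_encGate_inv]
      nlinarith [Nat.zero_le (gateInv (E := E) (Γ := Γ) (σ₀ := σ₀)).c]

theorem runs_fetchInverses {n : ℕ} (L : List (Gate n)) (t : ℕ) (ρ : Regs) (ht : t ≤ L.length)
    (hc : ρ.cnt' = List.replicate t true) (hf : ρ.fwd = encList encGate L) (hr : ρ.rev = []) :
    (fetchInverses : Frag E Γ σ₀).Runs ρ
      { ρ with cnt' := [], fwd := [],
               out := encItems encGate ((L.take t).map Gate.inv).reverse ++ ρ.out }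
      (((gateInv : Transducer E Γ σ₀ _ _).c + 9) * ((encList encGate L).length + 1)) := by
  have hle : (encItems encGate L).length + 1 = (encList encGate L).length := by
    simp [encList_eq]
  have hs : (encItems encGate L).length = (encItems encGate (L.take t)).length +
      (encItems encGate (L.drop t)).length := by
    rw [← List.length_append, ← encItems_append, List.take_append_drop]
  refine Frag.Runs.congr ((runs_fetchInverses_loop L t [false] ρ ht hc hr
    (hf.trans (encList_eq _ _))).seq (runs_clear _ _ _ rfl)) ?_ ?_
  · simp [Regs.set]
  · simp only [Regs.get, List.length_append, List.length_singleton]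
    rw [← hle]
    nlinarith [Nat.zero_le (gateInv (E := E) (Γ := Γ) (σ₀ := σ₀)).c]

end

end StackProgram

/-! ### Binary subtraction and controlled Pauli gates on stacks -/

namespace StackProgram

open Turing Turing.TM2

theorem length_subBits (bs u : List Bool) (c : Bool) :
    (subBits bs u c).1.length = max bs.length u.length := by
  induction bs generalizing u c with
  | nil =>
    induction u generalizing c with
    | nil => simp [subBits]
    | cons a u ih => simp [subBits, ih]
  | cons b bs ih =>
    simp only [subBits, List.length_cons, ih, List.length_tail]
    omega

section

variable {E : Type} {Γ : E → Type} {σ₀ : Type} [DecidableEq E]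

/-- One step of the subtraction in `acc`, for a given bit of the subtrahend. -/
def subStep (b : Bool) : Frag E Γ σ₀ :=
  branch .acc fun u => branch .borrow fun c =>
    push .diff (diffBit (u.getD false) b (c.getD false)) ;;
    push .borrow (borrowBit (u.getD false) b (c.getD false))

theorem runs_subStep (b c : Bool) (ρ : Regs) (hb : ρ.borrow = [c]) :
    (subStep b : Frag E Γ σ₀).Runs ρ
      { ρ with acc := ρ.acc.tail, borrow := [borrowBit (ρ.acc.headD false) b c],
               diff := diffBit (ρ.acc.headD false) b c :: ρ.diff } 4 := by
  refine Frag.Runs.congr (runs_branch .acc _ (runs_branch_cons .borrow _ c [] (by exact hb)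
    ((runs_push _ _ _).seq (runs_push _ _ _)))) ?_ (by simp)
  simp [Regs.set, Regs.get]

/-- Subtracts the number at the front of `inp` from `acc`; the borrow is left in `borrow`. -/
def subtract : Frag E Γ σ₀ :=
  forUnary .inp (loop .inp (fun _ => false) subStep) ;;
  loop .acc (fun _ => true) (fun u => branch .borrow fun c =>
    push .diff (diffBit u false (c.getD false)) ;;
    push .borrow (borrowBit u false (c.getD false))) ;;
  moveAll .diff .acc

/-- The loop ends with the subtrahend, possibly before the minuend does. The witnesses are the
unread digits `u'`, the difference digits `d'` found so far and the current borrow `c'`. What is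
left to do is a subtraction of the empty list from `u'`. -/
theorem runs_subtract_loop (bs : List Bool) (rest : List Bool) :
    ∀ (ρ : Regs) (c : Bool), ρ.inp = encList (fun b => [b]) bs ++ rest → ρ.borrow = [c] →
    ∃ (u' d' : List Bool) (c' : Bool),
      (forUnary .inp (loop .inp (fun _ => false) subStep) : Frag E Γ σ₀).Runs ρ
        { ρ with inp := rest, acc := u', borrow := [c'], diff := d'.reverse ++ ρ.diff }
        (6 * bs.length + 2) ∧
      subBits bs ρ.acc c = (d' ++ (subBits [] u' c').1, (subBits [] u' c').2) := by
  induction bs with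
  | nil =>
    intro ρ c hi hb
    refine ⟨ρ.acc, [], c, (runs_forUnary_false rest (by exact hi)).congr ?_ (by simp), by simp⟩
    cases ρ; simp_all [Regs.set]
  | cons b bs ih =>
    intro ρ c hi hb
    obtain ⟨u', d', c', h1, h2⟩ := ih
      { ρ with inp := encList (fun b => [b]) bs ++ rest, acc := ρ.acc.tail,
               borrow := [borrowBit (ρ.acc.headD false) b c],
               diff := diffBit (ρ.acc.headD false) b c :: ρ.diff } _ rfl rfl
    refine ⟨u', diffBit (ρ.acc.headD false) b c :: d', c', ?_, ?_⟩
    · refine Frag.Runs.congr (runs_forUnary_true ([b] ++ encList (fun b => [b]) bs ++ rest)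
        (by exact hi) (runs_loop_exit .inp _ _ b (encList (fun b => [b]) bs ++ rest) rfl rfl
          (runs_subStep b c _ hb)) h1) ?_ ?_
      · simp
      · simp; omega
    · simp only [subBits]
      simp only at h2
      rw [h2]
      simp

theorem runs_subtract_rest (u : List Bool) :
    ∀ (ρ : Regs) (c : Bool), ρ.acc = u → ρ.borrow = [c] →
    (loop .acc (fun _ => true) (fun u => branch .borrow fun c =>
      push .diff (diffBit u false (c.getD false)) ;;
      push .borrow (borrowBit u false (c.getD false))) : Frag E Γ σ₀).Runs ρ
      { ρ with acc := [], borrow := [(subBits [] u c).2],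
               diff := (subBits [] u c).1.reverse ++ ρ.diff } (4 * u.length + 1) := by
  induction u with
  | nil =>
    intro ρ c ha hb
    refine (runs_loop_nil .acc _ _ (by exact ha)).congr ?_ (by simp)
    cases ρ; simp_all [subBits]
  | cons a u ih =>
    intro ρ c ha hb
    refine Frag.Runs.congr (runs_loop_again .acc _ _ a u (by exact ha) rfl
      (runs_branch_cons .borrow _ c [] (by exact hb)
        ((runs_push _ _ _).seq (runs_push _ _ _))) (ih _ _ rfl rfl)) ?_ ?_
    · simp [subBits, Regs.set, Regs.get]
    · simp; omega

theorem runs_subtract (n : ℕ) (rest : List Bool) (ρ : Regs) (c : Bool)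
    (hi : ρ.inp = encBinary n ++ rest) (hb : ρ.borrow = [c]) (hd : ρ.diff = []) :
    (subtract : Frag E Γ σ₀).Runs ρ
      { ρ with inp := rest, acc := (subBits (Computability.encodeNat n) ρ.acc c).1,
               borrow := [(subBits (Computability.encodeNat n) ρ.acc c).2] }
      (12 * ((encBinary n).length + ρ.acc.length + 1)) := by
  obtain ⟨u', d', c', h1, h2⟩ := runs_subtract_loop (E := E) (Γ := Γ) (σ₀ := σ₀)
    (Computability.encodeNat n) rest ρ c hi hb
  have hl := length_subBits (Computability.encodeNat n) ρ.acc c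
  have hl' := length_subBits [] u' c'
  have hlen : (encBinary n).length = 2 * (Computability.encodeNat n).length + 1 := by
    unfold encBinary
    induction Computability.encodeNat n with
    | nil => rfl
    | cons a l ih => simp [encList, ih]; omega
  rw [h2] at hl ⊢
  refine Frag.Runs.congr (h1.seq ((runs_subtract_rest u' _ c' rfl rfl).seq
    (runs_moveAll (by decide) _ (d' ++ (subBits [] u' c').1).reverse ?_))) ?_ ?_
  · simp [Regs.get, hd]
  · cases ρ; simp_all [Regs.set, Regs.get]
  · simp only [List.length_append, List.length_nil, List.length_reverse] at hl hl' ⊢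
    omega

/-- The part of the code of a gate that follows the codes of the wires. -/
def gateTail (D : ℕ) (coef : Fin 4 → Fin 4 → Fin 4 → ℤ) : List Bool :=
  encBinary D ++ (encTable (encTable (encTable encInt 4) 4) 4 coef ++ [false])

/-- The code of a controlled Pauli gate. -/
def ctrlCode (P : Pauli) (w : ℕ) : List Bool :=
  encUnary 0 ++ (encUnary (w + 1) ++ gateTail 1 (ctrlCoef P.coef))

/-- Writes a controlled Pauli gate, the wire of which is read from `wires`. -/
def emitPauli (P : Pauli) : Frag E Γ σ₀ :=
  prepend .out (gateTail 1 (ctrlCoef P.coef)) ;; push .out false ;;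
  forUnary .wires (push .out true) ;; prepend .out [true, false, true]

theorem runs_emitPauli_loop (w : ℕ) (restW : List Bool) : ∀ (ρ : Regs),
    ρ.wires = encUnary w ++ restW →
    (forUnary .wires (push .out true) : Frag E Γ σ₀).Runs ρ
      { ρ with wires := restW, out := List.replicate w true ++ ρ.out } (2 * w + 2) := by
  induction w with
  | zero =>
    intro ρ hw
    exact (runs_forUnary_false restW (by exact hw)).congr (by simp [Regs.set]) (by simp)
  | succ w ih =>
    intro ρ hw
    refine Frag.Runs.congr (runs_forUnary_true (encUnary w ++ restW) (by exact hw)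
      (runs_push _ _ _) (ih _ rfl)) ?_ ?_
    · have : List.replicate w true ++ true :: ρ.out = List.replicate (w + 1) true ++ ρ.out := by
        rw [List.replicate_succ', List.append_assoc]; rfl
      simp [Regs.set, Regs.get, this]
    · omega

theorem exists_runs_emitPauli : ∃ C : ℕ, ∀ (P : Pauli) (w : ℕ) (restW : List Bool) (ρ : Regs),
    ρ.wires = encUnary w ++ restW →
    (emitPauli P : Frag E Γ σ₀).Runs ρ
      { ρ with wires := restW, out := true :: ctrlCode P w ++ ρ.out } (C + 2 * w) := by
  have hC : ∃ C, ∀ P : Pauli, (gateTail 1 (ctrlCoef P.coef)).length ≤ C := by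
    -- There are only four Pauli labels, and each of the occurring lengths is at most the sum of all
    -- of them.
    refine ⟨∑ P ∈ ({.I, .X, .Y, .Z} : Multiset Pauli).map
      (fun P => (gateTail 1 (ctrlCoef P.coef)).length) |>.toFinset, P, fun P => ?_⟩
    exact Finset.single_le_sum (f := fun x => x) (fun _ _ => Nat.zero_le _)
      (Multiset.mem_toFinset.2 (Multiset.mem_map.2 ⟨P, by cases P <;> simp, rfl⟩))
  obtain ⟨C, hC⟩ := hC
  refine ⟨C + 20, fun P w restW ρ hw => ?_⟩
  refine Frag.Runs.congr ((runs_prepend _ _ _).seq ((runs_push _ _ _).seq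
    ((runs_emitPauli_loop w restW _ ?_).seq (runs_prepend _ _ _)))) ?_ ?_
  · simp [Regs.set, hw]
  -- The three bits written last are the list marker, the unary code of the clean wire `0`, and the
  -- extra `1` that shifts the wire `w` of the system to `w + 1`.
  · simp [Regs.set, Regs.get, ctrlCode, encUnary, List.replicate_succ]
  · have := hC P
    simp
    omega

/-- The Pauli matrix with a given code. -/
def decodePauli : Bool → Bool → Pauli
  | false, false => .I
  | true, false => .X
  | true, true => .Y
  | false, true => .Z

/-- Reads Pauli labels, as many as `size` says. -/
def forPaulis (F : Pauli → Frag E Γ σ₀) : Frag E Γ σ₀ :=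
  forEach .size (push .size' true ;; branch .inp fun b => branch .inp fun b' =>
    F (decodePauli (b.getD false) (b'.getD false))) ;; moveAll .size' .size

theorem runs_readPauli {F : Pauli → Frag E Γ σ₀} (P : Pauli) (rest : List Bool) (ρ ρ' : Regs)
    (t : ℕ) (hi : ρ.inp = encPauli P ++ rest) (h : (F P).Runs { ρ with inp := rest } ρ' t) :
    (branch .inp fun b => branch .inp fun b' =>
      F (decodePauli (b.getD false) (b'.getD false)) : Frag E Γ σ₀).Runs ρ ρ' (t + 2) := by
  obtain ⟨b, b', h1, h2⟩ : ∃ b b', encPauli P = [b, b'] ∧ decodePauli b b' = P := by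
    cases P <;> exact ⟨_, _, rfl, rfl⟩
  subst h2
  rw [h1] at hi
  exact runs_branch_cons .inp _ b (b' :: rest) (by exact hi)
    (runs_branch_cons .inp _ b' rest rfl h)

/-- The loop consumes its counter `size`, which the following terms need again. A copy is therefore
collected in `size'` and moved back afterwards. -/
theorem runs_ignorePaulis_loop (l : List Pauli) (rest : List Bool) : ∀ (ρ : Regs),
    ρ.size = List.replicate l.length true → ρ.inp = l.flatMap encPauli ++ rest →
    (forEach .size (push .size' true ;; branch .inp fun b => branch .inp fun b' =>
      (fun _ => skip) (decodePauli (b.getD false) (b'.getD false))) : Frag E Γ σ₀).Runs ρ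
      { ρ with size := [], inp := rest, size' := List.replicate l.length true ++ ρ.size' }
      (5 * l.length + 1) := by
  induction l with
  | nil =>
    intro ρ hs hi
    refine (runs_forEach_nil (by exact hs)).congr ?_ (by simp)
    cases ρ; simp_all
  | cons P l ih =>
    intro ρ hs hi
    refine Frag.Runs.congr (runs_forEach_cons true (List.replicate l.length true) (by exact hs)
      ((runs_push _ _ _).seq (runs_readPauli (F := fun _ => skip) P
        (l.flatMap encPauli ++ rest) _ _ _ ?_ (runs_skip _))) (ih _ rfl rfl)) ?_ ?_
    · simpa [Regs.set] using hi
    · simp [Regs.set, Regs.get, List.replicate_succ']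
    · simp; omega

theorem runs_ignorePaulis (l : List Pauli) (rest : List Bool) (ρ : Regs)
    (hs : ρ.size = List.replicate l.length true) (hs' : ρ.size' = [])
    (hi : ρ.inp = l.flatMap encPauli ++ rest) :
    (forPaulis fun _ => skip : Frag E Γ σ₀).Runs ρ { ρ with inp := rest }
      (7 * l.length + 2) := by
  refine Frag.Runs.congr ((runs_ignorePaulis_loop l rest ρ hs hi).seq
    (runs_moveAll (by decide) _ (List.replicate l.length true) ?_)) ?_ ?_
  · simp [Regs.get, hs']
  · simp [Regs.set, Regs.get, hs, hs']
  · simp; omega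

theorem runs_emitPaulis_loop (C B : ℕ)
    (hC : ∀ (P : Pauli) (w : ℕ) (restW : List Bool) (ρ : Regs), ρ.wires = encUnary w ++ restW →
      (emitPauli P : Frag E Γ σ₀).Runs ρ
        { ρ with wires := restW, out := true :: ctrlCode P w ++ ρ.out } (C + 2 * w))
    (l : List (Pauli × ℕ)) (rest : List Bool) : ∀ (ρ : Regs),
    (∀ p ∈ l, p.2 ≤ B) →
    ρ.size = List.replicate l.length true → ρ.inp = (l.flatMap fun p => encPauli p.1) ++ rest →
    ρ.wires = l.flatMap (fun p => encUnary p.2) →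
    (forEach .size (push .size' true ;; branch .inp fun b => branch .inp fun b' =>
      emitPauli (decodePauli (b.getD false) (b'.getD false))) : Frag E Γ σ₀).Runs ρ
      { ρ with size := [], inp := rest, size' := List.replicate l.length true ++ ρ.size',
               wires := [], out := encItems (fun p => ctrlCode p.1 p.2) l.reverse ++ ρ.out }
      ((4 + C + 2 * B) * l.length + 1) := by
  induction l with
  | nil =>
    intro ρ hB hs hi hw
    refine (runs_forEach_nil (by exact hs)).congr ?_ (by simp)
    cases ρ; simp_all
  | cons p l ih =>
    intro ρ hB hs hi hw
    obtain ⟨P, w⟩ := p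
    refine Frag.Runs.congr (runs_forEach_cons true (List.replicate l.length true) (by exact hs)
      ((runs_push _ _ _).seq (runs_readPauli (F := emitPauli) P
        ((l.flatMap fun p => encPauli p.1) ++ rest) _ _ _ ?_
          (hC P w (l.flatMap fun p => encUnary p.2) _ ?_)))
      (ih _ (fun p hp => hB p (List.mem_cons_of_mem _ hp)) rfl rfl rfl)) ?_ ?_
    · simpa [Regs.set] using hi
    · simpa [Regs.set] using hw
    · simp [Regs.set, Regs.get, List.replicate_succ']
    · have := hB (P, w) (by simp)
      simp only [List.length_cons] at this ⊢
      nlinarith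

theorem exists_runs_emitPaulis : ∃ C : ℕ, ∀ (l : List (Pauli × ℕ)) (rest : List Bool) (ρ : Regs)
    (B : ℕ), (∀ p ∈ l, p.2 ≤ B) →
    ρ.size = List.replicate l.length true → ρ.size' = [] →
    ρ.inp = (l.flatMap fun p => encPauli p.1) ++ rest →
    ρ.wires = l.flatMap (fun p => encUnary p.2) →
    (forPaulis emitPauli : Frag E Γ σ₀).Runs ρ
      { ρ with inp := rest, wires := [],
               out := encItems (fun p => ctrlCode p.1 p.2) l.reverse ++ ρ.out }
      (C * (B + 1) * (l.length + 1)) := by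
  obtain ⟨C, hC⟩ := exists_runs_emitPauli (E := E) (Γ := Γ) (σ₀ := σ₀)
  refine ⟨C + 8, fun l rest ρ B hB hs hs' hi hw => ?_⟩
  refine Frag.Runs.congr ((runs_emitPaulis_loop C B hC l rest ρ hB hs hi hw).seq
    (runs_moveAll (by decide) _ (List.replicate l.length true) ?_)) ?_ ?_
  · simp [Regs.get, hs']
  · simp [Regs.set, Regs.get, hs, hs']
  · simp only [List.length_replicate]
    nlinarith [Nat.zero_le (C * B * l.length), Nat.zero_le (B * l.length), Nat.zero_le (C * B)]

end

end StackProgram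

theorem encTable_eq {α : Type} (e : α → List Bool) (n : ℕ) (f : Fin n → α) :
    encTable e n f = (List.ofFn f).flatMap e := by
  induction n with
  | zero => rfl
  | succ n ih => simp [encTable, ih]

theorem encItems_map {α β : Type} (e : β → List Bool) (f : α → β) (l : List α) :
    encItems e (l.map f) = encItems (fun a => e (f a)) l := by
  simp [encItems, List.flatMap_map]

/-! ### Reading and writing a term of a Pauli expansion -/

namespace StackProgram

open Turing Turing.TM2

section

variable {E : Type} {Γ : E → Type} {σ₀ : Type} [DecidableEq E]

/-- The code of a phase gate. -/
def phaseCode : List Bool := encUnary 0 ++ (encUnary 1 ++ gateTail 1 phaseCoef)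

theorem encGate_phaseGate (m : ℕ) : encGate (phaseGate m) = phaseCode := by
  simp [encGate, phaseCode, phaseGate, gateTail]

theorem encGate_ctrlPauli {m : ℕ} (P : Pauli) (w : Fin m) :
    encGate (ctrlPauli P w) = ctrlCode P w := by
  simp [encGate, ctrlCode, ctrlPauli, gateTail]

/-- Skips a phase and Pauli labels. -/
def ignoreTerm : Frag E Γ σ₀ := forUnary .inp skip ;; forPaulis fun _ => skip

/-- Writes the gates for a phase and Pauli labels. -/
def emitTerm : Frag E Γ σ₀ :=
  forUnary .inp (prepend .out (true :: phaseCode)) ;; forPaulis emitPauli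

theorem runs_ignoreTerm_loop (n : ℕ) (rest : List Bool) : ∀ (ρ : Regs),
    ρ.inp = encUnary n ++ rest →
    (forUnary .inp skip : Frag E Γ σ₀).Runs ρ { ρ with inp := rest } (2 * n + 2) := by
  induction n with
  | zero => exact fun ρ h => (runs_forUnary_false rest (by exact h)).mono (by simp)
  | succ n ih =>
    exact fun ρ h => (runs_forUnary_true (encUnary n ++ rest) (by exact h) (runs_skip _)
      (ih _ rfl)).mono (by omega)

theorem runs_emitTerm_loop (n m : ℕ) (rest : List Bool) : ∀ (ρ : Regs),
    ρ.inp = encUnary n ++ rest →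
    (forUnary .inp (prepend .out (true :: phaseCode)) : Frag E Γ σ₀).Runs ρ
      { ρ with inp := rest,
               out := encItems encGate (List.replicate n (phaseGate m)) ++ ρ.out }
      ((phaseCode.length + 4) * (n + 1)) := by
  induction n with
  | zero => exact fun ρ h => (runs_forUnary_false rest (by exact h)).mono (by simp)
  | succ n ih =>
    intro ρ h
    refine Frag.Runs.congr (runs_forUnary_true (encUnary n ++ rest) (by exact h)
      (runs_prepend _ _ _) (ih _ rfl)) ?_ ?_
    · rw [List.replicate_succ']
      simp [Regs.set, Regs.get, encGate_phaseGate]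
    · simp only [List.length_cons]
      nlinarith [phaseCode.length]

theorem runs_ignoreTerm {s : ℕ} (T : PauliTerm s) (rest : List Bool) (ρ : Regs)
    (hs : ρ.size = List.replicate s true) (hs' : ρ.size' = [])
    (hi : ρ.inp = encUnary T.phase ++ (encTable encPauli s T.paulis ++ rest)) :
    (ignoreTerm : Frag E Γ σ₀).Runs ρ { ρ with inp := rest } (7 * s + 12) := by
  refine Frag.Runs.congr ((runs_ignoreTerm_loop T.phase _ ρ hi).seq
    (runs_ignorePaulis (List.ofFn T.paulis) rest _ ?_ hs' ?_)) rfl ?_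
  · simpa using hs
  · simp [encTable_eq]
  · have := T.phase.isLt
    simp
    omega

theorem exists_runs_emitTerm : ∃ C : ℕ, ∀ {m s : ℕ} (w : Fin s ↪ Fin m) (T : PauliTerm s)
    (rest : List Bool) (ρ : Regs) (B : ℕ), (∀ i, (w i : ℕ) ≤ B) → s ≤ B →
    ρ.size = List.replicate s true → ρ.size' = [] →
    ρ.inp = encUnary T.phase ++ (encTable encPauli s T.paulis ++ rest) →
    ρ.wires = encTable (fun w : Fin m => encUnary w) s w →
    (emitTerm : Frag E Γ σ₀).Runs ρ
      { ρ with inp := rest, wires := [], out := encItems encGate (termGates w T) ++ ρ.out }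
      (C * (B + 1) ^ 2) := by
  obtain ⟨C, hC⟩ := exists_runs_emitPaulis (E := E) (Γ := Γ) (σ₀ := σ₀)
  refine ⟨C + (phaseCode.length + 4) * 4, fun {m s} w T rest ρ B hw hsB hs hs' hi hρ => ?_⟩
  refine Frag.Runs.congr ((runs_emitTerm_loop T.phase m _ ρ hi).seq
    (hC (List.ofFn fun i => (T.paulis i, (w i : ℕ))) rest _ B ?_ ?_ hs' ?_ ?_)) ?_ ?_
  · simpa [List.mem_ofFn] using hw
  · simpa using hs
  · simp only [encTable_eq]
    congr 1
    -- Composing with `id` presents both lists as images of the same `List.ofFn id`, so that the two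
    -- `flatMap`s can be compared entry by entry.
    rw [show (fun i => (T.paulis i, (w i : ℕ))) = (fun i => (T.paulis i, (w i : ℕ))) ∘ id from rfl,
      ← List.map_ofFn, List.flatMap_map, show T.paulis = T.paulis ∘ id from rfl, ← List.map_ofFn,
      List.flatMap_map]
    rfl
  · simp only [hρ, encTable_eq]
    rw [show (fun i => (T.paulis i, (w i : ℕ))) = (fun i => (T.paulis i, (w i : ℕ))) ∘ id from rfl,
      ← List.map_ofFn, List.flatMap_map, show (w : Fin s → Fin m) = w ∘ id from rfl,
      ← List.map_ofFn, List.flatMap_map]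
    rfl
  · have : encItems encGate (List.ofFn fun i => ctrlPauli (T.paulis i) (w i)).reverse =
        encItems (fun p => ctrlCode p.1 p.2)
          (List.ofFn fun i => (T.paulis i, (w i : ℕ))).reverse := by
      rw [show (fun i => (T.paulis i, (w i : ℕ))) = (fun i => (T.paulis i, (w i : ℕ))) ∘ id from rfl,
        ← List.map_ofFn, show (fun i => ctrlPauli (T.paulis i) (w i)) =
          (fun i => ctrlPauli (T.paulis i) (w i)) ∘ id from rfl, ← List.map_ofFn,
        ← List.map_reverse, ← List.map_reverse, encItems_map, encItems_map]
      simp [encGate_ctrlPauli]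
    simp [termGates, this]
  · have h3 := T.phase.isLt
    have h1 : ((T.phase : ℕ) + 1) ≤ 4 := by omega
    have h2 : C * (B + 1) * (s + 1) ≤ C * (B + 1) * (B + 1) := by gcongr
    have h4 : (phaseCode.length + 4) * ((T.phase : ℕ) + 1) ≤ (phaseCode.length + 4) * 4 := by
      gcongr
    have h5 : 1 ≤ (B + 1) ^ 2 := Nat.one_le_pow _ _ (by omega)
    simp only [List.length_ofFn]
    nlinarith

/-- Processes a term of an expansion: subtracts its multiplicity from `acc` and, at the first
borrow, writes the gates of the term. -/
def termProg : Frag E Γ σ₀ :=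
  push .borrow false ;; subtract ;; branch .borrow fun c => match c with
    | some true => branch .flag fun f => match f with
      | some _ => emitTerm
      | none => ignoreTerm
    | _ => ignoreTerm

theorem length_encBinary (n : ℕ) :
    (encBinary n).length = 2 * (Computability.encodeNat n).length + 1 := by
  unfold encBinary
  induction Computability.encodeNat n with
  | nil => rfl
  | cons a l ih => simp [encList, ih]; omega

theorem length_encTerm {s : ℕ} (T : PauliTerm s) :
    (encTerm T).length = (encBinary T.mult).length + (T.phase + 1) + 2 * s := by
  have : ∀ l : List Pauli, (l.flatMap encPauli).length = 2 * l.length := by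
    intro l
    induction l with
    | nil => rfl
    | cons P l ih => cases P <;> simp_all [encPauli] <;> omega
  simp [encTerm, encTable_eq, this, encUnary]
  omega

/-- A term is skipped for one of two reasons: the number lies beyond its interval, so that there is
no borrow, or an earlier term was selected and `flag` is empty. In the second case `acc` no longer
has a meaning, but the subtraction is performed all the same. -/
theorem runs_termProg_of_not_borrow {s : ℕ} (T : PauliTerm s) (rest : List Bool) (ρ : Regs)
    (B : ℕ) (hB : (encTerm T).length ≤ B) (ha : ρ.acc.length ≤ B)
    (hs : ρ.size = List.replicate s true) (hs' : ρ.size' = [])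
    (hb : ρ.borrow = []) (hd : ρ.diff = []) (hi : ρ.inp = encTerm T ++ rest)
    (h : ρ.flag = [] ∨ (subBits (Computability.encodeNat T.mult) ρ.acc false).2 = false) :
    (termProg : Frag E Γ σ₀).Runs ρ
      { ρ with inp := rest, acc := (subBits (Computability.encodeNat T.mult) ρ.acc false).1 }
      (40 * (B + 1)) := by
  have hl := length_encTerm T
  have hsub := runs_subtract (E := E) (Γ := Γ) (σ₀ := σ₀) T.mult
    (encUnary T.phase ++ (encTable encPauli s T.paulis ++ rest)) (ρ.set .borrow [false]) false
    (by simpa [Regs.set, encTerm] using hi) rfl hd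
  have hpush := runs_push (E := E) (Γ := Γ) (σ₀ := σ₀) .borrow false ρ
  rw [show ρ.get .borrow = [] from hb] at hpush
  have hign := runs_ignoreTerm (E := E) (Γ := Γ) (σ₀ := σ₀) T rest
    { ρ with inp := encUnary T.phase ++ (encTable encPauli s T.paulis ++ rest),
             acc := (subBits (Computability.encodeNat T.mult) ρ.acc false).1 } hs hs' rfl
  refine Frag.Runs.congr (t := 1 + (12 * ((encBinary T.mult).length + ρ.acc.length + 1) +
    ((7 * s + 12) + 1 + 1))) (hpush.seq (hsub.seq ?_)) (ρ' :=
      { ρ with inp := rest, acc := (subBits (Computability.encodeNat T.mult) ρ.acc false).1 })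
      rfl ?_
  · cases hc : (subBits (Computability.encodeNat T.mult) ρ.acc false).2
    · refine Frag.Runs.mono (runs_branch_cons .borrow _ false [] ?_ (hign.congr' ?_)) (by omega)
      · exact congrArg (fun c => [c]) hc
      · cases ρ; simp_all [Regs.set]
    · have hf : ρ.flag = [] := by simpa [hc] using h
      refine runs_branch_cons .borrow _ true [] ?_ (runs_branch_nil .flag _ hf (hign.congr' ?_))
      · exact congrArg (fun c => [c]) hc
      · cases ρ; simp_all [Regs.set]
  · omega

/-- The first borrow says that the number falls into the interval of this term. Emptying `flag`
prevents a second selection, and the wires can be consumed because no later term needs them. -/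
theorem exists_runs_termProg_of_borrow : ∃ C : ℕ, ∀ {m s : ℕ} (w : Fin s ↪ Fin m)
    (T : PauliTerm s) (rest : List Bool) (ρ : Regs) (B : ℕ),
    (∀ i, (w i : ℕ) ≤ B) → (encTerm T).length ≤ B → ρ.acc.length ≤ B →
    ρ.size = List.replicate s true → ρ.size' = [] →
    ρ.borrow = [] → ρ.diff = [] → ρ.inp = encTerm T ++ rest → ρ.flag = [true] →
    ρ.wires = encTable (fun w : Fin m => encUnary w) s w →
    (subBits (Computability.encodeNat T.mult) ρ.acc false).2 = true →
    (termProg : Frag E Γ σ₀).Runs ρ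
      { ρ with inp := rest, acc := (subBits (Computability.encodeNat T.mult) ρ.acc false).1,
               flag := [], wires := [], out := encItems encGate (termGates w T) ++ ρ.out }
      (C * (B + 1) ^ 2) := by
  obtain ⟨C, hC⟩ := exists_runs_emitTerm (E := E) (Γ := Γ) (σ₀ := σ₀)
  refine ⟨C + 40, fun {m s} w T rest ρ B hw hB ha hs hs' hb hd hi hf hρ hc => ?_⟩
  have hl := length_encTerm T
  have hsub := runs_subtract (E := E) (Γ := Γ) (σ₀ := σ₀) T.mult
    (encUnary T.phase ++ (encTable encPauli s T.paulis ++ rest)) (ρ.set .borrow [false]) false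
    (by simpa [Regs.set, encTerm] using hi) rfl hd
  have hpush := runs_push (E := E) (Γ := Γ) (σ₀ := σ₀) .borrow false ρ
  rw [show ρ.get .borrow = [] from hb] at hpush
  have hemit := hC w T rest
    { ρ with inp := encUnary T.phase ++ (encTable encPauli s T.paulis ++ rest),
             acc := (subBits (Computability.encodeNat T.mult) ρ.acc false).1,
             flag := [] } B hw (by omega) hs hs' rfl hρ
  refine Frag.Runs.mono (hpush.seq (hsub.seq (runs_branch_cons .borrow _ true [] ?_
    (runs_branch_cons .flag _ true [] hf (hemit.congr' ?_))))) ?_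
  · exact congrArg (fun c => [c]) hc
  · cases ρ; simp_all [Regs.set]
  · have h1 : B + 1 ≤ (B + 1) ^ 2 := Nat.le_self_pow (by norm_num) _
    have h2 : (ρ.set .borrow [false]).acc = ρ.acc := rfl
    rw [h2]
    nlinarith

end

end StackProgram

/-! ### Selecting a term and writing a local operator -/

namespace StackProgram

open Turing Turing.TM2

section

variable {E : Type} {Γ : E → Type} {σ₀ : Type} [DecidableEq E]

/-- Processes a list of terms when a term has been selected before. -/
theorem runs_terms_of_selected {s : ℕ} (B : ℕ) (l : List (PauliTerm s)) (rest : List Bool) :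
    ∀ (ρ : Regs), (∀ T ∈ l, (encTerm T).length ≤ B) → ρ.acc.length ≤ B →
    ρ.size = List.replicate s true → ρ.size' = [] → ρ.borrow = [] → ρ.diff = [] →
    ρ.inp = encList encTerm l ++ rest → ρ.flag = [] →
    ∃ u : List Bool, u.length ≤ B ∧
      (forUnary .inp termProg : Frag E Γ σ₀).Runs ρ { ρ with inp := rest, acc := u }
        ((40 * (B + 1) + 1) * l.length + 2) := by
  induction l with
  | nil =>
    intro ρ _ ha _ _ _ _ hi _
    exact ⟨ρ.acc, ha, (runs_forUnary_false rest (by exact hi)).congr (by simp [Regs.set])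
      (by simp)⟩
  | cons T l ih =>
    intro ρ hB ha hs hs' hb hd hi hf
    have hT := hB T (by simp)
    have hT' := length_encTerm T
    have hT'' := length_encBinary T.mult
    have hlen := length_subBits (Computability.encodeNat T.mult) ρ.acc false
    obtain ⟨u, hu, h⟩ := ih
      { ρ with inp := encList encTerm l ++ rest,
               acc := (subBits (Computability.encodeNat T.mult) ρ.acc false).1 }
      (fun T hT => hB T (List.mem_cons_of_mem _ hT)) (by simp only [hlen]; omega)
      hs hs' hb hd rfl hf
    refine ⟨u, hu, (runs_forUnary_true (encTerm T ++ (encList encTerm l ++ rest))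
      (by simpa [encList, Regs.get] using hi)
      (runs_termProg_of_not_borrow T (encList encTerm l ++ rest)
        (ρ.set .inp (encTerm T ++ (encList encTerm l ++ rest))) B hT ha hs hs' hb hd
        rfl (Or.inl hf)) h).mono ?_⟩
    simp only [List.length_cons]
    ring_nf
    omega

/-- The registers after a list of terms has been processed. -/
def afterTerms {m s : ℕ} (w : Fin s ↪ Fin m) (ρ : Regs) (rest u : List Bool) :
    Option (PauliTerm s) → Regs
  | some T => { ρ with inp := rest, acc := u, flag := [], wires := [],
                       out := encItems encGate (termGates w T) ++ ρ.out }
  | none => { ρ with inp := rest, acc := u }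

/-- Up to the first borrow the program and `selectTerm` perform the same subtractions; after it, the
remaining terms are only skipped. The final content `u` of `acc` is not specified, since only its
length matters for the time needed to clear it. -/
theorem exists_runs_terms : ∃ C : ℕ, ∀ {m s : ℕ} (w : Fin s ↪ Fin m) (B : ℕ)
    (l : List (PauliTerm s)) (rest : List Bool) (ρ : Regs),
    (∀ i, (w i : ℕ) ≤ B) → (∀ T ∈ l, (encTerm T).length ≤ B) → ρ.acc.length ≤ B →
    ρ.size = List.replicate s true → ρ.size' = [] → ρ.borrow = [] → ρ.diff = [] →
    ρ.inp = encList encTerm l ++ rest → ρ.flag = [true] →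
    ρ.wires = encTable (fun w : Fin m => encUnary w) s w →
    ∃ u : List Bool, u.length ≤ B ∧
      (forUnary .inp termProg : Frag E Γ σ₀).Runs ρ
        (afterTerms w ρ rest u (selectTerm l ρ.acc)) (C * (B + 1) ^ 2 * (l.length + 1)) := by
  obtain ⟨C, hC⟩ := exists_runs_termProg_of_borrow (E := E) (Γ := Γ) (σ₀ := σ₀)
  refine ⟨C + 100, fun {m s} w B l => ?_⟩
  have h1 : B + 1 ≤ (B + 1) ^ 2 := Nat.le_self_pow (by norm_num) _
  induction l with
  | nil =>
    intro rest ρ _ _ ha _ _ _ _ hi _ _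
    refine ⟨ρ.acc, ha, (runs_forUnary_false rest (by exact hi)).congr
      (by simp [Regs.set, selectTerm, afterTerms]) ?_⟩
    simp only [List.length_nil, zero_add, mul_one]
    nlinarith [Nat.zero_le (C * (B + 1) ^ 2)]
  | cons T l ih =>
    intro rest ρ hw hB ha hs hs' hb hd hi hf hρ
    have hT := hB T (by simp)
    have hT' := length_encTerm T
    have hT'' := length_encBinary T.mult
    have hlen := length_subBits (Computability.encodeNat T.mult) ρ.acc false
    have hlen' : (subBits (Computability.encodeNat T.mult) ρ.acc false).1.length ≤ B := by omega
    have hBl : ∀ T ∈ l, (encTerm T).length ≤ B := fun T hT => hB T (List.mem_cons_of_mem _ hT)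
    cases hc : (subBits (Computability.encodeNat T.mult) ρ.acc false).2
    · obtain ⟨u, hu, h⟩ := ih rest
        { ρ with inp := encList encTerm l ++ rest,
                 acc := (subBits (Computability.encodeNat T.mult) ρ.acc false).1 }
        hw hBl hlen' hs hs' hb hd rfl hf hρ
      refine ⟨u, hu, Frag.Runs.congr (runs_forUnary_true
        (encTerm T ++ (encList encTerm l ++ rest)) (by simpa [encList, Regs.get] using hi)
        (runs_termProg_of_not_borrow T (encList encTerm l ++ rest)
          (ρ.set .inp (encTerm T ++ (encList encTerm l ++ rest))) B hT ha hs hs' hb hd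
          rfl (Or.inr hc)) h) ?_ ?_⟩
      · simp only [selectTerm, hc]
        simp only [Bool.false_eq_true, if_false]
        cases selectTerm l (subBits (Computability.encodeNat T.mult) ρ.acc false).1 <;> rfl
      · simp only [List.length_cons]
        nlinarith [Nat.zero_le (C * (B + 1) ^ 2)]
    · obtain ⟨u, hu, h⟩ := runs_terms_of_selected (E := E) (Γ := Γ) (σ₀ := σ₀) B l rest
        { ρ with inp := encList encTerm l ++ rest,
                 acc := (subBits (Computability.encodeNat T.mult) ρ.acc false).1,
                 flag := [], wires := [], out := encItems encGate (termGates w T) ++ ρ.out }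
        hBl hlen' hs hs' hb hd rfl rfl
      refine ⟨u, hu, Frag.Runs.congr (runs_forUnary_true
        (encTerm T ++ (encList encTerm l ++ rest)) (by simpa [encList, Regs.get] using hi)
        (hC w T (encList encTerm l ++ rest)
          (ρ.set .inp (encTerm T ++ (encList encTerm l ++ rest))) B hw hT ha hs hs' hb hd
          rfl hf hρ hc) h) ?_ ?_⟩
      · simp only [selectTerm, hc]
        rfl
      · simp only [List.length_cons]
        have h2 : (B + 1) * l.length ≤ (B + 1) ^ 2 * l.length := by gcongr
        nlinarith [Nat.zero_le (C * (B + 1) ^ 2 * l.length)]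

/-- Moves a bit of the seed to a register. -/
def takeSeed (r : Reg) : Frag E Γ σ₀ := branch .seed fun o => push r (o.getD false)

theorem runs_takeSeed (r : Reg) (hr : r ≠ .seed) (ρ : Regs) :
    (takeSeed r : Frag E Γ σ₀).Runs ρ
      ((ρ.set .seed ρ.seed.tail).set r (ρ.seed.headD false :: ρ.get r)) 2 := by
  refine Frag.Runs.congr (runs_branch .seed _ (runs_push _ _ _)) ?_ le_rfl
  rw [Regs.get_set_of_ne _ hr, List.headD_eq_head?_getD]
  rfl

/-- Moves a number of bits of the seed to `acc`. -/
def takeSeeds : ℕ → Frag E Γ σ₀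
  | 0 => skip
  | n + 1 => takeSeed .acc ;; takeSeeds n

theorem runs_takeSeeds (n : ℕ) (ρ : Regs) :
    (takeSeeds n : Frag E Γ σ₀).Runs ρ
      { ρ with seed := ρ.seed.drop n, acc := (takeBits n ρ.seed).reverse ++ ρ.acc }
      (2 * n + 1) := by
  induction n generalizing ρ with
  | zero => simpa [takeSeeds, takeBits] using runs_skip ρ
  | succ n ih =>
    refine Frag.Runs.congr ((runs_takeSeed .acc (by decide) ρ).seq (ih _)) ?_ (by omega)
    simp [Regs.set, Regs.get, takeBits]

theorem runs_takeSeed_loop (n : ℕ) (rest : List Bool) : ∀ (ρ : Regs),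
    ρ.inp = encUnary n ++ rest →
    (forUnary .inp (takeSeed .acc) : Frag E Γ σ₀).Runs ρ
      { ρ with inp := rest, seed := ρ.seed.drop n,
               acc := (takeBits n ρ.seed).reverse ++ ρ.acc } (3 * n + 2) := by
  induction n with
  | zero =>
    exact fun ρ h => (runs_forUnary_false rest (by exact h)).congr
      (by simp [Regs.set, takeBits]) (by simp)
  | succ n ih =>
    refine fun ρ h => (runs_forUnary_true (encUnary n ++ rest) (by exact h)
      (runs_takeSeed .acc (by decide) _) (ih _ rfl)).congr ?_ (by omega)
    simp [Regs.set, Regs.get, takeBits]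

theorem takeBits_add (m n : ℕ) (s : List Bool) :
    takeBits (m + n) s = takeBits m s ++ takeBits n (s.drop m) := by
  induction m generalizing s with
  | zero => simp [takeBits]
  | succ m ih =>
    rw [Nat.succ_add]
    simp [takeBits, ih]

theorem length_takeBits (n : ℕ) (s : List Bool) : (takeBits n s).length = n := by
  induction n generalizing s with
  | zero => rfl
  | succ n ih => simp [takeBits, ih]

/-- Reads a unary code and pushes as many bits on a register. -/
theorem runs_countUnary {r : Reg} (hr : r ≠ .inp) (n : ℕ) (rest : List Bool) : ∀ (ρ : Regs),
    ρ.inp = encUnary n ++ rest →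
    (forUnary .inp (push r true) : Frag E Γ σ₀).Runs ρ
      ((ρ.set .inp rest).set r (List.replicate n true ++ ρ.get r)) (2 * n + 2) := by
  induction n with
  | zero =>
    refine fun ρ h => (runs_forUnary_false rest (by exact h)).congr ?_ (by simp)
    rw [show List.replicate 0 true ++ ρ.get r = (ρ.set .inp rest).get r by simp [hr],
      Regs.set_get]
  | succ n ih =>
    refine fun ρ h => (runs_forUnary_true (encUnary n ++ rest) (by exact h)
      (runs_push _ _ _) (ih _ ?_)).congr ?_ (by omega)
    · exact Regs.get_set_of_ne _ hr.symm _
    · rw [Regs.set_set_set_set _ hr.symm]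
      simp [hr, List.replicate_succ']

/-- Reads as many unary codes as `size` says. -/
theorem runs_readWires_loop {m : ℕ} (l : List (Fin m)) (rest : List Bool) : ∀ (ρ : Regs),
    ρ.size = List.replicate l.length true →
    ρ.inp = (l.flatMap fun w : Fin _ => encUnary w) ++ rest →
    (forEach .size (push .size' true ;; Transducer.unary.prog .inp .wires') :
      Frag E Γ σ₀).Runs ρ
      { ρ with size := [], inp := rest, size' := List.replicate l.length true ++ ρ.size',
               wires' := (l.flatMap fun w : Fin _ => encUnary w).reverse ++ ρ.wires' }
      (6 * (l.flatMap fun w : Fin _ => encUnary w).length + 1) := by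
  induction l with
  | nil =>
    intro ρ hs hi
    refine (runs_forEach_nil (by exact hs)).congr ?_ (by simp)
    cases ρ; simp_all
  | cons w l ih =>
    intro ρ hs hi
    refine Frag.Runs.congr (runs_forEach_cons true (List.replicate l.length true) (by exact hs)
      ((runs_push _ _ _).seq (Transducer.unary.runs .inp .wires' (by decide) (w : ℕ) _
        ((l.flatMap fun w : Fin _ => encUnary w) ++ rest) ?_)) (ih _ rfl rfl)) ?_ ?_
    · simpa [Regs.set, Regs.get] using hi
    · simp [Regs.set, Regs.get, List.replicate_succ']
    · simp [Transducer.unary, encUnary]; omega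

/-- Writes a random sign. -/
def emitSign : Frag E Γ σ₀ :=
  branch .sign fun b => match b with
    | some true => prepend .out (true :: phaseCode ++ true :: phaseCode)
    | _ => skip

theorem runs_emitSign (m : ℕ) (b : Bool) (ρ : Regs) (h : ρ.sign = [b]) :
    (emitSign : Frag E Γ σ₀).Runs ρ
      { ρ with sign := [],
               out := encItems encGate (if b then [phaseGate m, phaseGate m] else []) ++ ρ.out }
      (2 * phaseCode.length + 5) := by
  cases b
  · exact Frag.Runs.mono (runs_branch_cons .sign _ false [] h (runs_skip _)) (by omega)
  · refine Frag.Runs.congr (runs_branch_cons .sign _ true [] h (runs_prepend _ _ _)) ?_ ?_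
    · simp [Regs.set, Regs.get, encGate_phaseGate]
    · simp; omega

/-- Writes the gates of a local operator. -/
def opProg (κ : ℕ) : Frag E Γ σ₀ :=
  forUnary .inp (push .size true) ;;
  forEach .size (push .size' true ;; Transducer.unary.prog .inp .wires') ;;
  moveAll .size' .size ;; moveAll .wires' .wires ;;
  forUnary .inp (takeSeed .acc) ;; takeSeeds κ ;; takeSeed .sign ;; push .flag true ;;
  forUnary .inp termProg ;;
  branch .flag (fun f => match f with
    | some _ => emitSign
    | none => skip) ;;
  clear .sign ;; clear .acc ;; clear .wires ;; clear .size

theorem length_encUnary (n : ℕ) : (encUnary n).length = n + 1 := by simp [encUnary]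

theorem length_encLocalOp {m : ℕ} (O : LocalOp m) :
    (encLocalOp O).length = (O.s + 1) + ((encTable (fun w : Fin m => encUnary w) O.s O.wires).length
      + ((O.prec + 1) + (encList encTerm O.terms).length)) := by
  simp only [encLocalOp, List.length_append, length_encUnary]

theorem length_le_encList {α : Type} (e : α → List Bool) (l : List α) :
    (∀ a ∈ l, (e a).length ≤ (encList e l).length) ∧ l.length ≤ (encList e l).length := by
  induction l with
  | nil => simp
  | cons b l ih =>
    refine ⟨?_, ?_⟩
    · intro a ha
      rcases List.mem_cons.1 ha with rfl | ha
      · simp [encList]; omega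
      · have := ih.1 a ha
        simp [encList]; omega
    · have := ih.2
      simp [encList]; omega

theorem le_length_encTable {m s : ℕ} (w : Fin s → Fin m) (i : Fin s) :
    (w i : ℕ) ≤ (encTable (fun w : Fin m => encUnary w) s w).length := by
  rw [encTable_eq]
  have : (encUnary (w i)).length ≤ ((List.ofFn w).flatMap fun w : Fin _ => encUnary w).length := by
    rw [List.length_flatMap]
    exact List.single_le_sum (fun _ _ => Nat.zero_le _) _
      (List.mem_map.2 ⟨w i, List.mem_ofFn.2 ⟨i, rfl⟩, rfl⟩)
  rw [length_encUnary] at this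
  omega

/-- The sign bit is drawn even if a term is selected and the sign is not used. The number of seed
bits consumed is thus independent of the outcome, which gives the probes disjoint blocks of random
bits at fixed positions. -/
theorem exists_runs_opProg (κ : ℕ) : ∃ C : ℕ, ∀ {m : ℕ} (O : LocalOp m) (rest : List Bool)
    (ρ : Regs), ρ.inp = encLocalOp O ++ rest → ρ.size = [] → ρ.size' = [] → ρ.wires = [] →
    ρ.wires' = [] → ρ.acc = [] → ρ.sign = [] → ρ.flag = [] → ρ.borrow = [] → ρ.diff = [] →
    (opProg κ : Frag E Γ σ₀).Runs ρ
      { ρ with inp := rest, seed := ρ.seed.drop (O.prec + κ + 1),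
               out := encItems encGate (opGates κ O ρ.seed) ++ ρ.out }
      (C * ((encLocalOp O).length + 1) ^ 3) := by
  obtain ⟨C, hC⟩ := exists_runs_terms (E := E) (Γ := Γ) (σ₀ := σ₀)
  refine ⟨C * (κ + 1) ^ 2 + 100 + 8 * κ + 2 * phaseCode.length, fun {m} O rest ρ hi h1 h2 h3 h4 h5 h6 h7 h8 h9 => ?_⟩
  have hlen := length_encLocalOp O
  have hterms := length_le_encList encTerm O.terms
  obtain ⟨L, hL⟩ : ∃ L, L = (encLocalOp O).length := ⟨_, rfl⟩
  obtain ⟨W, hW⟩ : ∃ W, W = encTable (fun w : Fin m => encUnary w) O.s O.wires := ⟨_, rfl⟩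
  have hW' : W = (List.ofFn O.wires).flatMap fun w : Fin _ => encUnary w := by rw [hW, encTable_eq]
  -- The bound `L + κ` covers the wires and the codes of the terms, which are parts of the code of
  -- length `L`, and also the drawn number, which has `prec + κ` bits.
  obtain ⟨u, hu, hrun⟩ := hC O.wires (L + κ) O.terms rest
    { ρ with inp := encList encTerm O.terms ++ rest, size := List.replicate O.s true,
             wires := W, acc := (takeBits (O.prec + κ) ρ.seed).reverse,
             sign := [(ρ.seed.drop (O.prec + κ)).headD false], flag := [true],
             seed := ρ.seed.drop (O.prec + κ + 1) }
    (fun i => by have := le_length_encTable O.wires i; omega)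
    (fun T hT => by have := hterms.1 T hT; omega)
    (by simp only [List.length_reverse, length_takeBits]; omega)
    rfl h2 h8 h9 rfl rfl hW
  have s1 := runs_countUnary (E := E) (Γ := Γ) (σ₀ := σ₀) (r := .size) (by decide) O.s
    (W ++ (encUnary O.prec ++ (encList encTerm O.terms ++ rest))) ρ
    (by simpa [encLocalOp, hW] using hi)
  have s2 := runs_readWires_loop (E := E) (Γ := Γ) (σ₀ := σ₀) (List.ofFn O.wires)
    (encUnary O.prec ++ (encList encTerm O.terms ++ rest))
    (ρ := { ρ with inp := W ++ (encUnary O.prec ++ (encList encTerm O.terms ++ rest)),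
                   size := List.replicate O.s true })
    (by simp) (by rw [← hW'])
  rw [← hW'] at s2
  simp only [List.length_ofFn] at s2
  have s3 := runs_moveAll (E := E) (Γ := Γ) (σ₀ := σ₀) (A := .size') (B := .size) (by decide)
    { ρ with inp := encUnary O.prec ++ (encList encTerm O.terms ++ rest), size := [],
             size' := List.replicate O.s true, wires' := W.reverse } _ rfl
  have s4 := runs_moveAll (E := E) (Γ := Γ) (σ₀ := σ₀) (A := .wires') (B := .wires) (by decide)
    { ρ with inp := encUnary O.prec ++ (encList encTerm O.terms ++ rest),
             size := List.replicate O.s true, wires' := W.reverse } _ rfl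
  have s5 := runs_takeSeed_loop (E := E) (Γ := Γ) (σ₀ := σ₀) O.prec
    (encList encTerm O.terms ++ rest)
    { ρ with inp := encUnary O.prec ++ (encList encTerm O.terms ++ rest),
             size := List.replicate O.s true, wires := W } rfl
  have s6 := runs_takeSeeds (E := E) (Γ := Γ) (σ₀ := σ₀) κ
    { ρ with inp := encList encTerm O.terms ++ rest,
             size := List.replicate O.s true, wires := W, seed := ρ.seed.drop O.prec,
             acc := (takeBits O.prec ρ.seed).reverse }
  have s7 := runs_takeSeed (E := E) (Γ := Γ) (σ₀ := σ₀) .sign (by decide)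
    { ρ with inp := encList encTerm O.terms ++ rest,
             size := List.replicate O.s true, wires := W, seed := ρ.seed.drop (O.prec + κ),
             acc := (takeBits (O.prec + κ) ρ.seed).reverse }
  have s8 := runs_push (E := E) (Γ := Γ) (σ₀ := σ₀) .flag true
    { ρ with inp := encList encTerm O.terms ++ rest,
             size := List.replicate O.s true, wires := W, seed := ρ.seed.drop (O.prec + κ + 1),
             acc := (takeBits (O.prec + κ) ρ.seed).reverse,
             sign := [(ρ.seed.drop (O.prec + κ)).headD false] }
  have hWl : W.length ≤ L := by rw [hW]; omega
  -- The two outcomes of the selection leave different registers behind. After the sign has been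
  -- written or omitted and the auxiliary registers have been cleared, they agree.
  have key : ∃ (ρ₁ : Regs), (branch .flag (fun f => match f with
      | some _ => emitSign
      | none => skip) ;; clear .sign ;; clear .acc ;; clear .wires ;; clear .size :
        Frag E Γ σ₀).Runs (afterTerms O.wires
        { ρ with inp := encList encTerm O.terms ++ rest, size := List.replicate O.s true,
                 wires := W, acc := (takeBits (O.prec + κ) ρ.seed).reverse,
                 sign := [(ρ.seed.drop (O.prec + κ)).headD false], flag := [true],
                 seed := ρ.seed.drop (O.prec + κ + 1) } rest u
        (selectTerm O.terms (takeBits (O.prec + κ) ρ.seed).reverse)) ρ₁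
        (2 * phaseCode.length + 20 + 10 * (L + κ)) ∧ ρ₁ =
      { ρ with inp := rest, seed := ρ.seed.drop (O.prec + κ + 1),
               out := encItems encGate (opGates κ O ρ.seed) ++ ρ.out } := by
    unfold opGates
    cases hsel : selectTerm O.terms (takeBits (O.prec + κ) ρ.seed).reverse with
    | some T =>
      refine ⟨_, Frag.Runs.mono ((runs_branch_nil .flag _ rfl (runs_skip _)).seq
        ((runs_clear _ _ _ rfl).seq ((runs_clear _ _ _ rfl).seq ((runs_clear _ _ _ rfl).seq
          (runs_clear _ _ _ rfl))))) ?_, ?_⟩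
      · simp only [afterTerms, Regs.get, Regs.set, List.length_cons, List.length_nil,
          List.length_replicate]
        omega
      · cases ρ; simp_all [afterTerms, Regs.set]
    | none =>
      refine ⟨_, Frag.Runs.mono ((runs_branch_cons .flag _ true [] rfl
        (runs_emitSign m ((ρ.seed.drop (O.prec + κ)).headD false) _ rfl)).seq
        ((runs_clear _ _ _ rfl).seq ((runs_clear _ _ _ rfl).seq ((runs_clear _ _ _ rfl).seq
          (runs_clear _ _ _ rfl))))) ?_, ?_⟩
      · simp only [afterTerms, Regs.get, Regs.set, List.length_nil,
          List.length_replicate]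
        omega
      · cases ρ; simp_all [afterTerms, Regs.set]
  obtain ⟨ρ₁, hk, rfl⟩ := key
  refine Frag.Runs.mono ((s1.congr ?_ le_rfl).seq ((s2.congr ?_ le_rfl).seq
    ((s3.congr ?_ le_rfl).seq ((s4.congr ?_ le_rfl).seq ((s5.congr ?_ le_rfl).seq
      ((s6.congr ?_ le_rfl).seq ((s7.congr ?_ le_rfl).seq ((s8.congr ?_ le_rfl).seq
        (hrun.seq hk))))))))) ?_
  · simp [Regs.set, Regs.get, h1]
  · simp [h2, h4]
  · simp [Regs.set, Regs.get, h2]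
  · simp [Regs.set, Regs.get, h3, h4]
  · simp [h5]
  · simp [takeBits_add]
  · simp [Regs.set, Regs.get, h6]
  · simp [Regs.set, Regs.get, h7]
  · simp only [Regs.get, List.length_replicate, List.length_reverse]
    have hT : O.terms.length + 1 ≤ L + 1 := by omega
    have e1 : C * (L + κ + 1) ^ 2 * (O.terms.length + 1) ≤
        C * ((κ + 1) * (L + 1)) ^ 2 * (L + 1) := by
      gcongr
      nlinarith [Nat.zero_le (κ * L)]
    have e2 : C * ((κ + 1) * (L + 1)) ^ 2 * (L + 1) = C * (κ + 1) ^ 2 * (L + 1) ^ 3 := by ring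
    have e3 : L + 1 ≤ (L + 1) ^ 3 := Nat.le_self_pow (by norm_num) _
    have e4 : O.s + O.prec ≤ L := by omega
    have e5 : (100 + 8 * κ + 2 * phaseCode.length) * (L + 1) ≤
      (100 + 8 * κ + 2 * phaseCode.length) * (L + 1) ^ 3 := by gcongr
    rw [← hL]
    nlinarith [Nat.zero_le (κ * L), Nat.zero_le (phaseCode.length * L)]

end

end StackProgram

/-! ### Writing the whole test circuit -/

namespace StackProgram

open Turing Turing.TM2

section

variable {E : Type} {Γ : E → Type} {σ₀ : Type} [DecidableEq E]

/-- Writes the part of the circuit that belongs to a probe. -/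
def probeProg (κ : ℕ) : Frag E Γ σ₀ :=
  forUnary .inp (push .cnt true ;; push .cnt' true) ;;
  copyGates ;; fetchGates ;; opProg κ ;; copyGates ;; fetchInverses

theorem runs_readTime (n : ℕ) (rest : List Bool) : ∀ (ρ : Regs),
    ρ.inp = encUnary n ++ rest →
    (forUnary .inp (push .cnt true ;; push .cnt' true) : Frag E Γ σ₀).Runs ρ
      { ρ with inp := rest, cnt := List.replicate n true ++ ρ.cnt,
               cnt' := List.replicate n true ++ ρ.cnt' } (3 * n + 2) := by
  induction n with
  | zero =>
    exact fun ρ h => (runs_forUnary_false rest (by exact h)).congr (by simp [Regs.set])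
      (by simp)
  | succ n ih =>
    refine fun ρ h => (runs_forUnary_true (encUnary n ++ rest) (by exact h)
      ((runs_push _ _ _).seq (runs_push _ _ _)) (ih _ rfl)).congr ?_ (by omega)
    simp [Regs.set, Regs.get, List.replicate_succ']

/-- The register `out` is filled from the back: first the evolution, then the operator in front of
it, then the inverse evolution in front of both. Since later gates multiply from the left, the
resulting operator is `U O U†`. -/
theorem exists_runs_probeProg (κ : ℕ) : ∃ C : ℕ, ∀ {m : ℕ} (gates : List (Gate m)) (p : Probe m)
    (rest out width seed : List Bool) (B : ℕ), p.time ≤ gates.length →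
    (encProbe p).length ≤ B → (encList encGate (gates.map Gate.shift)).length ≤ B →
    (probeProg κ : Frag E Γ σ₀).Runs
      { inp := encProbe p ++ rest, out := out, width := width, seed := seed,
        gates := (encList encGate (gates.map Gate.shift)).reverse }
      { inp := rest, out := encItems encGate (probeGates κ gates p seed) ++ out, width := width,
        seed := seed.drop (p.op.prec + κ + 1),
        gates := (encList encGate (gates.map Gate.shift)).reverse } (C * (B + 1) ^ 3) := by
  obtain ⟨C, hC⟩ := exists_runs_opProg (E := E) (Γ := Γ) (σ₀ := σ₀) κ
  refine ⟨C + 100 + (gateCopy : Transducer E Γ σ₀ _ _).c + (gateInv : Transducer E Γ σ₀ _ _).c,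
    fun {m} gates p rest out width seed B ht hp hG => ?_⟩
  obtain ⟨G, hGd⟩ : ∃ G, G = encList encGate (gates.map Gate.shift) := ⟨_, rfl⟩
  rw [← hGd] at hG ⊢
  have s1 := runs_readTime (E := E) (Γ := Γ) (σ₀ := σ₀) p.time (encLocalOp p.op ++ rest)
    { inp := encProbe p ++ rest, out := out, width := width, seed := seed, gates := G.reverse }
    (by simp [encProbe])
  have s2 := runs_copyGates (E := E) (Γ := Γ) (σ₀ := σ₀)
    { inp := encLocalOp p.op ++ rest, out := out, width := width, seed := seed,
      gates := G.reverse, cnt := List.replicate p.time true,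
      cnt' := List.replicate p.time true } G rfl rfl rfl
  have s3 := runs_fetchGates (E := E) (Γ := Γ) (σ₀ := σ₀) (gates.map Gate.shift) p.time
    { inp := encLocalOp p.op ++ rest, out := out, width := width, seed := seed,
      gates := G.reverse, fwd := G, cnt := List.replicate p.time true,
      cnt' := List.replicate p.time true } (by simpa using ht) rfl hGd rfl
  have s4 := hC p.op rest
    { inp := encLocalOp p.op ++ rest,
      out := encItems encGate ((gates.map Gate.shift).take p.time) ++ out, width := width,
      seed := seed, gates := G.reverse, cnt' := List.replicate p.time true }
    rfl rfl rfl rfl rfl rfl rfl rfl rfl rfl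
  have s5 := runs_copyGates (E := E) (Γ := Γ) (σ₀ := σ₀)
    { inp := rest, out := encItems encGate (opGates κ p.op seed) ++
        (encItems encGate ((gates.map Gate.shift).take p.time) ++ out), width := width,
      seed := seed.drop (p.op.prec + κ + 1), gates := G.reverse,
      cnt' := List.replicate p.time true } G rfl rfl rfl
  have s6 := runs_fetchInverses (E := E) (Γ := Γ) (σ₀ := σ₀) (gates.map Gate.shift) p.time
    { inp := rest, out := encItems encGate (opGates κ p.op seed) ++
        (encItems encGate ((gates.map Gate.shift).take p.time) ++ out), width := width,
      seed := seed.drop (p.op.prec + κ + 1), gates := G.reverse, fwd := G,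
      cnt' := List.replicate p.time true } (by simpa using ht) rfl hGd rfl
  refine Frag.Runs.congr ((s1.congr ?_ le_rfl).seq (s2.seq (s3.seq (s4.seq (s5.seq s6))))) ?_ ?_
  · simp
  · have : (gates.map Gate.shift).take p.time = (gates.take p.time).map Gate.shift :=
      List.map_take.symm
    simp only [probeGates, this, List.map_map, encItems_append, List.append_assoc]
    rfl
  · have e1 : (encLocalOp p.op).length ≤ B ∧ p.time ≤ B := by
      simp only [encProbe, List.length_append, length_encUnary] at hp
      omega
    have e2 : C * ((encLocalOp p.op).length + 1) ^ 3 ≤ C * (B + 1) ^ 3 := by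
      gcongr
      exact e1.1
    have e3 : (B + 1) ≤ (B + 1) ^ 3 := Nat.le_self_pow (by norm_num) _
    rw [← hGd]
    generalize (gateCopy : Transducer E Γ σ₀ _ _).c = c₁
    generalize (gateInv : Transducer E Γ σ₀ _ _).c = c₂
    have e4 : (c₁ + 7) * (G.length + 1) ≤ (c₁ + 7) * (B + 1) ^ 3 := by
      gcongr; omega
    have e5 : (c₂ + 9) * (G.length + 1) ≤ (c₂ + 9) * (B + 1) ^ 3 := by
      gcongr; omega
    nlinarith

/-- The gates of the first probe end up last in the circuit and hence leftmost in the product of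
operators, so the probes can be processed in the order of the input. Of the rest of the seed only
the length is recorded, because it is erased later. -/
theorem exists_runs_probes (κ : ℕ) : ∃ C : ℕ, ∀ {m : ℕ} (gates : List (Gate m))
    (ps : List (Probe m)) (rest out width seed : List Bool) (B : ℕ),
    (∀ p ∈ ps, p.time ≤ gates.length) → (∀ p ∈ ps, (encProbe p).length ≤ B) →
    (encList encGate (gates.map Gate.shift)).length ≤ B →
    ∃ seed' : List Bool, seed'.length ≤ seed.length ∧
      (forUnary .inp (probeProg κ) : Frag E Γ σ₀).Runs
      { inp := encList encProbe ps ++ rest, out := out, width := width, seed := seed,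
        gates := (encList encGate (gates.map Gate.shift)).reverse }
      { inp := rest, out := encItems encGate (probesGates κ gates ps seed) ++ out,
        width := width, seed := seed',
        gates := (encList encGate (gates.map Gate.shift)).reverse }
      (C * (B + 1) ^ 3 * (ps.length + 1)) := by
  obtain ⟨C, hC⟩ := exists_runs_probeProg (E := E) (Γ := Γ) (σ₀ := σ₀) κ
  refine ⟨C + 2, fun {m} gates ps => ?_⟩
  induction ps with
  | nil =>
    intro rest out width seed B _ _ _
    refine ⟨seed, le_rfl, (runs_forUnary_false rest rfl).congr
      (by simp [Regs.set, probesGates]) ?_⟩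
    have : 1 ≤ (B + 1) ^ 3 := Nat.one_le_pow _ _ (by omega)
    simp
    nlinarith [Nat.zero_le (C * (B + 1) ^ 3)]
  | cons p ps ih =>
    intro rest out width seed B ht hp hG
    obtain ⟨seed', hs, h⟩ := ih rest (encItems encGate (probeGates κ gates p seed) ++ out) width
      (seed.drop (p.op.prec + κ + 1)) B (fun p hp => ht p (List.mem_cons_of_mem _ hp))
      (fun q hq => hp q (List.mem_cons_of_mem _ hq)) hG
    have h1 := hC gates p (encList encProbe ps ++ rest) out width seed B (ht p (by simp))
      (hp p (by simp)) hG
    refine ⟨seed', hs.trans (by simp), Frag.Runs.congr (runs_forUnary_true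
      (encProbe p ++ (encList encProbe ps ++ rest)) ?_ h1 h) ?_ ?_⟩
    · simp [Regs.get, encList]
    · simp [probesGates]
    · have : 1 ≤ (B + 1) ^ 3 := Nat.one_le_pow _ _ (by omega)
      simp only [List.length_cons]
      nlinarith

/-- The code of a Hadamard gate. -/
def hadamardCode : List Bool := encUnary 0 ++ (encUnary 1 ++ gateTail 2 hadamardCoef)

theorem encGate_hadamardGate (m : ℕ) : encGate (hadamardGate m) = hadamardCode := by
  simp [encGate, hadamardCode, hadamardGate, gateTail]

/-- Writes the circuit that estimates a correlation function. -/
def testProg (κ a : ℕ) : Frag E Γ σ₀ :=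
  Transducer.unary.prog .inp .width ;; gateShift.list.prog .inp .gates ;;
  copyAll .inp .tmp .seed ;; moveAll .tmp .inp ;;
  prepend .out (true :: hadamardCode ++ [false]) ;;
  forUnary .inp (probeProg κ) ;;
  prepend .out (true :: hadamardCode ++ encItems (fun _ => phaseCode) (List.replicate a ())) ;;
  moveAll .width .out ;; push .out true ;; clear .inp ;; clear .gates ;; clear .seed

theorem encList_map {α β : Type} (e : β → List Bool) (f : α → β) (l : List α) :
    encList e (l.map f) = encList (fun a => e (f a)) l := by
  simp [encList_eq, encItems_map]

/-- Shifting the two wires, written in unary, costs two bits for each gate, and the list marker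
already contributes one bit for each gate. -/
theorem length_encList_shift {m : ℕ} (l : List (Gate m)) :
    (encList encGate (l.map Gate.shift)).length ≤ 3 * (encList encGate l).length := by
  induction l with
  | nil => simp [encList]
  | cons g l ih =>
    have : (encGate g.shift).length = (encGate g).length + 2 := by
      simp [encGate, Gate.shift, length_encUnary]
      omega
    simp only [List.map_cons, encList, List.length_cons, List.length_append, this]
    omega

/-- Each probe takes time cubic in the input length `L` and there are at most `L` probes; this gives
the fourth power. No stacks besides the registers are needed, hence `E := Empty`. -/
theorem polyTime_circuit (A : Set ℕ) (l K κ a : ℕ) :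
    PolyTime (tocProblem A l K).encQuery encOneClean (TOCInstance.circuit κ a) := by
  obtain ⟨C, hC⟩ := exists_runs_probes (E := Empty) (Γ := Empty.elim) (σ₀ := Unit) κ
  obtain ⟨D, hD⟩ : ∃ D, D = (gateShift : Transducer Empty Empty.elim Unit _ _).list.c := ⟨_, rfl⟩
  refine polyTime_of_runsFrom (E := Empty) (Γ := Empty.elim) (σ₀ := Unit) (testProg κ a) ()
    (Polynomial.C (3 ^ 3 * C + D + 100 + 2 * hadamardCode.length +
      (encItems (fun _ => phaseCode) (List.replicate a ())).length) *
      (Polynomial.X + 1) ^ 4) fun y => ⟨(), ?_⟩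
  obtain ⟨x, k, r⟩ := y
  change Frag.RunsFrom _ _ _ { inp := encTOC x ++ (encUnary k ++ r) } _ _ _ _
  obtain ⟨L, hL⟩ : ∃ L, L = (encTOC x ++ (encUnary k ++ r)).length := ⟨_, rfl⟩
  obtain ⟨G, hG⟩ : ∃ G, G = encList encGate (x.gates.map Gate.shift) := ⟨_, rfl⟩
  obtain ⟨Q, hQ⟩ : ∃ Q, Q = encList encProbe x.probes ++ (encUnary k ++ r) := ⟨_, rfl⟩
  have hlen : L = (x.m + 1) + (encList encGate x.gates).length + Q.length := by
    rw [hL, hQ]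
    simp only [encTOC, List.length_append, length_encUnary]
    omega
  have hQlen : (encList encProbe x.probes).length ≤ Q.length := by rw [hQ]; simp
  have hprobes := length_le_encList encProbe x.probes
  have hGlen := length_encList_shift x.gates
  -- The factor `3` comes from `length_encList_shift`; the codes of the probes are parts of the
  -- input.
  obtain ⟨seed', hs, hrun⟩ := hC x.gates x.probes (encUnary k ++ r)
    (true :: hadamardCode ++ [false]) (encUnary x.m).reverse Q.reverse (3 * L) x.time_le
    (fun p hp => by have := hprobes.1 p hp; omega) (by omega)
  rw [← hG, ← hQ] at hrun
  have s1 := Transducer.unary.runs (E := Empty) (Γ := Empty.elim) (σ₀ := Unit) .inp .width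
    (by decide) x.m { inp := encTOC x ++ (encUnary k ++ r) }
    (encList encGate x.gates ++ Q) (by simp [Regs.get, encTOC, hQ])
  have s2 := (gateShift : Transducer Empty Empty.elim Unit _ _).list.runs .inp .gates
    (by decide) (x.gates.map rawGate)
    { inp := encList encGate x.gates ++ Q, width := (encUnary x.m).reverse } Q (by rw [encList_map]; rfl)
  rw [encList_map, encList_map] at s2
  have hG' : encList (fun g : Gate x.m => encRawGate ((rawGate g).1 + 1, (rawGate g).2.1 + 1,
      (rawGate g).2.2.1, (rawGate g).2.2.2.1, (rawGate g).2.2.2.2)) x.gates = G := by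
    rw [hG, encList_map]
    rfl
  rw [hG', ← hD] at s2
  -- All of the unread input is copied in reverse to serve as the seed. The random string stands at
  -- its end and so comes out on top, without any need to locate where it begins.
  have s3 := runs_copyAll (E := Empty) (Γ := Empty.elim) (σ₀ := Unit) (A := .inp) (B := .tmp)
    (C := .seed) (by decide) (by decide) (by decide)
    { inp := Q, width := (encUnary x.m).reverse, gates := G.reverse } Q rfl
  have s4 := runs_moveAll (E := Empty) (Γ := Empty.elim) (σ₀ := Unit) (A := .tmp) (B := .inp)
    (by decide)
    { tmp := Q.reverse, width := (encUnary x.m).reverse, gates := G.reverse, seed := Q.reverse }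
    _ rfl
  have s5 := runs_prepend (E := Empty) (Γ := Empty.elim) (σ₀ := Unit) .out
    (true :: hadamardCode ++ [false])
    { inp := Q, width := (encUnary x.m).reverse, gates := G.reverse, seed := Q.reverse }
  obtain ⟨out, hout⟩ : ∃ out, out = encItems encGate (probesGates κ x.gates x.probes Q.reverse) ++
    (true :: hadamardCode ++ [false]) := ⟨_, rfl⟩
  have s6 := runs_prepend (E := Empty) (Γ := Empty.elim) (σ₀ := Unit) .out
    (true :: hadamardCode ++ encItems (fun _ => phaseCode) (List.replicate a ()))
    { inp := encUnary k ++ r, out := out, width := (encUnary x.m).reverse, gates := G.reverse,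
      seed := seed' }
  obtain ⟨out', hout'⟩ : ∃ out', out' =
    true :: hadamardCode ++ encItems (fun _ => phaseCode) (List.replicate a ()) ++ out := ⟨_, rfl⟩
  have s7 := runs_moveAll (E := Empty) (Γ := Empty.elim) (σ₀ := Unit) (A := .width) (B := .out)
    (by decide)
    { inp := encUnary k ++ r, out := out', width := (encUnary x.m).reverse, gates := G.reverse,
      seed := seed' } _ rfl
  have s8 := runs_push (E := Empty) (Γ := Empty.elim) (σ₀ := Unit) .out true
    { inp := encUnary k ++ r, out := encUnary x.m ++ out', gates := G.reverse, seed := seed' }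
  have s9 := runs_clear (E := Empty) (Γ := Empty.elim) (σ₀ := Unit) .inp
    { inp := encUnary k ++ r, out := true :: (encUnary x.m ++ out'), gates := G.reverse,
      seed := seed' } _ rfl
  have s10 := runs_clear (E := Empty) (Γ := Empty.elim) (σ₀ := Unit) .gates
    { out := true :: (encUnary x.m ++ out'), gates := G.reverse, seed := seed' } _ rfl
  have s11 := runs_clear (E := Empty) (Γ := Empty.elim) (σ₀ := Unit) .seed
    { out := true :: (encUnary x.m ++ out'), seed := seed' } _ rfl
  have main := (s1.congr ?_ le_rfl).seq ((s2.congr ?_ le_rfl).seq ((s3.congr ?_ le_rfl).seq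
    ((s4.congr ?_ le_rfl).seq ((s5.congr ?_ le_rfl).seq ((hrun.congr ?_ le_rfl).seq
    ((s6.congr ?_ le_rfl).seq ((s7.congr ?_ le_rfl).seq (s8.seq (s9.seq (s10.seq
    (s11.congr (ρ'' := { out := encOneClean (TOCInstance.circuit κ a (x, k, r)) })
      ?_ le_rfl)))))))))))
  · refine (main () _).mono ?_
    change _ ≤ Polynomial.eval (encTOC x ++ (encUnary k ++ r)).length _
    rw [← hL]
    have e1 : C * (3 * L + 1) ^ 3 * (x.probes.length + 1) ≤
        C * (3 * (L + 1)) ^ 3 * (L + 1) := by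
      gcongr
      · omega
      · omega
    have e2 : C * (3 * (L + 1)) ^ 3 * (L + 1) = 3 ^ 3 * C * (L + 1) ^ 4 := by ring
    have e3 : L + 1 ≤ (L + 1) ^ 4 := Nat.le_self_pow (by norm_num) _
    have e4 : D * ((encList encGate x.gates).length + 1) ≤ D * (L + 1) ^ 4 := by
      gcongr
      omega
    have e5 : (encList (fun a => encRawGate (rawGate a)) x.gates).length =
      (encList encGate x.gates).length := rfl
    have e6 : G.length ≤ 3 * L := by rw [hG]; omega
    have e7 : (encUnary k ++ r).length ≤ Q.length := by rw [hQ]; simp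
    have e8 : Q.length ≤ L := by omega
    have e9 : seed'.length ≤ L := by simp only [List.length_reverse] at hs; omega
    simp only [Polynomial.eval_mul, Polynomial.eval_C, Polynomial.eval_pow, Polynomial.eval_add,
      Polynomial.eval_X, Polynomial.eval_one, Transducer.unary, length_encUnary, e5, Regs.get,
      List.length_reverse, List.length_cons, List.length_append, List.length_nil]
    simp only [List.length_append, length_encUnary] at e7
    generalize (encItems (fun _ => phaseCode) (List.replicate a ())).length = P
    generalize hadamardCode.length = H
    have e10 : (100 + 2 * H + P) * (L + 1) ≤ (100 + 2 * H + P) * (L + 1) ^ 4 := by gcongr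
    nlinarith [Nat.zero_le (H * L), Nat.zero_le (P * L)]
  · simp [Regs.set, Regs.get]
  · simp [Regs.set, Regs.get]
  · simp [Regs.set, Regs.get]
  · simp [Regs.set, Regs.get]
  · simp [Regs.set, Regs.get]
  · rw [hout]
  · simp [Regs.set, Regs.get, hout']
  · simp [Regs.set, Regs.get]
  · have : encItems (fun _ => phaseCode) (List.replicate a ()) =
        encItems encGate (List.replicate a (phaseGate x.m)) := by
      simp only [← encGate_phaseGate x.m]
      rw [← encItems_map, List.map_replicate]
    simp only [Regs.set, TOCInstance.circuit, testCircuit, encOneClean, encList_eq,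
      encItems_cons, encItems_append, encGate_hadamardGate, hout', hout, this]
    rw [hQ]
    simp [encUnary, encList_eq, List.replicate_succ]
end

end StackProgram

/-! ### Running a given machine inside a program -/

namespace StackProgram

open Turing Turing.TM2

section

variable {E : Type} {Γ : E → Type} {σ₀ : Type}

/-- A statement of a machine as a statement of a machine with registers. -/
def liftStmt {Λ L : Type} (emb : Λ → L) (exit : L) :
    Stmt Γ Λ σ₀ → Stmt (Alph Γ) L (σ₀ × Option Bool)
  | .push k f q => .push (.inl k) (fun v => f v.1) (liftStmt emb exit q)
  | .peek k f q => .peek (.inl k) (fun v s => (f v.1 s, v.2)) (liftStmt emb exit q)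
  | .pop k f q => .pop (.inl k) (fun v s => (f v.1 s, v.2)) (liftStmt emb exit q)
  | .load f q => .load (fun v => (f v.1, v.2)) (liftStmt emb exit q)
  | .branch p q q' => .branch (fun v => p v.1) (liftStmt emb exit q) (liftStmt emb exit q')
  | .goto f => .goto fun v => emb (f v.1)
  | .halt => .goto fun _ => exit

/-- A configuration of a machine as a configuration of a machine with registers. -/
def liftCfg {Λ L : Type} (emb : Λ → L) (exit : L) (o : Option Bool) (ρ : Regs)
    (c : Cfg Γ Λ σ₀) : Cfg (Alph Γ) L (σ₀ × Option Bool) :=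
  ⟨some (c.l.elim exit emb), (c.var, o), stackOf c.stk ρ⟩

variable [DecidableEq E]

theorem stepAux_liftStmt {Λ L : Type} (emb : Λ → L) (exit : L) (o : Option Bool) (ρ : Regs)
    (q : Stmt Γ Λ σ₀) (v : σ₀) (S : ∀ k, List (Γ k)) :
    stepAux (liftStmt emb exit q) (v, o) (stackOf S ρ) =
      liftCfg emb exit o ρ (stepAux q v S) := by
  induction q generalizing v S with
  | push k f q ih =>
    refine Eq.trans ?_ (ih v _)
    exact congrArg (stepAux _ _) (update_stacks_inl S ρ k _)
  | peek k f q ih => exact ih _ _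
  | pop k f q ih =>
    refine Eq.trans ?_ (ih _ _)
    exact congrArg (stepAux _ _) (update_stacks_inl S ρ k _)
  | load f q ih => exact ih _ _
  | branch p q q' ih ih' =>
    change cond (p v) _ _ = liftCfg emb exit o ρ (cond (p v) _ _)
    cases p v
    · exact ih' v S
    · exact ih v S
  | goto f => rfl
  | halt => rfl

theorem iterate_bind_none {α : Type} (f : α → Option α) (n : ℕ) :
    (flip bind f)^[n] (none : Option α) = none := by
  induction n with
  | zero => rfl
  | succ n ih => exact ih

/-- The embedded machine is followed step by step. Halting becomes a jump to the exit, so a halted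
configuration corresponds to one that stands at the exit label, and the number of steps is the same.
-/
theorem steps_liftCfg {Λ L : Type} {M : Λ → Stmt Γ Λ σ₀}
    {M' : L → Stmt (Alph Γ) L (σ₀ × Option Bool)} (emb : Λ → L) (exit : L)
    (hM : ∀ l, M' (emb l) = liftStmt emb exit (M l)) (o : Option Bool) (ρ : Regs) (n : ℕ)
    (c c' : Cfg Γ Λ σ₀) (h : Steps M n c c') :
    Steps M' n (liftCfg emb exit o ρ c) (liftCfg emb exit o ρ c') := by
  induction n generalizing c with
  | zero =>
    obtain rfl : c = c' := Option.some.inj h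
    exact Steps.zero _
  | succ n ih =>
    rcases c with ⟨_ | l, v, S⟩
    -- A halted configuration has no successor, so it cannot start a run of `n + 1` steps.
    · exact absurd ((iterate_bind_none _ n).symm.trans h) (by simp)
    · exact Steps.head (step_eq (hM l) (stepAux_liftStmt emb exit o ρ _ v S)) (ih _ h)

/-- The number of push instructions of a statement. -/
def pushes {Λ : Type} : Stmt Γ Λ σ₀ → ℕ
  | .push _ _ q => pushes q + 1
  | .peek _ _ q => pushes q
  | .pop _ _ q => pushes q
  | .load _ q => pushes q
  | .branch _ q q' => pushes q + pushes q'
  | .goto _ => 0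
  | .halt => 0

theorem length_stepAux_le {Λ : Type} (q : Stmt Γ Λ σ₀) (v : σ₀) (S : ∀ k, List (Γ k)) (k : E) :
    ((stepAux q v S).stk k).length ≤ (S k).length + pushes q := by
  induction q generalizing v S with
  | push k' f q ih =>
    refine (ih v _).trans ?_
    by_cases h : k = k'
    · subst h
      simp only [pushes, Function.update_self, List.length_cons]
      omega
    · simp [pushes, h]
  | peek k' f q ih => exact ih _ _
  | pop k' f q ih =>
    refine (ih _ _).trans ?_
    by_cases h : k = k'
    · subst h
      simp [pushes]
    · simp [pushes, h]
  | load f q ih => exact ih _ _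
  | branch p q q' ih ih' =>
    simp only [stepAux, pushes]
    cases p v
    · have := ih' v S
      simp only [cond_false]
      omega
    · have := ih v S
      simp only [cond_true]
      omega
  | goto f => simp [pushes]
  | halt => simp [pushes]

/-- One step executes one statement and can lengthen a stack by at most the number of push
instructions in it. The sum over all labels bounds this uniformly. -/
theorem length_le_of_steps {Λ : Type} [Fintype Λ] {M : Λ → Stmt Γ Λ σ₀} (k : E) (n : ℕ)
    (c c' : Cfg Γ Λ σ₀) (h : Steps M n c c') :
    (c'.stk k).length ≤ (c.stk k).length + (∑ l, pushes (M l)) * n := by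
  induction n generalizing c with
  | zero =>
    obtain rfl : c = c' := Option.some.inj h
    simp
  | succ n ih =>
    rcases c with ⟨_ | l, v, S⟩
    · exact absurd ((iterate_bind_none _ n).symm.trans h) (by simp)
    · have h1 := ih _ h
      have h2 := length_stepAux_le (M l) v S k
      have h3 : pushes (M l) ≤ ∑ l, pushes (M l) :=
        Finset.single_le_sum (f := fun l => pushes (M l)) (fun _ _ => Nat.zero_le _)
          (Finset.mem_univ l)
      rw [Nat.mul_succ]
      change (c'.stk k).length ≤ (S k).length + _
      omega

theorem stepAux_branch_of_true {K : Type} [DecidableEq K] {Δ : K → Type} {L σ : Type}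
    (p : σ → Bool) (q q' : Stmt Δ L σ) (v : σ) (S : ∀ k, List (Δ k)) (h : p v = true) :
    stepAux (.branch p q q') v S = stepAux q v S := by
  rw [stepAux, h, cond_true]

theorem stepAux_push_inl {L : Type} (k : E) (f : σ₀ × Option Bool → Γ k)
    (q : Stmt (Alph Γ) L (σ₀ × Option Bool)) (v : σ₀ × Option Bool) (e : ∀ k, List (Γ k))
    (ρ : Regs) :
    stepAux (.push (Sum.inl k) f q) v (stackOf e ρ) =
      stepAux q v (stackOf (Function.update e k (f v :: e k)) ρ) :=
  congrArg (stepAux q v) (update_stacks_inl e ρ k _)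

theorem stepAux_push_inr {L : Type} (r : Reg) (f : σ₀ × Option Bool → Bool)
    (q : Stmt (Alph Γ) L (σ₀ × Option Bool)) (v : σ₀ × Option Bool) (e : ∀ k, List (Γ k))
    (ρ : Regs) :
    stepAux (.push (Sum.inr r) f q) v (stackOf e ρ) =
      stepAux q v (stackOf e (ρ.set r (f v :: ρ.get r))) :=
  congrArg (stepAux q v) (update_stacks_inr e ρ r _)

/-- Moves the bits of a register, translated, to a further stack, and keeps a copy. -/
def feed (A B : Reg) (k : E) (f : Bool → Γ k) : Frag E Γ σ₀ where
  Lab := Unit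
  fin := inferInstance
  entry := ()
  code emb exit _ := .pop (.inr A) (fun v b => (v.1, b)) (.branch (fun v => v.2.isSome)
    (.push (.inl k) (fun v => f (v.2.getD false)) (.push (.inr B) (fun v => v.2.getD false)
      (.goto fun _ => emb ())))
    (.goto fun _ => exit))

theorem runs_feed {A B : Reg} (hAB : A ≠ B) (k : E) (f : Bool → Γ k) (v : σ₀)
    (e : ∀ k, List (Γ k)) (ρ : Regs) (l : List Bool) (hl : ρ.get A = l) :
    (feed A B k f).RunsFrom v e ρ v (Function.update e k ((l.map f).reverse ++ e k))
      ((ρ.set A []).set B (l.reverse ++ ρ.get B)) (l.length + 1) := by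
  intro L M emb exit hM o
  induction l generalizing ρ e o with
  | nil =>
    refine ⟨none, 1, by simp, Steps.one ?_⟩
    have h := update_stacks_inr e ρ A []
    refine step_eq_of_pop [] (hM ()) hl ?_
    refine (congrArg (Cfg.mk _ _) h).trans ?_
    have : ρ.set A [] = ρ := by rw [← hl, ρ.set_get]
    simp [this]
  | cons b l ih =>
    obtain ⟨o', n, hn, hs⟩ := ih (Function.update e k (f b :: e k))
      ((ρ.set A l).set B (b :: ρ.get B)) (by simp [hAB]) (some b)
    rw [Regs.set_set_set_set _ hAB, Function.update_idem, Function.update_self,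
      Regs.get_set_self] at hs
    refine ⟨o', n + 1, by simpa using hn, Steps.head (step_eq_of_pop (Δ := Alph Γ)
      (k := Sum.inr A) (b :: l : List Bool) (hM ()) hl ((congrArg (stepAux _ _)
      (update_stacks_inr e ρ A l)).trans ((stepAux_branch_of_true _ _ _ _ _ rfl).trans
      ((stepAux_push_inl _ _ _ _ _ _).trans
      (stepAux_push_inr _ _ _ _ _ _))))) ?_⟩
    simpa [hAB.symm, feed] using hs

/-- Moves the bits of a further stack, translated, to a register. -/
def drain (k : E) (A : Reg) (f : Γ k → Bool) : Frag E Γ σ₀ where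
  Lab := Unit
  fin := inferInstance
  entry := ()
  code emb exit _ := .pop (.inl k) (fun v b => (v.1, b.map f)) (.branch (fun v => v.2.isSome)
    (.push (.inr A) (fun v => v.2.getD false) (.goto fun _ => emb ()))
    (.goto fun _ => exit))

theorem runs_drain (k : E) (A : Reg) (f : Γ k → Bool) (v : σ₀)
    (e : ∀ k, List (Γ k)) (ρ : Regs) (l : List (Γ k)) (hl : e k = l) :
    (drain k A f).RunsFrom v e ρ v (Function.update e k [])
      (ρ.set A ((l.map f).reverse ++ ρ.get A)) (l.length + 1) := by
  intro L M emb exit hM o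
  induction l generalizing ρ e o with
  | nil =>
    refine ⟨none, 1, by simp, Steps.one ?_⟩
    refine step_eq_of_pop (Δ := Alph Γ) (k := Sum.inl k) ([] : List (Γ k)) (hM ()) hl ?_
    refine (congrArg (Cfg.mk _ _) (update_stacks_inl e ρ k [])).trans ?_
    simp
  | cons b l ih =>
    obtain ⟨o', n, hn, hs⟩ := ih (Function.update e k l) (ρ.set A (f b :: ρ.get A)) (by simp)
      (some (f b))
    rw [Function.update_idem, Regs.set_set, Regs.get_set_self] at hs
    refine ⟨o', n + 1, by simpa using hn, Steps.head (step_eq_of_pop (Δ := Alph Γ)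
      (k := Sum.inl k) (b :: l : List (Γ k)) (hM ()) hl ((congrArg (stepAux _ _)
      (update_stacks_inl e ρ k l)).trans ((stepAux_branch_of_true _ _ _ _ _ rfl).trans
      (stepAux_push_inr _ _ _ _ _ _)))) ?_⟩
    simpa [drain] using hs

/-- A machine as a program fragment. -/
def Frag.ofMachine (tm : FinTM2) : Frag tm.K tm.Γ tm.σ where
  Lab := tm.Λ
  fin := tm.ΛFin
  entry := tm.main
  code emb exit l := liftStmt emb exit (tm.m l)

theorem initList_eq (tm : FinTM2) (s : List (tm.Γ tm.k₀)) :
    initList tm s = ⟨some tm.main, tm.initialState,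
      Function.update (fun _ => []) tm.k₀ s⟩ := by
  refine congrArg (Cfg.mk _ _) (funext fun k => ?_)
  by_cases h : k = tm.k₀
  · subst h
    simp
  · simp [h]

theorem haltList_eq (tm : FinTM2) (s : List (tm.Γ tm.k₁)) :
    haltList tm s = ⟨none, tm.initialState, Function.update (fun _ => []) tm.k₁ s⟩ := by
  refine congrArg (Cfg.mk _ _) (funext fun k => ?_)
  by_cases h : k = tm.k₁
  · subst h
    simp
  · simp [h]

/-- Runs a machine on the bits of the register `inp`; the result is written to the register
`gates`, and the input is kept in the register `rev`. -/
def callMachine (tm : FinTM2) (f : Bool → tm.Γ tm.k₀) (g : tm.Γ tm.k₁ → Bool) :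
    Frag tm.K tm.Γ tm.σ :=
  moveAll .inp .tmp ;; feed .tmp .rev tm.k₀ f ;; Frag.ofMachine tm ;; drain tm.k₁ .tmp g ;;
    moveAll .tmp .gates

/-- Every transfer between stacks reverses a word, so input and output are each moved twice. A
machine that halts properly is back in its initial state with only the output stack filled; draining
that stack leaves all further stacks empty. The copy of the input in `rev` is kept for counting its
bits later. -/
theorem runs_callMachine (tm : FinTM2) (f : Bool ≃ tm.Γ tm.k₀) (g : tm.Γ tm.k₁ ≃ Bool)
    (x y : List Bool) (n t : ℕ) (hn : n ≤ t)
    (h : Steps tm.m n (initList tm (x.map f)) (haltList tm (y.map g.symm))) :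
    (callMachine tm f g).RunsFrom tm.initialState (fun _ => []) { inp := x } tm.initialState
      (fun _ => []) { rev := x, gates := y } (3 * x.length + 3 * y.length + t + 4) := by
  rw [initList_eq, haltList_eq] at h
  have s1 := runs_moveAll (E := tm.K) (Γ := tm.Γ) (σ₀ := tm.σ) (A := .inp) (B := .tmp)
    (by decide) { inp := x } x rfl tm.initialState (fun _ => [])
  have s2 := runs_feed (A := .tmp) (B := .rev) (by decide) tm.k₀ f tm.initialState (fun _ => [])
    { tmp := x.reverse } x.reverse rfl
  have s3 : (Frag.ofMachine tm).RunsFrom tm.initialState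
      (Function.update (fun _ => []) tm.k₀ (x.map f)) { rev := x } tm.initialState
      (Function.update (fun _ => []) tm.k₁ (y.map g.symm)) { rev := x } t := by
    intro L M emb exit hM o
    exact ⟨o, n, hn, steps_liftCfg emb exit hM o { rev := x } n _ _ h⟩
  have s4 := runs_drain tm.k₁ .tmp g tm.initialState
    (Function.update (fun _ => []) tm.k₁ (y.map g.symm)) { rev := x } (y.map g.symm) (by simp)
  have s5 := runs_moveAll (E := tm.K) (Γ := tm.Γ) (σ₀ := tm.σ) (A := .tmp) (B := .gates)
    (by decide) { rev := x, tmp := y.reverse } y.reverse rfl tm.initialState (fun _ => [])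
  simp only [Regs.set, Regs.get, List.append_nil, List.map_reverse, List.reverse_reverse,
    Function.update_idem, List.map_map, Equiv.self_comp_symm, List.map_id,
    Function.update_eq_self] at s1 s2 s4 s5
  refine (s1.seq (s2.seq (s3.seq (s4.seq s5)))).mono ?_
  simp only [List.length_reverse, List.length_map]
  omega

/-- At the start, the output stack is either empty or identical with the input stack; the rest of
its length must have been pushed during the run. -/
theorem exists_length_le (tm : FinTM2) : ∃ D : ℕ, ∀ (s : List (tm.Γ tm.k₀))
    (s' : List (tm.Γ tm.k₁)) (n : ℕ), Steps tm.m n (initList tm s) (haltList tm s') →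
      s'.length ≤ s.length + D * n := by
  let := tm.ΛFin
  refine ⟨∑ l, pushes (tm.m l), fun s s' n h => ?_⟩
  rw [initList_eq, haltList_eq] at h
  have := length_le_of_steps tm.k₁ n _ _ h
  simp only [Function.update_self] at this
  refine this.trans (Nat.add_le_add_right ?_ _)
  by_cases hk : tm.k₁ = tm.k₀
  · rw [hk]
    simp
  · simp [hk]

end

end StackProgram

/-! ### Correlation functions that decide a promise problem -/

/-- The length of the value of a polynomial-time function is polynomially bounded. -/
theorem PolyTime.exists_length_le {α β : Type} {ea : α → List Bool} {eb : β → List Bool}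
    {f : α → β} (h : PolyTime ea eb f) :
    ∃ Q : Polynomial ℕ, ∀ a, (eb (f a)).length ≤ Q.eval (ea a).length := by
  obtain ⟨h⟩ := h
  obtain ⟨D, hD⟩ := StackProgram.exists_length_le h.tm
  refine ⟨Polynomial.X + Polynomial.C D * h.time, fun a => ?_⟩
  have h1 := hD _ _ (h.outputsFun a).steps (h.outputsFun a).evals_in_steps
  have h2 := Nat.mul_le_mul_left D (h.outputsFun a).steps_le_m
  simp only [List.length_map] at h1
  simp only [Polynomial.eval_add, Polynomial.eval_mul, Polynomial.eval_C, Polynomial.eval_X]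
  omega

/-- The same gate in a circuit with more wires. -/
def Gate.castLE {n n' : ℕ} (h : n ≤ n') (g : Gate n) : Gate n' where
  fst := g.fst.castLE h
  snd := g.snd.castLE h
  fst_ne_snd := by simpa using g.fst_ne_snd
  den := g.den
  coef := g.coef
  isUnitary := g.isUnitary
  inverse := g.inverse

theorem encGate_castLE {n n' : ℕ} (h : n ≤ n') (g : Gate n) :
    encGate (g.castLE h) = encGate g := rfl

/-- The identity, as a probe at time `0`. -/
def idProbe (m : ℕ) : Probe m where
  time := 0
  op := { s := 0, wires := Function.Embedding.ofIsEmpty, prec := 0, terms := [⟨1, 0, fun _ => .I⟩] }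

/-- The Pauli matrix `Z` on the first wire, as a probe. -/
def zProbe (m t : ℕ) : Probe (m + 1) where
  time := t
  op :=
    { s := 1
      wires := ⟨fun _ => 0, fun _ _ _ => Subsingleton.elim _ _⟩
      prec := 0
      terms := [⟨1, 0, fun _ => .Z⟩] }

/-- The correlation function of `Z` at time `0` and after the circuit `C`, on `p + 1` further
qubits. -/
def OneClean.toTOC {A : Set ℕ} {l K N : ℕ} (hN : N + 2 ∈ A) (hl : 1 ≤ l) (hK : 1 ≤ K)
    (C : OneClean) (p : ℕ) : TOCInstance A l K where
  m := C.n + p + 1 + 1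
  gates := C.gates.map (Gate.castLE (by omega)) ++
    List.replicate (encOneClean C).length (idGate (C.n + p))
  probes := List.replicate N (idProbe _) ++ [zProbe _ 0, zProbe _ (encOneClean C).length]
  number_mem := by simpa using hN
  time_ordered := by
    rw [List.pairwise_append]
    refine ⟨List.pairwise_replicate.2 (Or.inr le_rfl), by simp [zProbe], ?_⟩
    intro a ha b hb
    rw [List.eq_of_mem_replicate ha]
    exact Nat.zero_le _
  time_le := by
    intro p hp
    simp only [List.mem_append, List.mem_cons, List.not_mem_nil, or_false] at hp
    rcases hp with hp | rfl | rfl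
    · rw [List.eq_of_mem_replicate hp]
      exact Nat.zero_le _
    · exact Nat.zero_le _
    · simp [zProbe]
  isLocal := by
    intro p hp
    simp only [List.mem_append, List.mem_cons, List.not_mem_nil, or_false] at hp
    rcases hp with hp | rfl | rfl
    · rw [List.eq_of_mem_replicate hp]
      exact Nat.zero_le _
    · exact hl
    · exact hl
  bounded := by
    intro p hp
    have h1 : (1 : ℝ) ≤ K := by exact_mod_cast hK
    simp only [List.mem_append, List.mem_cons, List.not_mem_nil, or_false] at hp
    rcases hp with hp | rfl | rfl
    · rw [List.eq_of_mem_replicate hp]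
      simpa [LocalOp.pauliNorm, idProbe] using h1
    · simpa [LocalOp.pauliNorm, zProbe] using h1
    · simpa [LocalOp.pauliNorm, zProbe] using h1

/-! ### Writing the instance that encodes a computation -/

namespace StackProgram

open Turing Turing.TM2

/-- The code of an identity gate on the first two wires. -/
def idGateCode : List Bool := encUnary 0 ++ (encUnary 1 ++ gateTail 1 oneCoef)

theorem encGate_idGate (m : ℕ) : encGate (idGate m) = idGateCode := by
  simp [encGate, idGateCode, idGate, gateTail]

/-- The code of the identity as a probe. -/
def idProbeCode : List Bool := encProbe (idProbe 0)

theorem encProbe_idProbe (m : ℕ) : encProbe (idProbe m) = idProbeCode := rfl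

/-- The code of `Z` on the first wire. -/
def zCode : List Bool := encLocalOp (zProbe 0 0).op

theorem encProbe_zProbe (m t : ℕ) : encProbe (zProbe m t) = encUnary t ++ zCode := rfl

section

variable {E : Type} {Γ : E → Type} {σ₀ : Type} [DecidableEq E]

/-- Moves the bits of a register and writes a word to `out` for each of them. -/
def countAll (A B : Reg) (w : List Bool) : Frag E Γ σ₀ :=
  loop A (fun _ => true) fun b => push B b ;; prepend .out w

theorem runs_countAll {A B : Reg} (h : A ≠ B) (hA : A ≠ .out) (hB : B ≠ .out) (w : List Bool)
    (ρ : Regs) (l : List Bool) (hl : ρ.get A = l) :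
    (countAll A B w : Frag E Γ σ₀).Runs ρ
      (((ρ.set A []).set B (l.reverse ++ ρ.get B)).set .out
        ((List.replicate l.length w).flatten ++ ρ.get .out)) ((w.length + 3) * l.length + 1) := by
  induction l generalizing ρ with
  | nil =>
    refine (runs_loop_nil A _ _ hl).congr ?_ (by simp)
    have : ρ.set A [] = ρ := by rw [← hl, ρ.set_get]
    simp [this]
  | cons b l ih =>
    refine (runs_loop_again A _ _ b l hl rfl ((runs_push B b _).seq (runs_prepend .out w _))
      (ih _ ?_)).congr ?_ ?_
    · simp [h, hA]
    · rw [Regs.set_comm _ hA.symm, Regs.set_comm _ hB.symm, Regs.set_set, Regs.set_set_set_set _ h]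
      simp [h.symm, hA.symm, hB, hB.symm, List.replicate_succ']
    · simp only [List.length_cons]
      ring_nf
      omega

/-- The program that writes the code of the correlation function that belongs to a one-clean-qubit
computation. -/
def instanceProg (N : ℕ) : Frag E Γ σ₀ :=
  prepend .out (false :: (zCode ++ [false])) ;;
  countAll .gates .tmp [true] ;;
  prepend .out (false :: ((List.replicate N (true :: idProbeCode)).flatten ++
    true :: (encUnary 0 ++ zCode ++ [true]))) ;;
  countAll .tmp .gates (true :: idGateCode) ;;
  Transducer.unary.prog .gates .width ;;
  moveAll .gates .tmp ;;
  branch .tmp (fun _ => moveAll .tmp .out) ;;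
  moveAll .width .out ;;
  countAll .rev .tmp [true] ;;
  clear .tmp ;;
  prepend .out [true, true]

theorem encItems_replicate {α : Type} (e : α → List Bool) (n : ℕ) (a : α) :
    encItems e (List.replicate n a) = (List.replicate n (true :: e a)).flatten := by
  simp [encItems, List.flatMap_replicate]

theorem encUnary_add (a b : ℕ) : encUnary (a + b) = List.replicate a true ++ encUnary b := by
  rw [encUnary, List.replicate_add, List.append_assoc, ← encUnary]

/-- The second `Z` is inserted at a time equal to the length of the code of `C`, not to the number
of its gates: bits can be counted by moving a stack, without parsing gates. As many identity gates
as bits are appended, so that this time is admissible and nothing changes after the gates of `C`. -/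
theorem exists_runs_instanceProg {A : Set ℕ} {l K N : ℕ} (hN : N + 2 ∈ A) (hl : 1 ≤ l)
    (hK : 1 ≤ K) : ∃ D : ℕ, ∀ (C : OneClean) (x : List Bool),
      (instanceProg N : Frag E Γ σ₀).Runs { rev := x, gates := encOneClean C }
        { out := encTOC (OneClean.toTOC hN hl hK C x.length) }
        (D * ((encOneClean C).length + x.length + 1)) := by
  refine ⟨zCode.length + (List.replicate N (true :: idProbeCode)).flatten.length + zCode.length +
    idGateCode.length + 100, fun C x => ?_⟩
  obtain ⟨n, gates⟩ := C
  obtain ⟨c, hc⟩ : ∃ c, c = encOneClean ⟨n, gates⟩ := ⟨_, rfl⟩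
  obtain ⟨I, hI⟩ : ∃ I, I = encItems encGate gates := ⟨_, rfl⟩
  obtain ⟨o₁, ho₁⟩ : ∃ o, o = List.replicate c.length true ++ false :: (zCode ++ [false]) :=
    ⟨_, rfl⟩
  obtain ⟨w, hw⟩ : ∃ w, w = false :: ((List.replicate N (true :: idProbeCode)).flatten ++
    true :: (encUnary 0 ++ zCode ++ [true])) := ⟨_, rfl⟩
  obtain ⟨o₂, ho₂⟩ : ∃ o, o = (List.replicate c.length (true :: idGateCode)).flatten ++
    (w ++ o₁) := ⟨_, rfl⟩
  have hcI : c = encUnary n ++ (I ++ [false]) := by rw [hc, hI, encOneClean, encList_eq]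
  have s1 := runs_prepend (E := E) (Γ := Γ) (σ₀ := σ₀) .out (false :: (zCode ++ [false]))
    { rev := x, gates := c }
  have s2 := runs_countAll (E := E) (Γ := Γ) (σ₀ := σ₀) (A := .gates) (B := .tmp) (by decide)
    (by decide) (by decide) [true] { rev := x, gates := c, out := false :: (zCode ++ [false]) } c rfl
  have s3 := runs_prepend (E := E) (Γ := Γ) (σ₀ := σ₀) .out w
    { rev := x, tmp := c.reverse, out := o₁ }
  have s4 := runs_countAll (E := E) (Γ := Γ) (σ₀ := σ₀) (A := .tmp) (B := .gates) (by decide)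
    (by decide) (by decide) (true :: idGateCode)
    { rev := x, tmp := c.reverse, out := w ++ o₁ } c.reverse rfl
  have s5 := Transducer.unary.runs (E := E) (Γ := Γ) (σ₀ := σ₀) .gates .width (by decide) n
    { rev := x, gates := c, out := o₂ } (I ++ [false]) hcI
  have s6 := runs_moveAll (E := E) (Γ := Γ) (σ₀ := σ₀) (A := .gates) (B := .tmp) (by decide)
    { rev := x, gates := I ++ [false], width := (encUnary n).reverse, out := o₂ } _ rfl
  -- The popped bit is the end marker of the original gate list, which has to go because the
  -- identity gates continue the list.
  have s7 := runs_branch_cons (E := E) (Γ := Γ) (σ₀ := σ₀) .tmp (fun _ => moveAll .tmp .out)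
    (ρ := { rev := x, tmp := false :: I.reverse, width := (encUnary n).reverse, out := o₂ })
    false I.reverse rfl (runs_moveAll (by decide) _ I.reverse rfl)
  have s8 := runs_moveAll (E := E) (Γ := Γ) (σ₀ := σ₀) (A := .width) (B := .out) (by decide)
    { rev := x, width := (encUnary n).reverse, out := I ++ o₂ } _ rfl
  have s9 := runs_countAll (E := E) (Γ := Γ) (σ₀ := σ₀) (A := .rev) (B := .tmp) (by decide)
    (by decide) (by decide) [true] { rev := x, out := encUnary n ++ (I ++ o₂) } x rfl
  have s10 := runs_clear (E := E) (Γ := Γ) (σ₀ := σ₀) .tmp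
    { tmp := x.reverse, out := List.replicate x.length true ++ (encUnary n ++ (I ++ o₂)) } _ rfl
  have s11 := runs_prepend (E := E) (Γ := Γ) (σ₀ := σ₀) .out [true, true]
    { out := List.replicate x.length true ++ (encUnary n ++ (I ++ o₂)) }
  have main := (s1.congr ?_ le_rfl).seq ((s2.congr ?_ le_rfl).seq ((s3.congr ?_ le_rfl).seq
    ((s4.congr ?_ le_rfl).seq ((s5.congr ?_ le_rfl).seq ((s6.congr ?_ le_rfl).seq
    ((s7.congr ?_ le_rfl).seq ((s8.congr ?_ le_rfl).seq ((s9.congr ?_ le_rfl).seq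
    ((s10.congr ?_ le_rfl).seq s11)))))))))
  · rw [← hc]
    rw [hw] at main
    refine main.congr ?_ ?_
    · simp only [Regs.set, Regs.get, OneClean.toTOC, encTOC, encList_eq, encItems_append,
        encItems_map, encItems_replicate, encItems_cons, encItems_nil, encGate_castLE,
        encProbe_zProbe, encProbe_idProbe, encGate_idGate, ← hc, ← hI, ho₂, ho₁, hw]
      -- The summands are put in the order in which the unary code of the number of qubits is
      -- assembled: two marks in front, one for each bit of `x`, then the code of `n`.
      have : n + x.length + 1 + 1 = 2 + x.length + n := by omega
      rw [this, encUnary_add, List.replicate_add]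
      simp [encUnary]
    · have hcl : c.length = n + I.length + 2 := by
        rw [hcI]
        simp [length_encUnary]
        omega
      simp only [Transducer.unary, length_encUnary, Regs.get, List.length_reverse, List.length_cons,
        List.length_append, List.length_nil]
      generalize (List.replicate N (true :: idProbeCode)).flatten.length = P
      generalize zCode.length = Z
      generalize idGateCode.length = G
      generalize c.length = L at *
      nlinarith [Nat.zero_le (P * L), Nat.zero_le (P * x.length), Nat.zero_le (Z * L),
        Nat.zero_le (Z * x.length), Nat.zero_le (G * x.length)]
  all_goals simp [Regs.set, Regs.get, ho₁, ho₂]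

end

/-- The correlation function that belongs to a one-clean-qubit computation is computable in
polynomial time. -/
theorem polyTime_instance {A : Set ℕ} {l K N : ℕ} (hN : N + 2 ∈ A) (hl : 1 ≤ l) (hK : 1 ≤ K)
    {C : List Bool → OneClean} (hC : PolyTime (fun x => x) encOneClean C) :
    PolyTime (fun x => x) encTOC
      (fun x => OneClean.toTOC hN hl hK (C x) x.length) := by
  obtain ⟨Q, hQ⟩ := hC.exists_length_le
  obtain ⟨h⟩ := hC
  obtain ⟨D, hD⟩ := exists_runs_instanceProg (E := h.tm.K) (Γ := h.tm.Γ) (σ₀ := h.tm.σ) hN hl hK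
  let _ := h.tm.kFin
  let _ := h.tm.σFin
  refine polyTime_of_runsFrom (callMachine h.tm h.inputAlphabet.symm h.outputAlphabet ;;
    instanceProg N) h.tm.initialState (Polynomial.C 3 * Polynomial.X + Polynomial.C 3 * Q + h.time +
      Polynomial.C 4 + Polynomial.C D * (Q + Polynomial.X + 1)) fun x => ⟨h.tm.initialState, ?_⟩
  have s1 := runs_callMachine h.tm h.inputAlphabet.symm h.outputAlphabet x (encOneClean (C x))
    _ _ (h.outputsFun x).steps_le_m (h.outputsFun x).evals_in_steps
  refine (s1.seq (hD (C x) x _ _)).mono ?_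
  have h1 := hQ x
  have h2 : D * ((encOneClean (C x)).length + x.length + 1) ≤ D * (Q.eval x.length + x.length + 1) := by
    gcongr
  simp only [Polynomial.eval_add, Polynomial.eval_mul, Polynomial.eval_C, Polynomial.eval_X,
    Polynomial.eval_one]
  omega

end StackProgram

/-! ### Operators on some of the qubits -/

section lift

variable {α β γ : Type} [Fintype α] [Fintype β] [Fintype γ]

/-- An operator on the qubits `α` as an operator on the qubits `β`. -/
noncomputable def liftOp (ι : α ↪ β) (A : Matrix (α → Fin 2) (α → Fin 2) ℂ) :
    Matrix (β → Fin 2) (β → Fin 2) ℂ :=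
  Matrix.of fun x y =>
    open Classical in
    if ∀ w, w ∉ Set.range ι → x w = y w then A (x ∘ ι) (y ∘ ι) else 0

open Classical in
/-- The splitting of a bit string into the bits with indices in the range of an embedding and the
others. -/
noncomputable def splitEquiv (ι : α ↪ β) :
    (β → Fin 2) ≃ (α → Fin 2) × ({w // w ∉ Set.range ι} → Fin 2) :=
  (Equiv.piEquivPiSubtypeProd (· ∈ Set.range ι) fun _ => Fin 2).trans
    (Equiv.prodCongr (Equiv.arrowCongr (Equiv.ofInjective ι ι.injective).symm (Equiv.refl _))
      (Equiv.refl _))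

-- After the bits are split into those in the range and the others, lifting is a Kronecker product
-- with the identity. Multiplicativity, adjoints and traces of lifted operators are then those of
-- Kronecker products.
open Classical in
theorem liftOp_eq [DecidableEq β] (ι : α ↪ β) (A : Matrix (α → Fin 2) (α → Fin 2) ℂ) :
    liftOp ι A = (Matrix.kroneckerMap (fun a b => a * b) A 1).submatrix (splitEquiv ι) (splitEquiv ι) := by
  ext x y
  have h1 : ∀ x, (splitEquiv ι x).1 = x ∘ ι := fun x => rfl
  have h2 : ∀ x, (splitEquiv ι x).2 = fun w => x w.1 := fun x => rfl
  simp only [liftOp, Matrix.of_apply, Matrix.submatrix_apply, Matrix.kroneckerMap_apply, h1, h2,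
    Matrix.one_apply, funext_iff, Subtype.forall]
  split <;> simp

theorem liftOp_mul [DecidableEq α] [DecidableEq β] (ι : α ↪ β) (A B : Matrix (α → Fin 2) (α → Fin 2) ℂ) :
    liftOp ι (A * B) = liftOp ι A * liftOp ι B := by
  classical
  rw [liftOp_eq, liftOp_eq, liftOp_eq, Matrix.submatrix_mul_equiv, ← Matrix.mul_kronecker_mul,
    Matrix.one_mul]

theorem liftOp_one [DecidableEq α] [DecidableEq β] (ι : α ↪ β) : liftOp ι 1 = 1 := by
  classical
  rw [liftOp_eq, Matrix.one_kronecker_one, Matrix.submatrix_one_equiv]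

theorem liftOp_sub (ι : α ↪ β) (A B : Matrix (α → Fin 2) (α → Fin 2) ℂ) :
    liftOp ι (A - B) = liftOp ι A - liftOp ι B := by
  ext x y
  simp only [liftOp, Matrix.of_apply, Matrix.sub_apply]
  split <;> simp

theorem liftOp_smul (ι : α ↪ β) (c : ℂ) (A : Matrix (α → Fin 2) (α → Fin 2) ℂ) :
    liftOp ι (c • A) = c • liftOp ι A := by
  ext x y
  simp only [liftOp, Matrix.of_apply, Matrix.smul_apply]
  split <;> simp

theorem liftOp_conjTranspose (ι : α ↪ β) (A : Matrix (α → Fin 2) (α → Fin 2) ℂ) :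
    liftOp ι Aᴴ = (liftOp ι A)ᴴ := by
  classical
  rw [liftOp_eq, liftOp_eq, Matrix.conjTranspose_submatrix, Matrix.conjTranspose_kronecker,
    Matrix.conjTranspose_one]

/-- Each added qubit doubles the trace and also the dimension, so the normalized trace does not
notice idle qubits. -/
theorem trace_liftOp [DecidableEq α] [DecidableEq β] (ι : α ↪ β) (A : Matrix (α → Fin 2) (α → Fin 2) ℂ) :
    (liftOp ι A).trace / 2 ^ Fintype.card β = A.trace / 2 ^ Fintype.card α := by
  classical
  have h : (liftOp ι A).trace = A.trace * 2 ^ Fintype.card {w // w ∉ Set.range ι} := by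
    rw [liftOp_eq]
    refine (Equiv.sum_comp (splitEquiv ι) fun i =>
      (Matrix.kroneckerMap (fun a b => a * b) A 1) i i).trans ?_
    change (Matrix.kroneckerMap (fun a b => a * b) A 1).trace = _
    rw [Matrix.trace_kronecker, Matrix.trace_one]
    simp
  have hc : Fintype.card β = Fintype.card α + Fintype.card {w // w ∉ Set.range ι} := by
    have := Fintype.card_congr (splitEquiv ι)
    rw [Fintype.card_prod] at this
    simp only [Fintype.card_pi, Finset.prod_const, Fintype.card_fin, Finset.card_univ] at this
    rw [← pow_add] at this
    exact Nat.pow_right_injective le_rfl this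
  rw [h, hc, pow_add]
  field_simp

theorem liftOp_liftOp (ι : α ↪ β) (κ : β ↪ γ) (A : Matrix (α → Fin 2) (α → Fin 2) ℂ) :
    liftOp κ (liftOp ι A) = liftOp (ι.trans κ) A := by
  ext x y
  simp only [liftOp, Matrix.of_apply]
  by_cases h : ∀ w, w ∉ Set.range (ι.trans κ) → x w = y w
  · rw [if_pos h, if_pos, if_pos]
    · rfl
    · intro w hw
      refine h _ fun ⟨v, hv⟩ => hw ⟨v, κ.injective hv⟩
    · rintro w hw
      exact h w fun ⟨v, hv⟩ => hw ⟨ι v, hv⟩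
  · rw [if_neg h]
    split
    · rename_i h1
      rw [if_neg]
      intro h2
      apply h
      intro w hw
      by_cases hk : w ∈ Set.range κ
      · obtain ⟨v, rfl⟩ := hk
        exact h2 v fun ⟨u, hu⟩ => hw ⟨u, congrArg κ hu⟩
      · exact h1 w hk
    · rfl

end lift

/-! ### Gates and circuits as lifted matrices -/

namespace Gate

/-- The wires of a gate. -/
def pair {n : ℕ} (g : Gate n) : Fin 2 ↪ Fin n :=
  ⟨![g.fst, g.snd], by
    intro i j h
    have h1 := g.fst_ne_snd
    fin_cases i <;> fin_cases j <;> simp_all [eq_comm]⟩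

/-- The index of a pair of bits. -/
def indexEquiv : (Fin 2 → Fin 2) ≃ Fin 4 := finTwoArrowEquiv (Fin 2) |>.trans finProdFinEquiv

/-- This makes unitarity, inverses and the change to a larger register consequences of the calculus
of `liftOp`. -/
theorem toOp_eq {n : ℕ} (g : Gate n) :
    g.toOp = liftOp g.pair (g.local4.submatrix indexEquiv indexEquiv) := by
  ext x y
  simp only [toOp, liftOp, Matrix.of_apply, Matrix.submatrix_apply]
  have : (∀ w, w ≠ g.fst → w ≠ g.snd → x w = y w) ↔ ∀ w, w ∉ Set.range g.pair → x w = y w := by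
    have h0 : g.pair 0 = g.fst := rfl
    have h1 : g.pair 1 = g.snd := rfl
    simp only [Set.mem_range, Fin.exists_fin_two, not_or, h0, h1, and_imp, ne_eq, eq_comm]
  by_cases h : ∀ w, w ≠ g.fst → w ≠ g.snd → x w = y w
  · rw [if_pos h, if_pos (this.1 h)]
    rfl
  · rw [if_neg h, if_neg (mt this.2 h)]

theorem local4_mem {n : ℕ} (g : Gate n) : g.local4 ∈ Matrix.unitaryGroup (Fin 4) ℂ := by
  unfold local4
  split
  · exact Unitary.star_mem g.isUnitary
  · exact g.isUnitary

theorem toOp_mem {n : ℕ} (g : Gate n) : g.toOp ∈ Matrix.unitaryGroup (Fin n → Fin 2) ℂ := by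
  rw [Matrix.mem_unitaryGroup_iff, Matrix.star_eq_conjTranspose, toOp_eq, ← liftOp_conjTranspose,
    ← liftOp_mul, Matrix.conjTranspose_submatrix, Matrix.submatrix_mul_equiv,
    ← Matrix.star_eq_conjTranspose, Matrix.mem_unitaryGroup_iff.1 g.local4_mem,
    Matrix.submatrix_one_equiv, liftOp_one]

theorem toOp_inv {n : ℕ} (g : Gate n) : g.inv.toOp = g.toOpᴴ := by
  have h : g.inv.local4 = g.local4ᴴ := by
    unfold local4 inv
    dsimp only
    by_cases hi : g.inverse = true <;> simp [hi]
  rw [toOp_eq, toOp_eq, ← liftOp_conjTranspose, Matrix.conjTranspose_submatrix, ← h]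
  rfl

theorem toOp_castLE {n n' : ℕ} (h : n ≤ n') (g : Gate n) :
    (g.castLE h).toOp = liftOp (Fin.castLEEmb h) g.toOp := by
  rw [toOp_eq, toOp_eq, liftOp_liftOp]
  have : (g.castLE h).pair = g.pair.trans (Fin.castLEEmb h) := by
    ext i
    fin_cases i <;> rfl
  rw [this]
  rfl

end Gate

theorem circuitOp_append {n : ℕ} (l l' : List (Gate n)) :
    circuitOp (l ++ l') = circuitOp l' * circuitOp l := by
  induction l with
  | nil => simp [circuitOp]
  | cons g l ih => rw [List.cons_append, circuitOp, ih, circuitOp, Matrix.mul_assoc]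

theorem circuitOp_mem {n : ℕ} (l : List (Gate n)) :
    circuitOp l ∈ Matrix.unitaryGroup (Fin n → Fin 2) ℂ := by
  induction l with
  | nil => exact one_mem _
  | cons g l ih => exact mul_mem ih g.toOp_mem

theorem circuitOp_mul_conjTranspose {n : ℕ} (l : List (Gate n)) :
    circuitOp l * (circuitOp l)ᴴ = 1 :=
  Matrix.mem_unitaryGroup_iff.1 (circuitOp_mem l)

theorem circuitOp_reverse_inv {n : ℕ} (l : List (Gate n)) :
    circuitOp (l.map Gate.inv).reverse = (circuitOp l)ᴴ := by
  induction l with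
  | nil => simp [circuitOp]
  | cons g l ih =>
    rw [List.map_cons, List.reverse_cons, circuitOp_append, ih, circuitOp, circuitOp, circuitOp,
      Matrix.one_mul, Gate.toOp_inv, Matrix.conjTranspose_mul]

theorem circuitOp_castLE {n n' : ℕ} (h : n ≤ n') (l : List (Gate n)) :
    circuitOp (l.map (Gate.castLE h)) = liftOp (Fin.castLEEmb h) (circuitOp l) := by
  induction l with
  | nil => simp [circuitOp, liftOp_one]
  | cons g l ih => rw [List.map_cons, circuitOp, ih, circuitOp, liftOp_mul, Gate.toOp_castLE]

theorem toOp_idGate (n : ℕ) : (idGate n).toOp = 1 := by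
  have : (idGate n).local4 = 1 := entryMatrix_one
  rw [Gate.toOp_eq, this, Matrix.submatrix_one_equiv, liftOp_one]

theorem circuitOp_replicate_idGate (n k : ℕ) :
    circuitOp (List.replicate k (idGate n)) = 1 := by
  induction k with
  | zero => rfl
  | succ k ih => rw [List.replicate_succ, circuitOp, ih, toOp_idGate, Matrix.one_mul]

/-! ### The correlation function of `Z` and the bias of the clean qubit -/

theorem liftOp_cleanProj {n n' : ℕ} (h : n + 1 ≤ n' + 1) :
    liftOp (Fin.castLEEmb h) (cleanProj n) = cleanProj n' := by
  ext x y
  have h0 : Fin.castLEEmb h 0 = 0 := rfl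
  simp only [liftOp, cleanProj, Matrix.of_apply, Matrix.diagonal_apply, Function.comp_apply, h0]
  by_cases hxy : x = y
  · subst hxy
    simp
  · rw [if_neg hxy]
    split
    · rename_i h1
      rw [if_neg]
      intro h2
      apply hxy
      funext w
      by_cases hw : w ∈ Set.range (Fin.castLEEmb h)
      · obtain ⟨v, rfl⟩ := hw
        exact congrFun h2 v
      · exact h1 w hw
    · rfl

theorem trace_cleanProj (n : ℕ) : (cleanProj n).trace = 2 ^ n := by
  -- The projection is lifted from a single qubit, where its trace is `1`; the normalized trace
  -- `1/2` carries over.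
  have h := trace_liftOp (Fin.castLEEmb (show 0 + 1 ≤ n + 1 by omega)) (cleanProj 0)
  rw [liftOp_cleanProj] at h
  have h2 : (cleanProj 0).trace = 1 := by
    rw [cleanProj, Matrix.trace_diagonal, ← (Equiv.funUnique (Fin 1) (Fin 2)).symm.sum_comp]
    simp
  rw [h2, Fintype.card_fin, Fintype.card_fin, pow_succ] at h
  field_simp at h
  simpa using h

/-- Expanding both reflections gives four traces. Those of `P` and of `u P u†` are `2^n` each, so
that only the trace of `P · u P u†`, which is the outcome probability up to normalization, depends
on `u`. -/
theorem trace_reflection (n : ℕ) {u : QOp (n + 1)} (hu : u * uᴴ = 1) :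
    (((2 : ℂ) • cleanProj n - 1) * (u * ((2 : ℂ) • cleanProj n - 1) * uᴴ)).trace / 2 ^ (n + 1) =
      2 * (cleanProj n * (u * (((2 : ℂ) ^ n)⁻¹ • cleanProj n) * uᴴ)).trace - 1 := by
  have hu' : uᴴ * u = 1 := mul_eq_one_comm.1 hu
  have h1 : (u * cleanProj n * uᴴ).trace = 2 ^ n := by
    rw [Matrix.trace_mul_comm, ← Matrix.mul_assoc, hu', Matrix.one_mul, trace_cleanProj]
  have h2 : u * ((2 : ℂ) • cleanProj n - 1) * uᴴ = (2 : ℂ) • (u * cleanProj n * uᴴ) - 1 := by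
    rw [Matrix.mul_sub, Matrix.sub_mul, Matrix.mul_one, hu, Matrix.mul_smul, Matrix.smul_mul]
  have h3 : (1 : QOp (n + 1)).trace = 2 ^ (n + 1) := by
    rw [Matrix.trace_one]
    simp
  rw [h2, Matrix.mul_sub, Matrix.mul_one, Matrix.sub_mul, Matrix.one_mul]
  simp only [Matrix.smul_mul, Matrix.mul_smul, Matrix.trace_sub, Matrix.trace_smul, h1, h3,
    trace_cleanProj, smul_eq_mul]
  field_simp
  ring

theorem toOp_idProbe (m : ℕ) : (idProbe m).op.toOp = 1 := by
  have : (idProbe m).op.toOp = pauliOp (s := 0) Function.Embedding.ofIsEmpty fun _ => .I := by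
    simp [LocalOp.toOp, idProbe]
  rw [this]
  ext x y
  simp [pauliOp, Matrix.one_apply, funext_iff]

/-- A single wire. -/
def wireEmb {n : ℕ} (w : Fin n) : Fin 1 ↪ Fin n := ⟨fun _ => w, fun _ _ _ => Subsingleton.elim _ _⟩

theorem pauliOp_wireEmb {n : ℕ} (w : Fin n) (P : Fin 1 → Pauli) (x y : Fin n → Fin 2) :
    pauliOp (wireEmb w) P x y =
      open Classical in
      if ∀ v, v ≠ w → x v = y v then (P 0).toMatrix (x w) (y w) else 0 := by
  have h : ∀ i, wireEmb w i = w := fun _ => rfl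
  simp [pauliOp, h, eq_comm]

theorem toOp_zProbe (m t : ℕ) : (zProbe m t).op.toOp = (2 : ℂ) • cleanProj m - 1 := by
  have : (zProbe m t).op.toOp = pauliOp (wireEmb 0) fun _ => .Z := by
    simp [LocalOp.toOp, zProbe, wireEmb]
  rw [this]
  ext x y
  rw [pauliOp_wireEmb]
  simp only [cleanProj, Matrix.sub_apply, Matrix.smul_apply, Matrix.diagonal_apply,
    Matrix.one_apply]
  by_cases h : x = y
  · subst h
    have : x 0 = 0 ∨ x 0 = 1 := by omega
    rcases this with h | h
    · simp [h, Pauli.toMatrix]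
      norm_num
    · simp [h, Pauli.toMatrix]
  · simp only [h, if_false]
    split
    · rename_i h1
      have : x 0 ≠ y 0 := by
        intro h0
        apply h
        funext w
        by_cases hw : w = 0
        · rw [hw, h0]
        · exact h1 w hw
      rcases (by omega : x 0 = 0 ∧ y 0 = 1 ∨ x 0 = 1 ∧ y 0 = 0) with ⟨h2, h3⟩ | ⟨h2, h3⟩ <;>
        simp [h2, h3, Pauli.toMatrix]
    · simp

theorem length_le_length_encList {α : Type} (e : α → List Bool) (l : List α) :
    l.length ≤ (encList e l).length := by
  induction l with
  | nil => simp
  | cons a l ih =>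
    simp only [encList, List.length_cons, List.length_append]
    omega

/-- The operator of a probe, evolved by a circuit. -/
noncomputable def Probe.evolve {m : ℕ} (gates : List (Gate m)) (p : Probe m) : QOp m :=
  circuitOp (gates.take p.time) * p.op.toOp * (circuitOp (gates.take p.time))ᴴ

theorem TOCInstance.correlation_eq {A : Set ℕ} {l K : ℕ} (x : TOCInstance A l K) :
    x.correlation = Matrix.trace (x.probes.map (Probe.evolve x.gates)).prod / 2 ^ x.m := rfl

/-- The correlation function that belongs to a one-clean-qubit computation is the bias of its
outcome. -/
theorem re_correlation_toTOC {A : Set ℕ} {l K N : ℕ} (hN : N + 2 ∈ A) (hl : 1 ≤ l) (hK : 1 ≤ K)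
    (C : OneClean) (p : ℕ) :
    (OneClean.toTOC hN hl hK C p).correlation.re = 2 * C.prob0 - 1 := by
  have hlen : C.gates.length ≤ (encOneClean C).length := by
    have := length_le_length_encList encGate C.gates
    simp only [encOneClean, List.length_append]
    omega
  have hm : C.n + 1 ≤ C.n + p + 1 + 1 := by omega
  obtain ⟨gates, hg⟩ : ∃ gates, gates = C.gates.map (Gate.castLE hm) ++
    List.replicate (encOneClean C).length (idGate (C.n + p)) := ⟨_, rfl⟩
  -- The code of `C` is at least as long as its list of gates, so at this time all gates of `C` and
  -- then only identity gates have been applied.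
  have hU : circuitOp (gates.take (encOneClean C).length) =
      liftOp (Fin.castLEEmb hm) (circuitOp C.gates) := by
    rw [hg, List.take_append, List.take_of_length_le (by simpa using hlen), circuitOp_append,
      List.take_replicate, circuitOp_replicate_idGate, Matrix.one_mul, circuitOp_castLE]
  have h0 : (idProbe (C.n + p + 1 + 1)).evolve gates = 1 := by
    rw [Probe.evolve, toOp_idProbe]
    simp [idProbe, circuitOp]
  have hZ (t : ℕ) : (zProbe (C.n + p + 1) t).op.toOp =
      liftOp (Fin.castLEEmb hm) ((2 : ℂ) • cleanProj C.n - 1) := by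
    rw [toOp_zProbe, ← liftOp_cleanProj hm, liftOp_sub, liftOp_smul, liftOp_one]
  have h1 : (zProbe (C.n + p + 1) 0).evolve gates =
      liftOp (Fin.castLEEmb hm) ((2 : ℂ) • cleanProj C.n - 1) := by
    rw [Probe.evolve, hZ]
    simp [zProbe, circuitOp]
  have h2 : (zProbe (C.n + p + 1) (encOneClean C).length).evolve gates =
      liftOp (Fin.castLEEmb hm) (circuitOp C.gates * ((2 : ℂ) • cleanProj C.n - 1) *
        (circuitOp C.gates)ᴴ) := by
    rw [Probe.evolve, hZ, liftOp_mul, liftOp_mul, liftOp_conjTranspose, ← hU]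
    rfl
  have h3 : ((List.replicate N (idProbe (C.n + p + 1 + 1)) ++ [zProbe (C.n + p + 1) 0,
      zProbe (C.n + p + 1) (encOneClean C).length]).map (Probe.evolve gates)).prod =
      liftOp (Fin.castLEEmb hm) (((2 : ℂ) • cleanProj C.n - 1) * (circuitOp C.gates *
        ((2 : ℂ) • cleanProj C.n - 1) * (circuitOp C.gates)ᴴ)) := by
    rw [List.map_append, List.map_replicate, List.prod_append, List.map_cons, List.map_cons,
      List.map_nil, List.prod_cons, List.prod_cons, List.prod_nil, List.prod_replicate, h0, h1, h2,
      one_pow, one_mul, mul_one, ← liftOp_mul]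
  have h4 := trace_liftOp (Fin.castLEEmb hm) (((2 : ℂ) • cleanProj C.n - 1) * (circuitOp C.gates *
        ((2 : ℂ) • cleanProj C.n - 1) * (circuitOp C.gates)ᴴ))
  rw [Fintype.card_fin, Fintype.card_fin,
    trace_reflection _ (circuitOp_mul_conjTranspose C.gates), ← h3, hg] at h4
  refine (congrArg Complex.re h4).trans ?_
  simp [OneClean.prob0, initialState]

/-! ### The Hadamard test -/

section block

variable {m : ℕ}

/-- The bits of the system in a bit string for the clean qubit, the system and a spare qubit. -/
def middle (x : Fin (m + 1 + 1) → Fin 2) : Fin m → Fin 2 := fun i => x i.castSucc.succ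

/-- The splitting of a bit string into the clean bit, the bits of the system and the spare bit. -/
def blockEquiv (m : ℕ) : (Fin (m + 1 + 1) → Fin 2) ≃ Fin 2 × ((Fin m → Fin 2) × Fin 2) where
  toFun x := (x 0, middle x, x (Fin.last (m + 1)))
  invFun p := Fin.cons p.1 (Fin.snoc (α := fun _ => Fin 2) p.2.1 p.2.2)
  left_inv x := by
    funext w
    refine Fin.cases rfl (fun w => ?_) w
    refine (Fin.cons_succ _ _ _).trans ?_
    refine Fin.lastCases ?_ (fun w => ?_) w
    · simp
    · simp [middle]
  right_inv p := by
    refine Prod.ext rfl (Prod.ext (funext fun i => ?_) ?_)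
    · simp [middle]
    · simp [← Fin.succ_last]

/-- The tensor product of an operator on the clean qubit, an operator on the system and the
identity on the spare qubit. -/
noncomputable def blockOp (a : Matrix (Fin 2) (Fin 2) ℂ) (A : QOp m) : QOp (m + 1 + 1) :=
  (Matrix.kroneckerMap (fun s t => s * t) a
    (Matrix.kroneckerMap (fun s t => s * t) A (1 : Matrix (Fin 2) (Fin 2) ℂ))).submatrix
      (blockEquiv m) (blockEquiv m)

theorem blockOp_apply (a : Matrix (Fin 2) (Fin 2) ℂ) (A : QOp m) (x y : Fin (m + 1 + 1) → Fin 2) :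
    blockOp a A x y = a (x 0) (y 0) * (A (middle x) (middle y) *
      if x (Fin.last (m + 1)) = y (Fin.last (m + 1)) then 1 else 0) := rfl

theorem blockOp_mul (a b : Matrix (Fin 2) (Fin 2) ℂ) (A B : QOp m) :
    blockOp a A * blockOp b B = blockOp (a * b) (A * B) := by
  rw [blockOp, blockOp, blockOp, Matrix.submatrix_mul_equiv, ← Matrix.mul_kronecker_mul,
    ← Matrix.mul_kronecker_mul, Matrix.one_mul]

theorem blockOp_one : blockOp 1 (1 : QOp m) = 1 := by
  rw [blockOp, Matrix.one_kronecker_one, Matrix.one_kronecker_one, Matrix.submatrix_one_equiv]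

theorem blockOp_conjTranspose (a : Matrix (Fin 2) (Fin 2) ℂ) (A : QOp m) :
    (blockOp a A)ᴴ = blockOp aᴴ Aᴴ := by
  rw [blockOp, blockOp, Matrix.conjTranspose_submatrix, Matrix.conjTranspose_kronecker,
    Matrix.conjTranspose_kronecker, Matrix.conjTranspose_one]

theorem trace_blockOp (a : Matrix (Fin 2) (Fin 2) ℂ) (A : QOp m) :
    (blockOp a A).trace = a.trace * (A.trace * 2) := by
  rw [blockOp]
  refine (Equiv.sum_comp (blockEquiv m) fun i => (Matrix.kroneckerMap (fun s t => s * t) a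
    (Matrix.kroneckerMap (fun s t => s * t) A (1 : Matrix (Fin 2) (Fin 2) ℂ))) i i).trans ?_
  change (Matrix.kroneckerMap (fun s t => s * t) a
    (Matrix.kroneckerMap (fun s t => s * t) A (1 : Matrix (Fin 2) (Fin 2) ℂ))).trace = _
  rw [Matrix.trace_kronecker, Matrix.trace_kronecker, Matrix.trace_one]
  simp

theorem blockOp_add (a b : Matrix (Fin 2) (Fin 2) ℂ) (A : QOp m) :
    blockOp (a + b) A = blockOp a A + blockOp b A := by
  ext x y
  simp only [blockOp_apply, Matrix.add_apply]
  ring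

theorem blockOp_smul (c : ℂ) (a : Matrix (Fin 2) (Fin 2) ℂ) (A : QOp m) :
    blockOp (c • a) A = blockOp a (c • A) := by
  ext x y
  simp only [blockOp_apply, Matrix.smul_apply, smul_eq_mul]
  ring

theorem forall_wire (p : Fin (m + 1 + 1) → Prop) :
    (∀ w, p w) ↔ p 0 ∧ (∀ w : Fin m, p w.castSucc.succ) ∧ p (Fin.last (m + 1)) := by
  rw [Fin.forall_fin_succ, Fin.forall_fin_succ', Fin.succ_last]

theorem last_ne_middle (w : Fin m) : ¬Fin.last (m + 1) = w.castSucc.succ := by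
  rw [← Fin.succ_last, Fin.succ_inj]
  exact (Fin.castSucc_lt_last w).ne'

theorem last_ne_zero : ¬Fin.last (m + 1) = 0 := (Fin.last_pos).ne'

theorem toOp_shift (g : Gate m) : g.shift.toOp = blockOp 1 g.toOp := by
  ext x y
  have h1 : (∀ w, w ≠ g.shift.fst → w ≠ g.shift.snd → x w = y w) ↔
      x 0 = y 0 ∧ (∀ w, w ≠ g.fst → w ≠ g.snd → middle x w = middle y w) ∧
        x (Fin.last (m + 1)) = y (Fin.last (m + 1)) := by
    rw [forall_wire]
    simp only [Gate.shift, ne_eq, Fin.succ_inj, Fin.castSucc_inj, (Fin.succ_ne_zero _).symm,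
      not_false_eq_true, forall_const, middle, last_ne_middle]
  simp only [blockOp_apply, Gate.toOp, Matrix.of_apply, Matrix.one_apply, h1]
  by_cases h2 : x 0 = y 0 <;> by_cases h3 : x (Fin.last (m + 1)) = y (Fin.last (m + 1)) <;>
    simp only [h2, h3, if_true, if_false, true_and, and_true, and_false, false_and, one_mul,
      mul_one, mul_zero, zero_mul]
  rfl

theorem eq_iff_middle {x y : Fin (m + 1 + 1) → Fin 2} :
    (∀ w, w ≠ 0 → x w = y w) ↔
      middle x = middle y ∧ x (Fin.last (m + 1)) = y (Fin.last (m + 1)) := by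
  rw [forall_wire, funext_iff]
  simp [middle]

/-- A gate that acts on the clean qubit only. -/
theorem toOp_clean (g : Gate (m + 1 + 1)) (hg : g.fst = 0) (u : Matrix (Fin 2) (Fin 2) ℂ)
    (hu : ∀ a b c d : Fin 2, g.local4 (finProdFinEquiv (a, b)) (finProdFinEquiv (c, d)) =
      u a c * if b = d then 1 else 0) : g.toOp = blockOp u 1 := by
  ext x y
  simp only [blockOp_apply, Gate.toOp, Matrix.of_apply, Matrix.one_apply, hu, hg]
  have h1 : ((∀ w, w ≠ 0 → w ≠ g.snd → x w = y w) ∧ x g.snd = y g.snd) ↔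
      (middle x = middle y ∧ x (Fin.last (m + 1)) = y (Fin.last (m + 1))) := by
    rw [← eq_iff_middle]
    constructor
    · rintro ⟨h, h'⟩ w hw
      by_cases hw' : w = g.snd
      · rw [hw', h']
      · exact h w hw hw'
    · intro h
      exact ⟨fun w hw _ => h w hw, h _ fun h0 => g.fst_ne_snd (hg.trans h0.symm)⟩
  by_cases h2 : (∀ w, w ≠ 0 → w ≠ g.snd → x w = y w) ∧ x g.snd = y g.snd
  · obtain ⟨h3, h4⟩ := h1.1 h2
    rw [if_pos h2.1, if_pos h2.2, if_pos h3, if_pos h4, one_mul]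
  · have h3 := mt h1.2 h2
    rw [not_and_or] at h2 h3
    have h4 : (if middle x = middle y then (1 : ℂ) else 0) *
        (if x (Fin.last (m + 1)) = y (Fin.last (m + 1)) then 1 else 0) = 0 := by
      rcases h3 with h3 | h3 <;> simp [h3]
    rw [h4, mul_zero]
    rcases h2 with h2 | h2
    · rw [if_neg h2]
    · simp [h2]

/-- The projection on the clean qubit being `0`. -/
def projZero : Matrix (Fin 2) (Fin 2) ℂ := !![1, 0; 0, 0]

/-- The projection on the clean qubit being `1`. -/
def projOne : Matrix (Fin 2) (Fin 2) ℂ := !![0, 0; 0, 1]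

/-- The Hadamard matrix. -/
noncomputable def hadamard : Matrix (Fin 2) (Fin 2) ℂ :=
  ((Real.sqrt 2 : ℂ) / 2) • !![1, 1; 1, -1]

/-- An operator on the system, controlled by the clean qubit. -/
noncomputable def ctrlOp (A : QOp m) : QOp (m + 1 + 1) := blockOp projZero 1 + blockOp projOne A

/-- The mixed terms vanish because the two projections on the clean qubit are orthogonal. -/
theorem ctrlOp_mul (A B : QOp m) : ctrlOp A * ctrlOp B = ctrlOp (A * B) := by
  have h1 : projZero * projZero = projZero := by
    ext i j; fin_cases i <;> fin_cases j <;> simp [projZero, Matrix.mul_apply]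
  have h2 : projZero * projOne = 0 := by
    ext i j; fin_cases i <;> fin_cases j <;> simp [projZero, projOne, Matrix.mul_apply]
  have h3 : projOne * projZero = 0 := by
    ext i j; fin_cases i <;> fin_cases j <;> simp [projZero, projOne, Matrix.mul_apply]
  have h4 : projOne * projOne = projOne := by
    ext i j; fin_cases i <;> fin_cases j <;> simp [projOne, Matrix.mul_apply]
  have h5 (A : QOp m) : blockOp 0 A = 0 := by ext x y; simp [blockOp_apply]
  simp only [ctrlOp, Matrix.add_mul, Matrix.mul_add, blockOp_mul, h1, h2, h3, h4, h5,
    Matrix.one_mul, add_zero, zero_add]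

theorem projZero_add_projOne : projZero + projOne = 1 := by
  ext i j; fin_cases i <;> fin_cases j <;> simp [projZero, projOne]

theorem ctrlOp_one : ctrlOp (1 : QOp m) = 1 := by
  rw [ctrlOp, ← blockOp_add, projZero_add_projOne, blockOp_one]

/-- Where the clean qubit is `0`, the evolution and its inverse cancel. The gates of the dynamics
therefore need no control, and two-qubit gates suffice for the test. -/
theorem conj_ctrlOp {u : QOp m} (hu : u * uᴴ = 1) (A : QOp m) :
    blockOp 1 u * ctrlOp A * (blockOp 1 u)ᴴ = ctrlOp (u * A * uᴴ) := by
  rw [blockOp_conjTranspose, ctrlOp, Matrix.mul_add, Matrix.add_mul, blockOp_mul, blockOp_mul,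
    blockOp_mul, blockOp_mul, Matrix.conjTranspose_one, Matrix.mul_one, Matrix.mul_one,
    Matrix.one_mul, Matrix.one_mul, Matrix.mul_one, hu, ctrlOp]

theorem toOp_phaseGate : (phaseGate m).toOp = ctrlOp (Complex.I • 1) := by
  rw [toOp_clean (phaseGate m) rfl (projZero + Complex.I • projOne), blockOp_add, blockOp_smul,
    ctrlOp]
  intro a b c d
  have : (phaseGate m).local4 = Matrix.diagonal ![1, 1, Complex.I, Complex.I] := entryMatrix_phase
  rw [this]
  fin_cases a <;> fin_cases b <;> fin_cases c <;> fin_cases d <;>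
    simp [finProdFinEquiv, projZero, projOne]

theorem toOp_hadamardGate : (hadamardGate m).toOp = blockOp hadamard 1 := by
  refine toOp_clean (hadamardGate m) rfl hadamard fun a b c d => ?_
  have : (hadamardGate m).local4 = ((Real.sqrt 2 : ℂ) / 2) •
    !![1, 0, 1, 0; 0, 1, 0, 1; 1, 0, -1, 0; 0, 1, 0, -1] := entryMatrix_hadamard
  rw [this]
  fin_cases a <;> fin_cases b <;> fin_cases c <;> fin_cases d <;>
    simp [finProdFinEquiv, hadamard]

theorem toOp_ctrlPauli (P : Pauli) (w : Fin m) :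
    (ctrlPauli P w).toOp = ctrlOp (pauliOp (wireEmb w) fun _ => P) := by
  ext x y
  have h1 : (∀ v, v ≠ (ctrlPauli P w).fst → v ≠ (ctrlPauli P w).snd → x v = y v) ↔
      (∀ v, v ≠ w → middle x v = middle y v) ∧ x (Fin.last (m + 1)) = y (Fin.last (m + 1)) := by
    rw [forall_wire]
    simp only [ctrlPauli, ne_eq, Fin.succ_inj, Fin.castSucc_inj, Fin.succ_ne_zero, not_true_eq_false,
      not_false_eq_true, forall_const, middle, last_ne_middle, last_ne_zero, false_imp_iff, true_and]
  have h2 : ∀ a b c d : Fin 2, (ctrlPauli P w).local4 (finProdFinEquiv (a, b)) (finProdFinEquiv (c, d)) =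
      projZero a c * (if b = d then 1 else 0) + projOne a c * P.toMatrix b d := by
    intro a b c d
    have : (ctrlPauli P w).local4 = !![1, 0, 0, 0; 0, 1, 0, 0; 0, 0, P.toMatrix 0 0, P.toMatrix 0 1;
        0, 0, P.toMatrix 1 0, P.toMatrix 1 1] := entryMatrix_ctrl P
    rw [this]
    fin_cases a <;> fin_cases b <;> fin_cases c <;> fin_cases d <;>
      simp [finProdFinEquiv, projZero, projOne]
  have h3 : middle x = middle y ↔
      (∀ v, v ≠ w → middle x v = middle y v) ∧ middle x w = middle y w := by
    rw [funext_iff]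
    exact ⟨fun h => ⟨fun v _ => h v, h w⟩, fun h v => if hv : v = w then hv ▸ h.2 else h.1 v hv⟩
  simp only [Gate.toOp, Matrix.of_apply, h1, h2, ctrlOp, Matrix.add_apply, blockOp_apply,
    pauliOp_wireEmb, Matrix.one_apply, h3]
  have h4 : ∀ x : Fin (m + 1 + 1) → Fin 2, x (ctrlPauli P w).fst = x 0 := fun _ => rfl
  have h5 : ∀ x : Fin (m + 1 + 1) → Fin 2, x (ctrlPauli P w).snd = middle x w := fun _ => rfl
  simp only [h4, h5]
  by_cases h7 : x (Fin.last (m + 1)) = y (Fin.last (m + 1))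
  · by_cases h6 : ∀ v, v ≠ w → middle x v = middle y v
    · rw [if_pos ⟨h6, h7⟩, if_pos h7, if_pos h6]
      by_cases h8 : middle x w = middle y w
      · rw [if_pos h8, if_pos ⟨h6, h8⟩]
        ring
      · rw [if_neg h8, if_neg fun h => h8 h.2]
        ring
    · rw [if_neg fun h => h6 h.1, if_neg fun h => h6 h.1, if_neg h6]
      ring
  · rw [if_neg fun h => h7 h.2, if_neg h7]
    ring

end block

/-! ### The circuit of the Hadamard test -/

section test

variable {m : ℕ}

theorem pauliOp_zero (wires : Fin 0 ↪ Fin m) (P : Fin 0 → Pauli) : pauliOp wires P = 1 := by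
  ext x y
  simp [pauliOp, Matrix.one_apply, funext_iff]

/-- Splitting off the first wire reduces a controlled Pauli string to two-qubit gates, one for each
wire. -/
theorem pauliOp_succ {s : ℕ} (wires : Fin (s + 1) ↪ Fin m) (P : Fin (s + 1) → Pauli) :
    pauliOp wires P = pauliOp (wireEmb (wires 0)) (fun _ => P 0) *
      pauliOp ((Fin.succEmb s).trans wires) (fun i => P i.succ) := by
  have hr : ∀ w, w ∉ Set.range ((Fin.succEmb s).trans wires) ↔ ∀ i : Fin s, wires i.succ ≠ w := by
    intro w
    simp
  have h0 : wires 0 ∉ Set.range ((Fin.succEmb s).trans wires) :=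
    (hr _).2 fun i h => Fin.succ_ne_zero i (wires.injective h)
  have hw : ∀ (i : Fin s), wires i.succ ≠ wires 0 := fun i h =>
    Fin.succ_ne_zero i (wires.injective h)
  ext x y
  -- Only one intermediate bit string contributes: the left factor may change `x` on the first wire
  -- only, and the right factor does not act on that wire.
  rw [Matrix.mul_apply, Finset.sum_eq_single (Function.update x (wires 0) (y (wires 0)))]
  · rw [pauliOp_wireEmb, if_pos fun v hv => by simp [hv], Function.update_self]
    simp only [pauliOp, Matrix.of_apply]
    have h1 : (∀ w, w ∉ Set.range ((Fin.succEmb s).trans wires) →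
        Function.update x (wires 0) (y (wires 0)) w = y w) ↔
        ∀ w, w ∉ Set.range wires → x w = y w := by
      constructor
      · intro h w hw'
        have := h w ((hr w).2 fun i hi => hw' ⟨_, hi⟩)
        rwa [Function.update_of_ne fun hh => hw' ⟨0, hh.symm⟩] at this
      · intro h w hw'
        by_cases hh : w = wires 0
        · rw [hh, Function.update_self]
        · rw [Function.update_of_ne hh]
          refine h w ?_
          rintro ⟨i, rfl⟩
          refine Fin.cases (fun hh _ => hh rfl) (fun i _ hw' => (hr _).1 hw' i rfl) i hh hw'
    by_cases h2 : ∀ w, w ∉ Set.range wires → x w = y w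
    · rw [if_pos h2, if_pos (h1.2 h2), Fin.prod_univ_succ]
      congr 1
      refine Finset.prod_congr rfl fun i _ => ?_
      have : (Fin.succEmb s).trans wires i = wires i.succ := rfl
      rw [this, Function.update_of_ne (hw i)]
    · rw [if_neg h2, if_neg (mt h1.1 h2), mul_zero]
  · intro z _ hz
    rw [pauliOp_wireEmb]
    split
    · rename_i h1
      have : z (wires 0) ≠ y (wires 0) := by
        intro h2
        apply hz
        funext v
        by_cases hv : v = wires 0
        · rw [hv, Function.update_self, h2]
        · rw [Function.update_of_ne hv, h1 v hv]
      have h3 : ¬∀ w, w ∉ Set.range ((Fin.succEmb s).trans wires) → z w = y w :=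
        fun h => this (h _ h0)
      simp only [pauliOp, Matrix.of_apply, if_neg h3, mul_zero]
    · rw [zero_mul]
  · intro h
    exact absurd (Finset.mem_univ _) h

/-- The list is reversed because the last gate is the leftmost factor, while `pauliOp_succ` splits
off the first wire on the left. -/
theorem circuitOp_ctrlPauli {s : ℕ} (wires : Fin s ↪ Fin m) (P : Fin s → Pauli) :
    circuitOp (List.ofFn fun i => ctrlPauli (P i) (wires i)).reverse =
      ctrlOp (pauliOp wires P) := by
  induction s with
  | zero => simp [circuitOp, pauliOp_zero, ctrlOp_one]
  | succ s ih =>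
    rw [List.ofFn_succ, List.reverse_cons, circuitOp_append, circuitOp, circuitOp, Matrix.one_mul,
      pauliOp_succ, ← ctrlOp_mul, toOp_ctrlPauli]
    exact congrArg _ (ih ((Fin.succEmb s).trans wires) fun i => P i.succ)

theorem circuitOp_phaseGate (k : ℕ) :
    circuitOp (List.replicate k (phaseGate m)) = ctrlOp (Complex.I ^ k • 1) := by
  induction k with
  | zero => simp [circuitOp, ctrlOp_one]
  | succ k ih =>
    rw [List.replicate_succ, circuitOp, ih, toOp_phaseGate, ctrlOp_mul, Matrix.smul_mul,
      Matrix.mul_smul, Matrix.one_mul, smul_smul, pow_succ]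

/-- The operator of a randomly chosen term of a local operator, or a random sign. -/
noncomputable def opValue (κ : ℕ) (O : LocalOp m) (seed : List Bool) : QOp m :=
  match selectTerm O.terms (takeBits (O.prec + κ) seed).reverse with
  | some T => Complex.I ^ (T.phase : ℕ) • pauliOp O.wires T.paulis
  | none => if (seed.drop (O.prec + κ)).headD false then -1 else 1

theorem circuitOp_opGates (κ : ℕ) (O : LocalOp m) (seed : List Bool) :
    circuitOp (opGates κ O seed) = ctrlOp (opValue κ O seed) := by
  unfold opGates opValue
  rcases selectTerm O.terms (takeBits (O.prec + κ) seed).reverse with _ | T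
  · dsimp only
    split
    · refine (circuitOp_phaseGate 2).trans ?_
      rw [Complex.I_sq, neg_one_smul]
    · rw [ctrlOp_one]
      rfl
  · dsimp only
    rw [termGates, circuitOp_append, circuitOp_ctrlPauli, circuitOp_phaseGate, ctrlOp_mul,
      Matrix.smul_mul, Matrix.one_mul]

/-- The product of randomly chosen terms of the probes, evolved by a circuit. -/
noncomputable def probesValue (κ : ℕ) (gates : List (Gate m)) : List (Probe m) → List Bool → QOp m
  | [], _ => 1
  | p :: ps, seed => circuitOp (gates.take p.time) * opValue κ p.op seed *
      (circuitOp (gates.take p.time))ᴴ * probesValue κ gates ps (seed.drop (p.op.prec + κ + 1))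

theorem circuitOp_shift (l : List (Gate m)) :
    circuitOp (l.map Gate.shift) = blockOp 1 (circuitOp l) := by
  induction l with
  | nil => simp [circuitOp, blockOp_one]
  | cons g l ih => rw [List.map_cons, circuitOp, ih, toOp_shift, blockOp_mul, circuitOp,
      Matrix.one_mul]

theorem circuitOp_probesGates (κ : ℕ) (gates : List (Gate m)) (probes : List (Probe m))
    (seed : List Bool) :
    circuitOp (probesGates κ gates probes seed) = ctrlOp (probesValue κ gates probes seed) := by
  induction probes generalizing seed with
  | nil => simp [probesGates, probesValue, circuitOp, ctrlOp_one]
  | cons p ps ih =>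
    have h : (gates.take p.time).map (fun g => g.shift.inv) =
        ((gates.take p.time).map Gate.shift).map Gate.inv := by
      rw [List.map_map]
      rfl
    rw [probesGates, circuitOp_append, ih, probeGates, circuitOp_append, circuitOp_append, h,
      circuitOp_reverse_inv, circuitOp_shift, circuitOp_opGates, ← Matrix.mul_assoc,
      conj_ctrlOp (circuitOp_mul_conjTranspose _), ctrlOp_mul, probesValue]

theorem ctrlOp_conjTranspose (A : QOp m) : (ctrlOp A)ᴴ = ctrlOp Aᴴ := by
  have h1 : projZeroᴴ = projZero := by
    ext i j; fin_cases i <;> fin_cases j <;> simp [projZero]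
  have h2 : projOneᴴ = projOne := by
    ext i j; fin_cases i <;> fin_cases j <;> simp [projOne]
  rw [ctrlOp, Matrix.conjTranspose_add, blockOp_conjTranspose, blockOp_conjTranspose, h1, h2,
    Matrix.conjTranspose_one, ctrlOp]

theorem trace_ctrlOp (A : QOp m) : (ctrlOp A).trace = 2 * 2 ^ m + 2 * A.trace := by
  rw [ctrlOp, Matrix.trace_add, trace_blockOp, trace_blockOp, Matrix.trace_one]
  simp [projZero, projOne, Matrix.trace_fin_two]
  ring

/-- The Hadamard test uses no more about `W` than this trace. It follows from the unitarity of the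
whole controlled circuit, so the unitarity of each sampled term need not be discussed. -/
theorem trace_mul_conjTranspose_of_ctrlOp {W : QOp m} (h : ctrlOp W * (ctrlOp W)ᴴ = 1) :
    (W * Wᴴ).trace = 2 ^ m := by
  have h1 := congrArg Matrix.trace h
  rw [ctrlOp_conjTranspose, ctrlOp_mul, trace_ctrlOp, Matrix.trace_one] at h1
  simp only [Fintype.card_pi, Fintype.card_fin, Finset.prod_const, Finset.card_univ,
    pow_succ] at h1
  push_cast at h1
  linear_combination h1 / 2

theorem cleanProj_eq : cleanProj (m + 1) = blockOp projZero 1 := by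
  ext x y
  have h : x = y ↔ x 0 = y 0 ∧ middle x = middle y ∧ x (Fin.last (m + 1)) = y (Fin.last (m + 1)) :=
    by rw [← eq_iff_middle, funext_iff, Fin.forall_fin_succ]; simp [Fin.forall_fin_succ]
  rw [blockOp_apply, cleanProj, Matrix.diagonal_apply, Matrix.one_apply]
  by_cases h1 : x 0 = y 0
  · by_cases h2 : middle x = middle y
    · by_cases h3 : x (Fin.last (m + 1)) = y (Fin.last (m + 1))
      · rw [if_pos (h.2 ⟨h1, h2, h3⟩), if_pos h2, if_pos h3, ← h1]
        rcases (by omega : x 0 = 0 ∨ x 0 = 1) with h | h <;> simp [h, projZero]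
      · rw [if_neg fun hh => h3 (h.1 hh).2.2, if_neg h3, mul_zero, mul_zero]
    · rw [if_neg fun hh => h2 (h.1 hh).2.1, if_neg h2, zero_mul, mul_zero]
  · rw [if_neg fun hh => h1 (h.1 hh).1]
    rcases (by omega : x 0 = 0 ∧ y 0 = 1 ∨ x 0 = 1 ∧ y 0 = 0) with ⟨h2, h3⟩ | ⟨h2, h3⟩ <;>
      simp [h2, h3, projZero]

theorem hadamard_projZero :
    hadamard * projZero * hadamard = !![1 / 2, 1 / 2; 1 / 2, 1 / 2] := by
  have h2 := sqrt_two_mul_self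
  ext i j
  fin_cases i <;> fin_cases j <;>
    simp [hadamard, projZero, Matrix.mul_apply] <;> linear_combination h2 / 4

theorem hadamard_projOne :
    hadamard * projOne * hadamard = !![1 / 2, -1 / 2; -1 / 2, 1 / 2] := by
  have h2 := sqrt_two_mul_self
  ext i j
  fin_cases i <;> fin_cases j <;>
    simp [hadamard, projOne, Matrix.mul_apply] <;>
    first | linear_combination h2 / 4 | linear_combination -h2 / 4

/-- The probability of the outcome `0` of a Hadamard test. -/
theorem trace_hadamardTest (W : QOp m) (hW : (W * Wᴴ).trace = 2 ^ m) :
    (cleanProj (m + 1) * (blockOp hadamard 1 * ctrlOp W * blockOp hadamard 1 *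
      initialState (m + 1) * (blockOp hadamard 1 * ctrlOp W * blockOp hadamard 1)ᴴ)).trace.re =
      1 / 2 + (W.trace / 2 ^ m).re / 2 := by
  -- The Hadamard gates are moved onto the two projections of the control. The entry of this
  -- operator from clean bit `0` to clean bit `0` is `(1 + W) / 2`.
  have h1 : blockOp hadamard 1 * ctrlOp W * blockOp hadamard 1 =
      blockOp !![1 / 2, 1 / 2; 1 / 2, 1 / 2] 1 + blockOp !![1 / 2, -1 / 2; -1 / 2, 1 / 2] W := by
    rw [ctrlOp, Matrix.mul_add, Matrix.add_mul, blockOp_mul, blockOp_mul, blockOp_mul, blockOp_mul,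
      hadamard_projZero, hadamard_projOne, Matrix.one_mul, Matrix.one_mul, Matrix.mul_one,
      Matrix.one_mul]
  have h2 : (1 : QOp m).trace = 2 ^ m := by
    rw [Matrix.trace_one]
    simp
  rw [h1, initialState, cleanProj_eq, Matrix.conjTranspose_add, blockOp_conjTranspose,
    blockOp_conjTranspose]
  simp only [Matrix.mul_smul, Matrix.smul_mul, Matrix.add_mul, Matrix.mul_add, blockOp_mul,
    Matrix.mul_one, Matrix.one_mul, Matrix.conjTranspose_one, Matrix.trace_smul, Matrix.trace_add,
    trace_blockOp, hW, h2, Matrix.trace_conjTranspose]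
  -- Preparing and measuring `0` keeps only the corner entries. The probability is therefore the
  -- normalized trace of `(1 + W)(1 + W)† / 4`.
  have h3 (a b c d e f g h : ℂ) : (projZero * (!![a, b; c, d] * projZero *
      !![e, f; g, h]ᴴ)).trace = a * star e := by
    simp [projZero, Matrix.trace_fin_two, Matrix.vecMul, dotProduct, Fin.sum_univ_two]
  simp only [h3]
  have h4 : star (1 / 2 : ℂ) = 1 / 2 := by simp
  have h5 : W.trace + star W.trace = ((2 * W.trace.re : ℝ) : ℂ) := Complex.add_conj _
  have h6 : (W.trace / 2 ^ m).re = W.trace.re / 2 ^ m := by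
    rw [← Complex.div_ofReal_re]
    push_cast
    rfl
  rw [h4, h6, ← Complex.ofReal_re (1 / 2 + W.trace.re / 2 ^ m / 2)]
  congr 1
  push_cast at h5 ⊢
  simp only [smul_eq_mul]
  field_simp
  linear_combination (2 ^ m : ℂ) * h5

theorem prob0_testCircuit (κ a : ℕ) (gates : List (Gate m)) (probes : List (Probe m))
    (seed : List Bool) :
    (testCircuit κ a gates probes seed).prob0 =
      1 / 2 + (Complex.I ^ a * ((probesValue κ gates probes seed).trace / 2 ^ m)).re / 2 := by
  have h1 : circuitOp (hadamardGate m :: (List.replicate a (phaseGate m) ++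
      (probesGates κ gates probes seed ++ [hadamardGate m]))) =
      blockOp hadamard 1 * ctrlOp (Complex.I ^ a • probesValue κ gates probes seed) *
        blockOp hadamard 1 := by
    rw [circuitOp, circuitOp_append, circuitOp_append, circuitOp_phaseGate,
      circuitOp_probesGates, circuitOp, circuitOp, toOp_hadamardGate, Matrix.one_mul,
      Matrix.mul_assoc (blockOp hadamard 1), ctrlOp_mul, Matrix.mul_smul, Matrix.mul_one]
  have h2 := circuitOp_mul_conjTranspose
    (List.replicate a (phaseGate m) ++ probesGates κ gates probes seed)
  rw [circuitOp_append, circuitOp_phaseGate, circuitOp_probesGates, ctrlOp_mul, Matrix.mul_smul,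
    Matrix.mul_one] at h2
  have h3 := trace_hadamardTest _ (trace_mul_conjTranspose_of_ctrlOp h2)
  rw [← h1, Matrix.trace_smul, smul_eq_mul, mul_div_assoc] at h3
  exact h3

end test

/-! ### Random choices -/

section bits

variable {V : Type} [AddCommMonoid V]

/-- The sum over all lists of `n` bits. -/
def sumBits : ℕ → (List Bool → V) → V
  | 0, f => f []
  | n + 1, f => sumBits n (fun l => f (false :: l)) + sumBits n fun l => f (true :: l)

theorem sum_ofFn (n : ℕ) (f : List Bool → V) :
    ∑ r : Fin n → Bool, f (List.ofFn r) = sumBits n f := by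
  induction n generalizing f with
  | zero => simp [sumBits]
  | succ n ih =>
    rw [← (Fin.consEquiv fun _ => Bool).sum_comp, Fintype.sum_prod_type, Fintype.sum_bool, sumBits,
      ← ih, ← ih, add_comm]
    simp [Fin.consEquiv, List.ofFn_succ]

theorem sumBits_congr {n : ℕ} {f g : List Bool → V} (h : ∀ l, l.length = n → f l = g l) :
    sumBits n f = sumBits n g := by
  induction n generalizing f g with
  | zero => exact h [] rfl
  | succ n ih =>
    rw [sumBits, sumBits, ih fun l hl => h _ (by simp [hl]), ih fun l hl => h _ (by simp [hl])]

theorem sumBits_add (a b : ℕ) (f : List Bool → V) :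
    sumBits (a + b) f = sumBits a fun u => sumBits b fun v => f (u ++ v) := by
  induction a generalizing f with
  | zero => simp [sumBits]
  | succ a ih =>
    rw [show a + 1 + b = a + b + 1 by omega, sumBits, ih, ih]
    rfl

theorem sumBits_add_distrib (n : ℕ) (f g : List Bool → V) :
    (sumBits n fun l => f l + g l) = sumBits n f + sumBits n g := by
  induction n generalizing f g with
  | zero => rfl
  | succ n ih =>
    rw [sumBits, ih, ih, sumBits, sumBits]
    abel

/-- Reversal permutes the bit strings of a given length. It occurs twice: the random string is
reversed to form the seed, and the drawn bits are reversed to form a number. -/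
theorem sumBits_reverse (n : ℕ) (f : List Bool → V) :
    (sumBits n fun l => f l.reverse) = sumBits n f := by
  induction n generalizing f with
  | zero => rfl
  | succ n ih =>
    have h1 := ih fun l => f (l ++ [false])
    have h2 := ih fun l => f (l ++ [true])
    have h3 := sumBits_add n 1 f
    simp only [sumBits] at h3
    simp only [sumBits, List.reverse_cons]
    rw [h3, sumBits_add_distrib, h1, h2]

/-- The value of a binary number, least significant bit first. -/
def bitsVal : List Bool → ℕ
  | [] => 0
  | b :: l => b.toNat + 2 * bitsVal l

theorem bitsVal_lt (l : List Bool) : bitsVal l < 2 ^ l.length := by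
  induction l with
  | nil => simp [bitsVal]
  | cons b l ih =>
    have := Bool.toNat_le b
    simp only [bitsVal, List.length_cons, pow_succ]
    omega

theorem sum_range_two_mul (M : ℕ) (f : ℕ → V) :
    ∑ d ∈ Finset.range (2 * M), f d = ∑ d ∈ Finset.range M, (f (2 * d) + f (2 * d + 1)) := by
  induction M with
  | zero => simp
  | succ M ih =>
    rw [show 2 * (M + 1) = 2 * M + 1 + 1 by ring, Finset.sum_range_succ, Finset.sum_range_succ, ih,
      Finset.sum_range_succ, add_assoc]

/-- Each number below `2^n` has exactly one expansion with `n` bits, so uniform bits give a uniform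
number. -/
theorem sumBits_bitsVal (n : ℕ) (f : ℕ → V) :
    (sumBits n fun l => f (bitsVal l)) = ∑ d ∈ Finset.range (2 ^ n), f d := by
  induction n generalizing f with
  | zero => simp [sumBits, bitsVal]
  | succ n ih =>
    rw [pow_succ', sum_range_two_mul, Finset.sum_add_distrib, ← ih fun d => f (2 * d),
      ← ih fun d => f (2 * d + 1), sumBits]
    simp [bitsVal, add_comm]

theorem bitsVal_encodeNat (n : ℕ) : bitsVal (Computability.encodeNat n) = n := by
  have h : ∀ p : PosNum, bitsVal (Computability.encodePosNum p) = p := by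
    intro p
    induction p with
    | one => rfl
    | bit0 p ih =>
      simp only [Computability.encodePosNum, bitsVal, ih, PosNum.cast_bit0]
      simp
      omega
    | bit1 p ih =>
      simp only [Computability.encodePosNum, bitsVal, ih, PosNum.cast_bit1]
      simp
      omega
  have h' : ∀ p : Num, bitsVal (Computability.encodeNum p) = p := by
    intro p
    cases p with
    | zero => rfl
    | pos p => exact h p
  exact (h' n).trans (Num.to_of_nat n)

/-- Summing the identities for the single digits, weighted by powers of two, cancels all borrows but
the first and the last. With no initial borrow, a final borrow occurs exactly when the minuend is
the smaller number. -/
theorem subBits_spec (b u : List Bool) (c : Bool) :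
    bitsVal b + c.toNat + bitsVal (subBits b u c).1 =
      bitsVal u + 2 ^ (subBits b u c).1.length * (subBits b u c).2.toNat := by
  have step (x y c : Bool) : y.toNat + c.toNat + (diffBit x y c).toNat =
      x.toNat + 2 * (borrowBit x y c).toNat := by
    cases x <;> cases y <;> cases c <;> rfl
  induction b generalizing u c with
  | nil =>
    induction u generalizing c with
    | nil => simp [subBits, bitsVal]
    | cons x u ih =>
      have h1 := ih (borrowBit x false c)
      have h2 := step x false c
      simp only [subBits, bitsVal, List.length_cons, pow_succ, Bool.toNat_false] at *
      nlinarith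
  | cons y b ih =>
    have h1 := ih u.tail (borrowBit (u.headD false) y c)
    have h2 := step (u.headD false) y c
    have h3 : bitsVal u = (u.headD false).toNat + 2 * bitsVal u.tail := by
      cases u <;> simp [bitsVal]
    rw [h3]
    simp only [subBits, bitsVal, List.length_cons, pow_succ] at *
    nlinarith

end bits

/-! ### Selection of a term by a number -/

section select

variable {s : ℕ}

/-- Selects a term of an expansion by a number. -/
def selectNat : List (PauliTerm s) → ℕ → Option (PauliTerm s)
  | [], _ => none
  | T :: l, d => if d < T.mult then some T else selectNat l (d - T.mult)

/-- A borrow means that the number is smaller than `mult`; otherwise the subtraction is exact and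
leaves the position relative to the next interval. -/
theorem selectTerm_eq (l : List (PauliTerm s)) (u : List Bool) :
    selectTerm l u = selectNat l (bitsVal u) := by
  induction l generalizing u with
  | nil => rfl
  | cons T l ih =>
    have h1 := subBits_spec (Computability.encodeNat T.mult) u false
    have h2 := bitsVal_lt (subBits (Computability.encodeNat T.mult) u false).1
    rw [bitsVal_encodeNat] at h1
    simp only [selectTerm, selectNat, ih]
    cases hb : (subBits (Computability.encodeNat T.mult) u false).2
    · rw [hb] at h1
      simp only [Bool.toNat_false, add_zero, mul_zero] at h1
      rw [if_neg (by simp), if_neg (by omega)]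
      congr 1
      omega
    · rw [hb] at h1
      simp only [Bool.toNat_false, Bool.toNat_true, add_zero, mul_one] at h1
      rw [if_pos rfl, if_pos (by omega)]

/-- The intervals are disjoint and fill an initial segment of the range, so each term is counted as
often as its multiplicity; the numbers beyond it contribute `f none = 0`. -/
theorem sum_selectNat {V : Type} [AddCommMonoid V] (f : Option (PauliTerm s) → V)
    (hf : f none = 0) (l : List (PauliTerm s)) (M : ℕ) (hM : (l.map PauliTerm.mult).sum ≤ M) :
    ∑ d ∈ Finset.range M, f (selectNat l d) = (l.map fun T => T.mult • f (some T)).sum := by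
  induction l generalizing M with
  | nil => simp [selectNat, hf]
  | cons T l ih =>
    simp only [List.map_cons, List.sum_cons] at hM ⊢
    obtain ⟨M, rfl⟩ := Nat.exists_eq_add_of_le (show T.mult ≤ M by omega)
    rw [Finset.sum_range_add, ← ih M (by omega)]
    congr 1
    · rw [Finset.sum_congr rfl fun d hd => by
        rw [selectNat, if_pos (Finset.mem_range.1 hd)], Finset.sum_const, Finset.card_range]
    · exact Finset.sum_congr rfl fun d _ => by
        rw [selectNat, if_neg (by omega), Nat.add_sub_cancel_left]

end select

/-! ### Averages over the random bits -/

section average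

variable {m : ℕ}

theorem sumBits_mul {n n' : ℕ} (f g : List Bool → QOp m) :
    (sumBits n fun u => sumBits n' fun v => f u * g v) = sumBits n f * sumBits n' g := by
  have h (A : QOp m) (n : ℕ) (g : List Bool → QOp m) :
      (sumBits n fun v => A * g v) = A * sumBits n g := by
    induction n generalizing g with
    | zero => rfl
    | succ n ih => rw [sumBits, sumBits, ih, ih, Matrix.mul_add]
  have h' (A : QOp m) (n : ℕ) (g : List Bool → QOp m) :
      (sumBits n fun v => g v * A) = sumBits n g * A := by
    induction n generalizing g with
    | zero => rfl
    | succ n ih => rw [sumBits, sumBits, ih, ih, Matrix.add_mul]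
  simp only [h, h']

theorem sumBits_const (n : ℕ) (A : QOp m) : (sumBits n fun _ => A) = (2 : ℂ) ^ n • A := by
  induction n with
  | zero => simp [sumBits]
  | succ n ih => rw [sumBits, ih, ← add_smul, pow_succ, mul_two]

theorem takeBits_append (n : ℕ) (u g : List Bool) (h : n ≤ u.length) :
    takeBits n (u ++ g) = u.take n := by
  induction n generalizing u with
  | zero => simp [takeBits]
  | succ n ih =>
    cases u with
    | nil => simp at h
    | cons b u =>
      have := ih u (by simpa using h)
      simp [takeBits, this]

/-- The average of the randomly chosen terms of a local operator is proportional to the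
operator. -/
theorem sumBits_opValue (κ : ℕ) (O : LocalOp m)
    (hO : (O.terms.map PauliTerm.mult).sum ≤ 2 ^ (O.prec + κ)) :
    sumBits (O.prec + κ + 1) (opValue κ O) = (2 : ℂ) ^ (O.prec + 1) • O.toOp := by
  -- Summation over the sign bit comes first: it cancels the two signs if no term is selected and
  -- gives a factor `2` if one is.
  have h1 : ∀ u : List Bool, u.length = O.prec + κ → (sumBits 1 fun v => opValue κ O (u ++ v)) =
      (selectNat O.terms (bitsVal u.reverse)).elim 0 fun T =>
        (2 : ℂ) • Complex.I ^ (T.phase : ℕ) • pauliOp O.wires T.paulis := by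
    intro u hu
    have h2 : ∀ b, takeBits (O.prec + κ) (u ++ [b]) = u := fun b => by
      rw [takeBits_append _ _ _ hu.ge, List.take_of_length_le hu.le]
    have h3 : ∀ b, (u ++ [b]).drop (O.prec + κ) = [b] := fun b => by
      rw [← hu, List.drop_left]
    simp only [sumBits, opValue, h2, h3, selectTerm_eq]
    rcases selectNat O.terms (bitsVal u.reverse) with _ | T
    · simp
    · simp [two_smul]
  rw [sumBits_add, sumBits_congr h1, sumBits_reverse _ fun u =>
    (selectNat O.terms (bitsVal u)).elim (0 : QOp m) fun T =>
        (2 : ℂ) • Complex.I ^ (T.phase : ℕ) • pauliOp O.wires T.paulis,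
    sumBits_bitsVal _ fun d => (selectNat O.terms d).elim (0 : QOp m) fun T =>
        (2 : ℂ) • Complex.I ^ (T.phase : ℕ) • pauliOp O.wires T.paulis,
    sum_selectNat (fun o => o.elim (0 : QOp m) fun T =>
        (2 : ℂ) • Complex.I ^ (T.phase : ℕ) • pauliOp O.wires T.paulis) rfl _ _ hO, LocalOp.toOp,
    List.smul_sum, List.map_map]
  congr 1
  refine List.map_congr_left fun T _ => ?_
  simp only [Option.elim_some, Function.comp_apply, ← Nat.cast_smul_eq_nsmul ℂ, smul_smul]
  congr 1
  field_simp
  ring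

theorem opValue_append (κ : ℕ) (O : LocalOp m) (u g : List Bool)
    (hu : u.length = O.prec + κ + 1) : opValue κ O (u ++ g) = opValue κ O u := by
  have h1 : takeBits (O.prec + κ) (u ++ g) = takeBits (O.prec + κ) u := by
    have := takeBits_append (O.prec + κ) u [] (by omega)
    rw [List.append_nil] at this
    rw [takeBits_append _ _ _ (by omega), this]
  have h2 : ((u ++ g).drop (O.prec + κ)).headD false = (u.drop (O.prec + κ)).headD false := by
    rw [List.drop_append_of_le_length (by omega)]
    have : (u.drop (O.prec + κ)).length = 1 := by
      rw [List.length_drop]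
      omega
    obtain ⟨b, hb⟩ := List.length_eq_one_iff.1 this
    rw [hb]
    rfl
  unfold opValue
  rw [h1, h2]

/-- The number of random bits used for a list of probes. -/
def seedLength (κ : ℕ) (probes : List (Probe m)) : ℕ :=
  (probes.map fun p => p.op.prec + κ + 1).sum

/-- The first probe reads only the first block of the seed and the others read only what follows.
The sum therefore factors, and every probe contributes its operator with a factor `2^(-κ)`. The
string `g` behind the random bits is never read. -/
theorem sumBits_probesValue (κ : ℕ) (gates : List (Gate m)) (probes : List (Probe m))
    (h : ∀ p ∈ probes, (p.op.terms.map PauliTerm.mult).sum ≤ 2 ^ (p.op.prec + κ)) (R : ℕ)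
    (hR : seedLength κ probes ≤ R) (g : List Bool) :
    (sumBits R fun r => probesValue κ gates probes (r ++ g)) =
      ((2 : ℂ) ^ R / (2 ^ κ) ^ probes.length) • (probes.map (Probe.evolve gates)).prod := by
  induction probes generalizing R with
  | nil => simp [probesValue, sumBits_const]
  | cons p ps ih =>
    simp only [seedLength, List.map_cons, List.sum_cons] at hR
    obtain ⟨R, rfl⟩ := Nat.exists_eq_add_of_le (show p.op.prec + κ + 1 ≤ R by omega)
    have h1 := ih (fun q hq => h q (by simp [hq])) R (by rw [seedLength]; omega)
    have h2 : ∀ u : List Bool, u.length = p.op.prec + κ + 1 →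
        (sumBits R fun v => probesValue κ gates (p :: ps) (u ++ v ++ g)) =
          sumBits R fun v => (circuitOp (gates.take p.time) * opValue κ p.op u *
            (circuitOp (gates.take p.time))ᴴ) * probesValue κ gates ps (v ++ g) := by
      intro u hu
      refine sumBits_congr fun v _ => ?_
      rw [probesValue, List.append_assoc, opValue_append _ _ _ _ hu, ← hu, List.drop_left]
    -- Sums over zero bits are single terms, so these two instances pull the constant factors `U†`
    -- and `U` out of the sum.
    have h3 := sumBits_mul (n := p.op.prec + κ + 1) (n' := 0)
      (fun u => circuitOp (gates.take p.time) * opValue κ p.op u)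
      (fun _ => (circuitOp (gates.take p.time))ᴴ)
    have h4 := sumBits_mul (n := 0) (n' := p.op.prec + κ + 1)
      (fun _ => circuitOp (gates.take p.time)) (opValue κ p.op)
    simp only [sumBits.eq_1] at h3 h4
    rw [sumBits_add, sumBits_congr h2, sumBits_mul (fun u => circuitOp (gates.take p.time) *
      opValue κ p.op u * (circuitOp (gates.take p.time))ᴴ), h1, h3, h4,
      sumBits_opValue κ p.op (h p (by simp)), List.map_cons, List.prod_cons, Probe.evolve]
    simp only [Matrix.mul_smul, Matrix.smul_mul, smul_smul, List.length_cons]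
    congr 1
    simp only [pow_add, pow_succ]
    field_simp

end average

/-! ### The outcome probability of the prepared circuits -/

theorem LocalOp.sum_mult_le {m K κ : ℕ} {O : LocalOp m} (hO : O.pauliNorm ≤ K) (hκ : K ≤ 2 ^ κ) :
    (O.terms.map PauliTerm.mult).sum ≤ 2 ^ (O.prec + κ) := by
  have h1 : O.pauliNorm = ((O.terms.map PauliTerm.mult).sum : ℕ) / 2 ^ O.prec := by
    rw [LocalOp.pauliNorm]
    induction O.terms with
    | nil => simp
    | cons T l ih =>
      simp only [List.map_cons, List.sum_cons, ih]
      push_cast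
      ring
  rw [h1, div_le_iff₀ (by positivity)] at hO
  have h2 : (K : ℝ) ≤ 2 ^ κ := by exact_mod_cast hκ
  have h3 : ((O.terms.map PauliTerm.mult).sum : ℝ) ≤ 2 ^ (O.prec + κ) := by
    rw [pow_add, mul_comm]
    exact hO.trans (by gcongr)
  exact_mod_cast h3

/-- The precision of each operator is written in unary, so the number of random bits is at most
linear in the input length for fixed `κ`. -/
theorem seedLength_le {m : ℕ} (κ : ℕ) (probes : List (Probe m)) :
    seedLength κ probes ≤ (κ + 1) * (encList encProbe probes).length := by
  unfold seedLength
  induction probes with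
  | nil => simp
  | cons p ps ih =>
    have h : p.op.prec + 1 ≤ (encProbe p).length := by
      simp only [encProbe, encLocalOp, List.length_append, StackProgram.length_encUnary]
      omega
    simp only [List.map_cons, List.sum_cons, encList, List.length_cons, List.length_append]
    nlinarith [Nat.zero_le (κ * p.op.prec)]

/-- The probability of the outcome `0` of the circuits prepared from an instance, when their seeds
are drawn at random. -/
theorem seededProb0_circuit {A : Set ℕ} {l K κ : ℕ} (hκ : K ≤ 2 ^ κ) (x : TOCInstance A l K)
    (a k R : ℕ) (hR : seedLength κ x.probes ≤ R) :
    seededProb0 (fun r => TOCInstance.circuit κ a (x, k, r)) R =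
      1 / 2 + (Complex.I ^ a * (x.correlation / (2 ^ κ) ^ x.probes.length)).re / 2 := by
  -- This is the deterministic part of the seed, behind the reversed random string. It is out of
  -- reach because `R` random bits suffice.
  obtain ⟨g, hg⟩ : ∃ g, g = (encList encProbe x.probes ++ encUnary k).reverse := ⟨_, rfl⟩
  have h1 : ∀ r, (TOCInstance.circuit κ a (x, k, r)).prob0 = 1 / 2 +
      (Complex.I ^ a * ((probesValue κ x.gates x.probes (r.reverse ++ g)).trace / 2 ^ x.m)).re / 2 := by
    intro r
    rw [TOCInstance.circuit, prob0_testCircuit, hg]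
    simp
  have h2 := sumBits_probesValue κ x.gates x.probes
    (fun p hp => LocalOp.sum_mult_le (x.bounded p hp) hκ) R hR g
  rw [← sumBits_reverse, ← sum_ofFn] at h2
  have h3 : ∑ r : Fin R → Bool, (Complex.I ^ a * ((probesValue κ x.gates x.probes
      ((List.ofFn r).reverse ++ g)).trace / 2 ^ x.m)).re =
      2 ^ R * (Complex.I ^ a * (x.correlation / (2 ^ κ) ^ x.probes.length)).re := by
    have h4 : (2 : ℝ) ^ R * (Complex.I ^ a * (x.correlation / (2 ^ κ) ^ x.probes.length)).re =
        ((2 : ℂ) ^ R * (Complex.I ^ a * (x.correlation / (2 ^ κ) ^ x.probes.length))).re := by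
      rw [← Complex.re_ofReal_mul]
      push_cast
      rfl
    rw [h4, ← Complex.re_sum, ← Finset.mul_sum, ← Finset.sum_div, ← Matrix.trace_sum, h2,
      Matrix.trace_smul, TOCInstance.correlation_eq, smul_eq_mul]
    congr 1
    ring
  have h5 : (Fintype.card (Fin R → Bool) : ℝ) = 2 ^ R := by simp
  simp only [seededProb0, h1]
  rw [Finset.sum_add_distrib, Finset.sum_const, Finset.card_univ, nsmul_eq_mul, h5,
    ← Finset.sum_div, h3]
  field_simp

/-- The probability is `2^(-n)` times the sum of `|u x y|^2` over `x` and `y` whose clean bits are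
`0`. There are `2^n` such `y`, and each column of a unitary matrix has norm `1`. -/
theorem OneClean.prob0_mem (C : OneClean) : 0 ≤ C.prob0 ∧ C.prob0 ≤ 1 := by
  obtain ⟨n, gates⟩ := C
  obtain ⟨u, hu⟩ : ∃ u, u = circuitOp gates := ⟨_, rfl⟩
  have hu' : uᴴ * u = 1 := by
    rw [hu]
    exact mul_eq_one_comm.1 (circuitOp_mul_conjTranspose gates)
  obtain ⟨d, hd⟩ : ∃ d : (Fin (n + 1) → Fin 2) → ℝ, d = fun x => if x 0 = 0 then 1 else 0 :=
    ⟨_, rfl⟩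
  have hd0 : ∀ x, 0 ≤ d x := fun x => by rw [hd]; dsimp only; split <;> norm_num
  have hd1 : ∀ x, d x ≤ 1 := fun x => by rw [hd]; dsimp only; split <;> norm_num
  have hP : cleanProj n = Matrix.diagonal fun x => (d x : ℂ) := by
    rw [cleanProj, hd]
    congr 1
    funext x
    split <;> simp [*]
  have hdn : ∑ y, d y = 2 ^ n := by
    have := trace_cleanProj n
    rw [hP, Matrix.trace_diagonal] at this
    exact_mod_cast this
  have h1 : (OneClean.mk n gates).prob0 =
      (2 ^ n)⁻¹ * ∑ x, ∑ y, d x * (d y * Complex.normSq (u x y)) := by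
    have : (cleanProj n * (u * initialState n * uᴴ)).trace =
        (((2 ^ n)⁻¹ * ∑ x, ∑ y, d x * (d y * Complex.normSq (u x y)) : ℝ) : ℂ) := by
      rw [initialState, Matrix.mul_smul, Matrix.smul_mul, Matrix.mul_smul, Matrix.trace_smul,
        smul_eq_mul, hP]
      push_cast
      congr 1
      refine Finset.sum_congr rfl fun x _ => ?_
      rw [Matrix.diag_apply, Matrix.diagonal_mul, Matrix.mul_apply, Finset.mul_sum]
      refine Finset.sum_congr rfl fun y _ => ?_
      rw [Matrix.mul_diagonal, Matrix.conjTranspose_apply, Complex.normSq_eq_conj_mul_self]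
      simp only [RCLike.star_def]
      ring
    rw [OneClean.prob0, ← hu, this, Complex.ofReal_re]
  have hcol : ∀ y, ∑ x, Complex.normSq (u x y) = 1 := by
    intro y
    have := congrFun (congrFun hu' y) y
    rw [Matrix.mul_apply, Matrix.one_apply_eq] at this
    have h2 : ((∑ x, Complex.normSq (u x y) : ℝ) : ℂ) = 1 := by
      rw [← this]
      push_cast
      refine Finset.sum_congr rfl fun x _ => ?_
      rw [Complex.normSq_eq_conj_mul_self, Matrix.conjTranspose_apply]
      rfl
    exact_mod_cast h2
  rw [h1]
  constructor
  · refine mul_nonneg (by positivity) (Finset.sum_nonneg fun x _ => Finset.sum_nonneg fun y _ => ?_)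
    exact mul_nonneg (hd0 x) (mul_nonneg (hd0 y) (Complex.normSq_nonneg _))
  · rw [inv_mul_le_iff₀ (by positivity), mul_one, ← hdn, Finset.sum_comm]
    refine Finset.sum_le_sum fun y _ => ?_
    calc ∑ x, d x * (d y * Complex.normSq (u x y)) ≤ ∑ x, d y * Complex.normSq (u x y) :=
          Finset.sum_le_sum fun x _ => mul_le_of_le_one_left
            (mul_nonneg (hd0 y) (Complex.normSq_nonneg _)) (hd1 x)
      _ = d y := by rw [← Finset.mul_sum, hcol, mul_one]

theorem seededProb0_mem (C : List Bool → OneClean) (R : ℕ) :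
    0 ≤ seededProb0 C R ∧ seededProb0 C R ≤ 1 := by
  unfold seededProb0
  constructor
  · exact div_nonneg (Finset.sum_nonneg fun r _ => (C _).prob0_mem.1) (by positivity)
  · rw [div_le_one (by positivity)]
    calc ∑ r : Fin R → Bool, (C (List.ofFn r)).prob0 ≤ ∑ r : Fin R → Bool, (1 : ℝ) :=
          Finset.sum_le_sum fun r _ => (C _).prob0_mem.2
      _ = 2 ^ R := by simp

/-! ### Concentration of the average outcome -/

theorem exp_le_of_abs_le {x : ℝ} (h : |x| ≤ 1) : Real.exp x ≤ 1 + x + x ^ 2 := by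
  have := (abs_le.1 (Real.abs_exp_sub_one_sub_id_le h)).2
  linarith

/-- In the bound `1 + x + x^2` for the exponential, the linear terms cancel since the outcome is
centred. The quadratic ones give `4 p (1 - p) t^2`, which is bounded crudely by `4 t^2`. -/
theorem two_point_mgf {p t : ℝ} (hp : 0 ≤ p) (hp' : p ≤ 1) (ht : |t| ≤ 1 / 2) :
    p * Real.exp (t * (1 - (2 * p - 1))) + (1 - p) * Real.exp (t * (-1 - (2 * p - 1))) ≤
      Real.exp (4 * t ^ 2) := by
  obtain ⟨ht1, ht2⟩ := abs_le.1 ht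
  have h1 : |t * (1 - (2 * p - 1))| ≤ 1 := by
    rw [abs_le]
    constructor <;> nlinarith
  have h2 : |t * (-1 - (2 * p - 1))| ≤ 1 := by
    rw [abs_le]
    constructor <;> nlinarith
  have h3 := mul_le_mul_of_nonneg_left (exp_le_of_abs_le h1) hp
  have h4 := mul_le_mul_of_nonneg_left (exp_le_of_abs_le h2) (sub_nonneg.2 hp')
  have h5 := Real.add_one_le_exp (4 * t ^ 2)
  have h6 : p * (1 - p) ≤ 1 := by nlinarith
  have h7 := mul_le_mul_of_nonneg_left h6 (by positivity : 0 ≤ 4 * t ^ 2)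
  nlinarith

theorem sum_runsProb (p : ℝ) (M : ℕ) : ∑ b : Fin M → Bool, runsProb p b = 1 := by
  have := Fintype.sum_pow (fun c : Bool => if c then 1 - p else p) M
  simp only [Fintype.sum_bool, if_true] at this
  simpa [runsProb] using this.symm

theorem runsProb_nonneg {p : ℝ} (hp : 0 ≤ p) (hp' : p ≤ 1) {M : ℕ} (b : Fin M → Bool) :
    0 ≤ runsProb p b := by
  refine Finset.prod_nonneg fun i _ => ?_
  split <;> linarith

/-- The exponent is a sum over independent runs, so the expectation is the `M`-th power of that of a
single run. -/
theorem sum_runsProb_exp_le {p t : ℝ} (hp : 0 ≤ p) (hp' : p ≤ 1) (ht : |t| ≤ 1 / 2) (M : ℕ)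
    (hM : 0 < M) : ∑ b : Fin M → Bool,
      runsProb p b * Real.exp (t * (M * (runsMean b - (2 * p - 1)))) ≤
        Real.exp (4 * t ^ 2 * M) := by
  have h1 : ∀ b : Fin M → Bool,
      runsProb p b * Real.exp (t * (M * (runsMean b - (2 * p - 1)))) =
        ∏ i, (if b i then (1 - p) * Real.exp (t * (-1 - (2 * p - 1))) else
          p * Real.exp (t * (1 - (2 * p - 1)))) := by
    intro b
    have h2 : t * (M * (runsMean b - (2 * p - 1))) =
        ∑ i, t * ((if b i then (-1 : ℝ) else 1) - (2 * p - 1)) := by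
      rw [← Finset.mul_sum, Finset.sum_sub_distrib, runsMean, Finset.sum_const, Finset.card_univ,
        Fintype.card_fin, nsmul_eq_mul, mul_sub (M : ℝ), mul_div_cancel₀]
      exact_mod_cast hM.ne'
    rw [h2, Real.exp_sum, runsProb, ← Finset.prod_mul_distrib]
    refine Finset.prod_congr rfl fun i _ => ?_
    split <;> rfl
  have h3 := Fintype.sum_pow (fun c : Bool => if c then (1 - p) * Real.exp (t * (-1 - (2 * p - 1)))
    else p * Real.exp (t * (1 - (2 * p - 1)))) M
  rw [Finset.sum_congr rfl fun b _ => h1 b, ← h3, Fintype.sum_bool]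
  have h4 := two_point_mgf hp hp' ht
  rw [mul_comm _ (M : ℝ), Real.exp_nat_mul]
  refine pow_le_pow_left₀ ?_ ?_ M
  · simp only [if_true, Bool.false_eq_true, if_false]
    have := sub_nonneg.2 hp'
    positivity
  · simp only [if_true, Bool.false_eq_true, if_false]
    linarith

open Classical in
/-- A tail bound for the average outcome. -/
theorem sum_runsProb_tail_le {p δ : ℝ} (hp : 0 ≤ p) (hp' : p ≤ 1) (hδ : 0 ≤ δ) (hδ' : δ ≤ 1)
    (M : ℕ) (hM : 0 < M) : ∑ b : Fin M → Bool,
      (if δ < |runsMean b - (2 * p - 1)| then runsProb p b else 0) ≤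
        2 * Real.exp (-(M * δ ^ 2 / 16)) := by
  -- For `|t| = δ / 8` the moment bound has exponent `M δ^2 / 16`, which is half of the subtracted
  -- `M δ^2 / 8`. The two signs of `t` treat the two tails.
  have key : ∀ t : ℝ, |t| = δ / 8 → ∑ b : Fin M → Bool,
      runsProb p b * Real.exp (t * (M * (runsMean b - (2 * p - 1))) - M * δ ^ 2 / 8) ≤
        Real.exp (-(M * δ ^ 2 / 16)) := by
    intro t ht
    have h1 := sum_runsProb_exp_le hp hp' (t := t) (by rw [ht]; linarith) M hM
    have h2 : t ^ 2 = (δ / 8) ^ 2 := by rw [← ht, sq_abs]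
    calc _ = (∑ b : Fin M → Bool, runsProb p b * Real.exp (t * (M * (runsMean b - (2 * p - 1))))) *
          Real.exp (-(M * δ ^ 2 / 8)) := by
          rw [Finset.sum_mul]
          refine Finset.sum_congr rfl fun b _ => ?_
          rw [mul_assoc, ← Real.exp_add, sub_eq_add_neg]
      _ ≤ Real.exp (4 * t ^ 2 * M) * Real.exp (-(M * δ ^ 2 / 8)) :=
          mul_le_mul_of_nonneg_right h1 (Real.exp_nonneg _)
      _ = _ := by
        rw [← Real.exp_add, h2]
        congr 1
        ring
  have h1 := key (δ / 8) (abs_of_nonneg (by linarith))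
  have h2 := key (-(δ / 8)) (by rw [abs_neg, abs_of_nonneg (by linarith)])
  rw [two_mul (Real.exp _)]
  refine le_trans ?_ (add_le_add h1 h2)
  rw [← Finset.sum_add_distrib]
  refine Finset.sum_le_sum fun b _ => ?_
  have hb := runsProb_nonneg hp hp' b
  have hM' : (0 : ℝ) ≤ M := Nat.cast_nonneg M
  have h3 := mul_nonneg hb (Real.exp_nonneg
    (δ / 8 * (M * (runsMean b - (2 * p - 1))) - M * δ ^ 2 / 8))
  have h4 := mul_nonneg hb (Real.exp_nonneg
    (-(δ / 8) * (M * (runsMean b - (2 * p - 1))) - M * δ ^ 2 / 8))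
  split
  · rename_i h
    rcases lt_abs.1 h with h | h
    · have h5 : 0 ≤ δ / 8 * (M * (runsMean b - (2 * p - 1))) - M * δ ^ 2 / 8 := by
        have := mul_nonneg (mul_nonneg hM' hδ) (sub_nonneg.2 h.le)
        nlinarith
      have := mul_le_mul_of_nonneg_left (Real.one_le_exp h5) hb
      linarith
    · have h5 : 0 ≤ -(δ / 8) * (M * (runsMean b - (2 * p - 1))) - M * δ ^ 2 / 8 := by
        have := mul_nonneg (mul_nonneg hM' hδ) (sub_nonneg.2 h.le)
        nlinarith
      have := mul_le_mul_of_nonneg_left (Real.one_le_exp h5) hb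
      linarith
  · linarith

/-- The failure probability of the estimate from two series of runs. -/
theorem failureProb_le {p p' : ℝ} (hp : 0 ≤ p ∧ p ≤ 1) (hp' : 0 ≤ p' ∧ p' ≤ 1) {B : ℕ}
    (hB : 1 ≤ B) (v : ℂ) (hre : v.re = B * (2 * p - 1)) (him : v.im = B * (2 * p' - 1))
    {k s M : ℕ} (hk : 1 ≤ k) (hM : 128 * B ^ 2 * k ^ 2 * (s + 1) ≤ M) :
    failureProb p p' M B v (1 / (k : ℝ)) ≤ (1 / 2 : ℝ) ^ s := by
  classical
  have hB' : (1 : ℝ) ≤ B := by exact_mod_cast hB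
  have hk' : (1 : ℝ) ≤ k := by exact_mod_cast hk
  have hM0 : 0 < M := lt_of_lt_of_le (by positivity) hM
  -- After multiplication by `B`, the real and the imaginary part may each be off by `1 / (2 k)`.
  obtain ⟨δ, hδ⟩ : ∃ δ : ℝ, δ = 1 / (2 * k * B) := ⟨_, rfl⟩
  have hkB : (1 : ℝ) ≤ k * B := by nlinarith
  have hδ0 : 0 ≤ δ := by rw [hδ]; positivity
  have hδ1 : δ ≤ 1 := by
    rw [hδ, div_le_one (by positivity)]
    nlinarith
  have t1 := sum_runsProb_tail_le hp.1 hp.2 hδ0 hδ1 M hM0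
  have t2 := sum_runsProb_tail_le hp'.1 hp'.2 hδ0 hδ1 M hM0
  have h1 : failureProb p p' M B v (1 / (k : ℝ)) ≤
      (∑ b : Fin M → Bool, if δ < |runsMean b - (2 * p - 1)| then runsProb p b else 0) +
        ∑ b : Fin M → Bool, if δ < |runsMean b - (2 * p' - 1)| then runsProb p' b else 0 := by
    calc failureProb p p' M B v (1 / (k : ℝ)) ≤
        ∑ b : Fin M → Bool, ∑ b' : Fin M → Bool,
          ((if δ < |runsMean b - (2 * p - 1)| then runsProb p b else 0) * runsProb p' b' +
            runsProb p b * (if δ < |runsMean b' - (2 * p' - 1)| then runsProb p' b' else 0)) := by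
          unfold failureProb
          refine Finset.sum_le_sum fun b _ => Finset.sum_le_sum fun b' _ => ?_
          have r1 := runsProb_nonneg hp.1 hp.2 b
          have r2 := runsProb_nonneg hp'.1 hp'.2 b'
          by_cases c1 : δ < |runsMean b - (2 * p - 1)|
          · rw [if_pos c1]
            have : 0 ≤ runsProb p b * (if δ < |runsMean b' - (2 * p' - 1)| then runsProb p' b' else 0) := by
              split <;> positivity
            split
            · linarith
            · nlinarith
          · by_cases c2 : δ < |runsMean b' - (2 * p' - 1)|
            · rw [if_neg c1, if_pos c2, zero_mul, zero_add]
              split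
              · exact le_rfl
              · positivity
            · rw [if_neg c1, if_neg c2, if_neg]
              · simp
              · rw [not_lt] at c1 c2 ⊢
                refine (Complex.norm_le_abs_re_add_abs_im _).trans ?_
                have e1 : ((B : ℂ) * ((runsMean b : ℂ) + Complex.I * (runsMean b' : ℂ)) - v).re =
                    B * (runsMean b - (2 * p - 1)) := by
                  simp [hre]
                  ring
                have e2 : ((B : ℂ) * ((runsMean b : ℂ) + Complex.I * (runsMean b' : ℂ)) - v).im =
                    B * (runsMean b' - (2 * p' - 1)) := by
                  simp [him]
                  ring
                have e3 : 1 / (k : ℝ) = B * δ + B * δ := by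
                  rw [hδ]
                  field_simp
                  norm_num
                rw [e1, e2, abs_mul, abs_mul, abs_of_nonneg (by linarith : (0 : ℝ) ≤ B), e3]
                gcongr
      _ = _ := by
          simp only [Finset.sum_add_distrib, ← Finset.mul_sum, ← Finset.sum_mul, sum_runsProb,
            mul_one, one_mul]
  refine h1.trans ((add_le_add t1 t2).trans ?_)
  -- Since `δ^2 / 16 = 1 / (64 k^2 B^2)`, the constant `128` in the number of runs leaves the factor
  -- `2`.
  have h2 : 2 * ((s : ℝ) + 1) ≤ M * δ ^ 2 / 16 := by
    have : (128 * B ^ 2 * k ^ 2 * (s + 1) : ℝ) ≤ M := by exact_mod_cast hM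
    rw [hδ, div_pow, one_pow, mul_one_div, div_div, le_div_iff₀ (by positivity)]
    nlinarith
  -- The extra power of `1/4` absorbs the factor `4` from two tails of two series.
  have h3 : Real.exp (-(M * δ ^ 2 / 16)) ≤ (1 / 4 : ℝ) ^ (s + 1) := by
    have e1 : (1 / 4 : ℝ) = (1 / 2) ^ 2 := by norm_num
    have e2 : Real.exp (-1) ≤ 1 / 2 := by
      rw [Real.exp_neg, inv_le_comm₀ (Real.exp_pos _) (by norm_num)]
      have := Real.add_one_le_exp 1
      norm_num at this ⊢
      exact this
    calc Real.exp (-(M * δ ^ 2 / 16)) ≤ Real.exp (((2 * (s + 1) : ℕ) : ℝ) * -1) := by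
          rw [Real.exp_le_exp]
          push_cast
          linarith
      _ = Real.exp (-1) ^ (2 * (s + 1)) := Real.exp_nat_mul _ _
      _ ≤ (1 / 2) ^ (2 * (s + 1)) := pow_le_pow_left₀ (Real.exp_nonneg _) e2 _
      _ = (1 / 4 : ℝ) ^ (s + 1) := by rw [e1, ← pow_mul]
  have h4 : (1 / 4 : ℝ) ^ s ≤ (1 / 2 : ℝ) ^ s := by gcongr; norm_num
  rw [pow_succ (1 / 4 : ℝ)] at h3
  linarith

/-! ### Membership and hardness -/

theorem tocProblem_inDQC1 {A : Set ℕ} {l K κ B : ℕ} (hκ : K ≤ 2 ^ κ)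
    (hB : ∀ N ∈ A, (2 ^ κ) ^ N = B) : (tocProblem A l K).InDQC1 := by
  -- The phase exponent `3` serves the imaginary part, because `Re (i^3 z) = Im z`. The rescaling
  -- factor `(2^κ)^N` has to be the same `B` for all admissible `N`.
  refine ⟨TOCInstance.circuit κ 0, TOCInstance.circuit κ 3, Polynomial.C (κ + 1) * Polynomial.X, B,
    128 * B ^ 2, StackProgram.polyTime_circuit A l K κ 0, StackProgram.polyTime_circuit A l K κ 3,
    ?_⟩
  intro x k s M hk hM
  change TOCInstance A l K at x
  have hBx := hB _ x.number_mem
  have hR : seedLength κ x.probes ≤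
      (Polynomial.C (κ + 1) * Polynomial.X : Polynomial ℕ).eval ((encTOC x).length + k) := by
    refine (seedLength_le κ x.probes).trans ?_
    simp only [Polynomial.eval_mul, Polynomial.eval_C, Polynomial.eval_X, encTOC,
      List.length_append]
    exact Nat.mul_le_mul_left _ (by omega)
  have hB1 : 1 ≤ B := hBx ▸ Nat.one_le_pow _ _ (Nat.one_le_two_pow)
  have hB0 : (B : ℝ) ≠ 0 := by
    have : (1 : ℝ) ≤ B := by exact_mod_cast hB1
    linarith
  have hBc : ((2 : ℂ) ^ κ) ^ x.probes.length = (B : ℝ) := by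
    rw [← hBx]
    push_cast
    rfl
  refine failureProb_le (seededProb0_mem _ _) (seededProb0_mem _ _) hB1 _ ?_ ?_ hk hM
  · refine Eq.trans ?_ (congrArg (fun p => (B : ℝ) * (2 * p - 1))
      (seededProb0_circuit hκ x 0 k _ hR)).symm
    change x.correlation.re = _
    rw [hBc, pow_zero, one_mul, Complex.div_ofReal_re]
    field_simp
    ring
  · refine Eq.trans ?_ (congrArg (fun p => (B : ℝ) * (2 * p - 1))
      (seededProb0_circuit hκ x 3 k _ hR)).symm
    change x.correlation.im = _
    have : (Complex.I ^ 3 * (x.correlation / (B : ℝ))).re = x.correlation.im / B := by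
      rw [Complex.I_pow_three, ← Complex.div_ofReal_im]
      simp
    rw [hBc, this]
    field_simp
    ring

theorem polynomial_eval_mono (q : Polynomial ℕ) {a b : ℕ} (h : a ≤ b) : q.eval a ≤ q.eval b := by
  rw [Polynomial.eval_eq_sum, Polynomial.eval_eq_sum]
  exact Finset.sum_le_sum fun i _ => Nat.mul_le_mul_left _ (Nat.pow_le_pow_left h i)

/-- The bias differs from `0` by at least twice the promised gap, and the permitted error is at most
the gap itself, so the sign survives. Evaluating `Q + q` at `m`, which is at least the input length,
bounds both the size of the instance and the inverse of the gap. -/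
theorem tocProblem_hard {A : Set ℕ} {l K N : ℕ} (hN : N + 2 ∈ A) (hl : 1 ≤ l) (hK : 1 ≤ K) :
    (tocProblem A l K).DQC1Hard := by
  rintro L ⟨C, q, hC, hL⟩
  have hΦ := StackProgram.polyTime_instance hN hl hK hC
  obtain ⟨Q, hQ⟩ := hΦ.exists_length_le
  refine ⟨fun x => OneClean.toTOC hN hl hK (C x) x.length, Q + q, hΦ, fun x => ?_⟩
  have hm : x.length ≤ (OneClean.toTOC hN hl hK (C x) x.length).m := by
    simp only [OneClean.toTOC]
    omega
  change (encTOC (OneClean.toTOC hN hl hK (C x) x.length)).length ≤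
    (Q + q).eval (OneClean.toTOC hN hl hK (C x) x.length).m ∧ ∀ z : ℂ,
      ‖z - (OneClean.toTOC hN hl hK (C x) x.length).correlation‖ ≤
        1 / ((((Q + q).eval (OneClean.toTOC hN hl hK (C x) x.length).m : ℕ) : ℝ) + 1) → _
  have h1 := polynomial_eval_mono Q hm
  have h2 := polynomial_eval_mono q hm
  rw [Polynomial.eval_add]
  refine ⟨(hQ x).trans (by omega), fun z hz => ?_⟩
  have h3 : (1 : ℝ) / (((Q.eval (OneClean.toTOC hN hl hK (C x) x.length).m +
      q.eval (OneClean.toTOC hN hl hK (C x) x.length).m : ℕ) : ℝ) + 1) ≤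
      1 / (((q.eval x.length : ℕ) : ℝ) + 1) := by
    gcongr
    omega
  have h4 : (0 : ℝ) < 1 / (((q.eval x.length : ℕ) : ℝ) + 1) := by positivity
  have h5 := abs_le.1 ((Complex.abs_re_le_norm _).trans (hz.trans h3))
  rw [Complex.sub_re, re_correlation_toTOC] at h5
  obtain ⟨hy, hn⟩ := hL x
  constructor
  · intro hx
    have := hy hx
    linarith [h5.1]
  · intro hx
    have := hn hx
    linarith [h5.2]

theorem corollary2 (l : ℕ) (hl : 1 ≤ l) :
    (tocProblem Set.univ l 1).DQC1Complete ∧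
    ∀ N K : ℕ, 2 ≤ N → 1 ≤ K → (tocProblem {N} l K).DQC1Complete := by
  -- For Pauli norm at most `1` no rescaling is needed, whatever `N` is. For fixed `N` the choice `κ
  -- = K` is wasteful but sufficient, since `K ≤ 2^K`.
  refine ⟨⟨tocProblem_inDQC1 (κ := 0) (B := 1) le_rfl (by simp),
    tocProblem_hard (N := 0) (Set.mem_univ _) hl le_rfl⟩, fun N K hN hK => ?_⟩
  obtain ⟨N, rfl⟩ := Nat.exists_eq_add_of_le' hN
  exact ⟨tocProblem_inDQC1 (κ := K) (B := (2 ^ K) ^ (N + 2)) Nat.lt_two_pow_self.le (by simp),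
    tocProblem_hard (N := N) rfl hl hK⟩
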